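/- Let $N$ be a complete (connected) smooth Riemannian manifold, let $m\ge 3$, and let $\varphi:M\to N\times\mathbb{R}$ be a smooth immersion of a non-empty compact $m$-dimensional manifold $M$ (without boundary) into the Riemannian product $N\times\mathbb{R}$. Let $H=\sum_{i=1}^m\alpha(e_i,e_i)$ be its mean curvature vector, where $\alpha$ is the second fundamental form and $e_1,\dots,e_m$ is an orthonormal basis of $T_xM$ for the induced metric. Let $p_1:N\times\mathbb{R}\to N$ be the projection and write $p_1(M)=p_1(\varphi(M))$. For $\kappa\in\mathbb{R}$ let $S_\kappa(t)=\sin(\sqrt{\kappa}\,t)/\sqrt{\kappa}$ if $\kappa>0$, $S_\kappa(t)=t$ if $\kappa=0$, $S_\kappa(t)=\sinh(\sqrt{-\kappa}\,t)/\sqrt{-\kappa}$ if $\kappa<0$, and let $C_\kappa=S_\kappa'$. The function $C_\kappa/S_\kappa$ is injective on $(0,\pi/\sqrt{\kappa})$ (on $(0,\infty)$ if $\kappa\le 0$), and $(C_\kappa/S_\kappa)^{-1}$ denotes its inverse there. (1) Let $x_0\in N$ be a point such that the radial sectional curvatures of $N$ along the geodesics issuing from $x_0$ are at most $\kappa$: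 $K(\gamma'(t),v)\le\kappa$ for every unit-speed geodesic $\gamma$ with $\gamma(0)=x_0$, every $t>0$ in its domain, and every unit vector $v\perp\gamma'(t)$. Let $R$ be the radius of the smallest closed ball with centre $x_0$ that contains $p_1(M)$. If $R<\mathrm{inj}_N(x_0)$, then $\sup_M|H|/(m-2)$ is a value of $C_\kappa/S_\kappa$ on the above interval and $$R\ \ge\ \Big(\frac{C_\kappa}{S_\kappa}\Big)^{-1}\Big(\frac{\sup_M|H|}{m-2}\Big).$$ (2) Suppose that the radial curvature condition in (1) holds at every point of $N$ (that is, the sectional curvatures of $N$ are at most $\kappa$), and let $R_{p_1(M)}$ be the infimum of the radii of the balls of $N$, of any centre, that contain $p_1(M)$. If $R_{p_1(M)}<\inf_{x\in N}\mathrm{inj}_N(x)$, then $\sup_M|H|/(m-2)$ is a value of $C_\kappa/S_\kappa$ on the above interval and $$R_{p_1(M)}\ \ge\ \Big(\frac{C_\kappa}{S_\kappa}\Big)^{-1}\Big(\frac{\sup_M|H|}{m-2}\Big).$$ -/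

import Mathlib

open Set Manifold Bundle
open scoped ContDiff ENNReal

noncomputable section

/-! ### The functions `S_κ`, `C_κ = S_κ'` and the inverse of `C_κ / S_κ` -/

/-- `S_κ(t)`: the solution of `S'' + κ S = 0`, `S(0) = 0`, `S'(0) = 1`. -/
def snK (κ t : ℝ) : ℝ :=
  if 0 < κ then Real.sin (√κ * t) / √κ
  else if κ < 0 then Real.sinh (√(-κ) * t) / √(-κ)
  else t

/-- `C_κ = S_κ'`. -/
def csK (κ t : ℝ) : ℝ := deriv (snK κ) t

/-- The quotient `C_κ / S_κ`. -/
def ctK (κ t : ℝ) : ℝ := csK κ t / snK κ t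

/-- The interval on which `C_κ / S_κ` is considered: `(0, π / √κ)` for `κ > 0`, and `(0, ∞)` for
`κ ≤ 0`. -/
def ctDomain (κ : ℝ) : Set ℝ := {t | 0 < t ∧ (0 < κ → t < Real.pi / √κ)}

theorem csK_eq (κ t : ℝ) : csK κ t =
    if 0 < κ then Real.cos (√κ * t) else if κ < 0 then Real.cosh (√(-κ) * t) else 1 := by
  unfold csK
  rcases lt_trichotomy κ 0 with h | h | h
  · have h0 : √(-κ) ≠ 0 := (Real.sqrt_pos.2 (by linarith)).ne'
    have : snK κ = fun t => Real.sinh (√(-κ) * t) / √(-κ) := by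
      funext t; simp [snK, h, not_lt.2 h.le]
    rw [this]
    have hd : HasDerivAt (fun t => Real.sinh (√(-κ) * t) / √(-κ))
        (Real.cosh (√(-κ) * t) * (√(-κ) * 1) / √(-κ)) t :=
      (((hasDerivAt_id t).const_mul (√(-κ))).sinh).div_const _
    rw [hd.deriv, if_neg (not_lt.2 h.le), if_pos h]
    field_simp
  · subst h
    have : snK 0 = fun t => t := by funext t; simp [snK]
    rw [this]; simp
  · have h0 : √κ ≠ 0 := (Real.sqrt_pos.2 h).ne'
    have : snK κ = fun t => Real.sin (√κ * t) / √κ := by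
      funext t; simp [snK, h]
    rw [this]
    have hd : HasDerivAt (fun t => Real.sin (√κ * t) / √κ)
        (Real.cos (√κ * t) * (√κ * 1) / √κ) t :=
      (((hasDerivAt_id t).const_mul (√κ)).sin).div_const _
    rw [hd.deriv, if_pos h]
    field_simp

/-- `C_κ / S_κ` is injective on its interval, so that its inverse is well defined. -/
theorem ctK_injOn (κ : ℝ) : InjOn (ctK κ) (ctDomain κ) := by
  rintro a ⟨ha, ha'⟩ b ⟨hb, hb'⟩ hab
  simp only [ctK, csK_eq, snK] at hab
  rcases lt_trichotomy κ 0 with h | h | h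
  · have h0 : 0 < √(-κ) := Real.sqrt_pos.2 (by linarith)
    have h1 : 0 < Real.sinh (√(-κ) * a) := Real.sinh_pos_iff.2 (by positivity)
    have h2 : 0 < Real.sinh (√(-κ) * b) := Real.sinh_pos_iff.2 (by positivity)
    simp only [not_lt.2 h.le, h, if_true, if_false] at hab
    have h3 : Real.sinh (√(-κ) * a - √(-κ) * b) = 0 := by
      rw [Real.sinh_sub]
      field_simp at hab
      linarith
    have h4 := Real.sinh_eq_zero.1 h3
    have h5 : √(-κ) * (a - b) = 0 := by linarith
    rcases mul_eq_zero.1 h5 with h6 | h6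
    · exact absurd h6 h0.ne'
    · linarith
  · subst h
    simpa using hab
  · have h0 : 0 < √κ := Real.sqrt_pos.2 h
    have ha2 : √κ * a < Real.pi := by
      have := ha' h; rw [lt_div_iff₀ h0] at this; linarith
    have hb2 : √κ * b < Real.pi := by
      have := hb' h; rw [lt_div_iff₀ h0] at this; linarith
    have ha3 : 0 < √κ * a := by positivity
    have hb3 : 0 < √κ * b := by positivity
    have h1 : 0 < Real.sin (√κ * a) := Real.sin_pos_of_pos_of_lt_pi ha3 ha2
    have h2 : 0 < Real.sin (√κ * b) := Real.sin_pos_of_pos_of_lt_pi hb3 hb2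
    simp only [h, if_true] at hab
    have h3 : Real.sin (√κ * a - √κ * b) = 0 := by
      rw [Real.sin_sub]
      field_simp at hab
      linarith
    have h4 := (Real.sin_eq_zero_iff_of_lt_of_lt (by linarith) (by linarith)).1 h3
    have h5 : √κ * (a - b) = 0 := by linarith
    rcases mul_eq_zero.1 h5 with h6 | h6
    · exact absurd h6 h0.ne'
    · linarith

/-- The inverse function `(C_κ / S_κ)⁻¹`; it is meaningful at the values of `C_κ / S_κ` on
`ctDomain κ`. -/
def ctInv (κ s : ℝ) : ℝ := Function.invFunOn (ctK κ) (ctDomain κ) s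

/-! ### Riemannian geometry in charts

The tangent space `TangentSpace I x` is, as in Mathlib, the model space `E` through the preferred
chart at `x`. -/

section Riemannian

variable {E : Type*} [NormedAddCommGroup E] [NormedSpace ℝ E]
  {H : Type*} [TopologicalSpace H] (I : ModelWithCorners ℝ E H)
  (W : Type*) [TopologicalSpace W] [ChartedSpace H W]

/-- A field of scalar-valued functions of two tangent vectors (used for Riemannian metrics). -/
abbrev MetricField := ∀ x : W, TangentSpace I x → TangentSpace I x → ℝ

/-- The metric of a Riemannian manifold as a `MetricField`. -/
def riemannianMetric [RiemannianBundle (fun x : W => TangentSpace I x)] : MetricField I W :=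
  fun _ u v => inner ℝ u v

variable {I W}

/-- The product metric on `W × ℝ`, `⟨u, v⟩ = g (dp₁ u, dp₁ v) + dp₂ u * dp₂ v`. -/
def prodLineMetric (g : MetricField I W) : MetricField (I.prod 𝓘(ℝ, ℝ)) (W × ℝ) :=
  fun p u v =>
    g p.1 (mfderiv (I.prod 𝓘(ℝ, ℝ)) I Prod.fst p u) (mfderiv (I.prod 𝓘(ℝ, ℝ)) I Prod.fst p v)
    + (show ℝ from mfderiv (I.prod 𝓘(ℝ, ℝ)) 𝓘(ℝ, ℝ) Prod.snd p u)
      * (show ℝ from mfderiv (I.prod 𝓘(ℝ, ℝ)) 𝓘(ℝ, ℝ) Prod.snd p v)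

/-- The coordinate expression, in the chart at `p`, of a metric `g` at the point with
coordinates `y`. -/
def chartMetric (g : MetricField I W) (p : W) (y u v : E) : ℝ :=
  g ((extChartAt I p).symm y)
    (mfderiv 𝓘(ℝ, E) I (extChartAt I p).symm y u)
    (mfderiv 𝓘(ℝ, E) I (extChartAt I p).symm y v)

/-- The Christoffel symbols of the first kind in the chart at `p`:
`(1/2) (∂_u g(v, w) + ∂_v g(u, w) - ∂_w g(u, v))` for coordinate vectors `u, v, w`. -/
def christoffelFirst (g : MetricField I W) (p : W) (y u v w : E) : ℝ :=
  (1 / 2) * (fderiv ℝ (fun z => chartMetric g p z v w) y u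
    + fderiv ℝ (fun z => chartMetric g p z u w) y v
    - fderiv ℝ (fun z => chartMetric g p z u v) y w)

variable [FiniteDimensional ℝ E]

/-- The Gram matrix `g_{ij}` in the chart at `p`. -/
def chartGram (g : MetricField I W) (p : W) (y : E) :
    Matrix (Fin (Module.finrank ℝ E)) (Fin (Module.finrank ℝ E)) ℝ :=
  Matrix.of fun i j => chartMetric g p y (Module.finBasis ℝ E i) (Module.finBasis ℝ E j)

/-- The Christoffel symbols of the second kind: `Γ(u, v) = u^i v^j Γ_{ij}^k ∂_k`, i.e. the
coordinate vector of the Levi-Civita derivative `∇_u v` of constant coordinate fields. -/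
def christoffel (g : MetricField I W) (p : W) (y u v : E) : E :=
  ∑ i, ∑ j, ((chartGram g p y)⁻¹ i j * christoffelFirst g p y u v (Module.finBasis ℝ E j)) •
    Module.finBasis ℝ E i

/-- The velocity of a curve. -/
def velocity (γ : ℝ → W) (t : ℝ) : TangentSpace I (γ t) :=
  mfderiv 𝓘(ℝ, ℝ) I γ t (1 : ℝ)

/-- The covariant acceleration `∇_{γ'} γ'` at time `t`, computed in the chart at `γ t`. -/
def covAccel (g : MetricField I W) (γ : ℝ → W) (t : ℝ) : TangentSpace I (γ t) :=
  (deriv (deriv fun s => extChartAt I (γ t) (γ s)) t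
    + christoffel g (γ t) (extChartAt I (γ t) (γ t))
        (deriv (fun s => extChartAt I (γ t) (γ s)) t)
        (deriv (fun s => extChartAt I (γ t) (γ s)) t) : E)

/-- `γ` is a geodesic on the open set `s` of times. -/
def IsGeodesicOn (g : MetricField I W) (γ : ℝ → W) (s : Set ℝ) : Prop :=
  ContMDiffOn 𝓘(ℝ, ℝ) I ∞ γ s ∧ ∀ t ∈ s, covAccel g γ t = 0

/-- The Riemann curvature tensor `R(u, v) w = ∇_u ∇_v w - ∇_v ∇_u w - ∇_{[u, v]} w` at `x`,
computed in the chart at `x` with constant coordinate fields. -/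
def riemannTensor (g : MetricField I W) (x : W) (u v w : TangentSpace I x) : TangentSpace I x :=
  let y : E := extChartAt I x x
  (fderiv ℝ (fun z => christoffel g x z v w) y u - fderiv ℝ (fun z => christoffel g x z u w) y v
    + christoffel g x y u (christoffel g x y v w)
    - christoffel g x y v (christoffel g x y u w) : E)

/-- The sectional curvature of the plane spanned by `u` and `v`. -/
def sectionalCurvature (g : MetricField I W) (x : W) (u v : TangentSpace I x) : ℝ :=
  g x (riemannTensor g x u v v) u / (g x u u * g x v v - g x u v ^ 2)

/-- The radial sectional curvatures along the geodesics issuing from `x₀` are at most `κ`. -/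
def RadialCurvatureLE (g : MetricField I W) (x₀ : W) (κ : ℝ) : Prop :=
  ∀ (γ : ℝ → W) (a b : ℝ), a < 0 → 0 < b → IsGeodesicOn g γ (Ioo a b) → γ 0 = x₀ →
    g (γ 0) (velocity γ 0) (velocity γ 0) = 1 →
    ∀ t ∈ Ioo 0 b, ∀ v : TangentSpace I (γ t),
      g (γ t) v v = 1 → g (γ t) (velocity γ t) v = 0 →
      sectionalCurvature g (γ t) (velocity γ t) v ≤ κ

/-- The exponential map at `x₀` is defined on the open ball of radius `r` of the tangent space
`T_{x₀} W` and is a diffeomorphism from this ball onto its image, an open set. The map `Φ` is the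
exponential map: it sends the rays `t ↦ t u`, `u` a unit vector, to the geodesics with initial
velocity `u`. -/
def IsNormalRadius (g : MetricField I W) (x₀ : W) (r : ℝ) : Prop :=
  ∃ Φ : OpenPartialHomeomorph E W,
    Φ.source = {v : E | g x₀ (v : TangentSpace I x₀) (v : TangentSpace I x₀) < r ^ 2} ∧
    ContMDiffOn 𝓘(ℝ, E) I ∞ Φ Φ.source ∧
    ContMDiffOn I 𝓘(ℝ, E) ∞ Φ.symm Φ.target ∧
    Φ 0 = x₀ ∧
    ∀ u : TangentSpace I x₀, g x₀ u u = 1 →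
      IsGeodesicOn g (fun t : ℝ => Φ (t • (u : E))) (Ioo (-r) r) ∧
      (⟨Φ ((0 : ℝ) • (u : E)), velocity (fun t : ℝ => Φ (t • (u : E))) 0⟩ : TangentBundle I W) =
        ⟨x₀, u⟩

/-- The injectivity radius at `x₀`. -/
def injRadius (g : MetricField I W) (x₀ : W) : ℝ≥0∞ :=
  ⨆ (r : ℝ) (_ : 0 < r ∧ IsNormalRadius g x₀ r), ENNReal.ofReal r

end Riemannian

/-! ### Immersed submanifolds and the mean curvature vector -/

section Immersion

variable {E' : Type*} [NormedAddCommGroup E'] [NormedSpace ℝ E'] [FiniteDimensional ℝ E']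
  {H' : Type*} [TopologicalSpace H'] {J : ModelWithCorners ℝ E' H'}
  {M : Type*} [TopologicalSpace M] [ChartedSpace H' M]
  {E : Type*} [NormedAddCommGroup E] [NormedSpace ℝ E] [FiniteDimensional ℝ E]
  {H : Type*} [TopologicalSpace H] {I : ModelWithCorners ℝ E H}
  {W : Type*} [TopologicalSpace W] [ChartedSpace H W]

variable (J I) in
/-- A smooth immersion of finite-dimensional manifolds: a smooth map with injective
differentials. -/
def IsSmoothImmersion (φ : M → W) : Prop :=
  ContMDiff J I ∞ φ ∧ ∀ x, Function.Injective (mfderiv J I φ x)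

/-- The Gram matrix of the induced metric on `T_x M`, in the coordinate basis of the chart
at `x`. -/
def inducedGram (g : MetricField I W) (φ : M → W) (x : M) :
    Matrix (Fin (Module.finrank ℝ E')) (Fin (Module.finrank ℝ E')) ℝ :=
  Matrix.of fun i j => g (φ x)
    (mfderiv J I φ x (Module.finBasis ℝ E' i)) (mfderiv J I φ x (Module.finBasis ℝ E' j))

/-- The component of `a ∈ T_{φ x} W` normal to `dφ (T_x M)`. -/
def normalPart (g : MetricField I W) (φ : M → W) (x : M) (a : TangentSpace I (φ x)) :
    TangentSpace I (φ x) :=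
  a - ∑ i, ∑ j, ((inducedGram (J := J) g φ x)⁻¹ i j
      * g (φ x) a (mfderiv J I φ x (Module.finBasis ℝ E' j))) •
    mfderiv J I φ x (Module.finBasis ℝ E' i)

/-- The second fundamental form `α(u, v) = (∇_u dφ(v))^⊥` of an immersion, where the covariant
derivative is computed in the charts at `x` and `φ x`, with `v` extended as a constant coordinate
field. -/
def secondFundamentalForm (g : MetricField I W) (φ : M → W) (x : M) (u v : TangentSpace J x) :
    TangentSpace I (φ x) :=
  let F : E' → E := fun z => extChartAt I (φ x) (φ ((extChartAt J x).symm z))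
  let y : E' := extChartAt J x x
  normalPart (J := J) g φ x
    (fderiv ℝ (fun z => fderiv ℝ F z v) y u
      + christoffel g (φ x) (F y) (fderiv ℝ F y u) (fderiv ℝ F y v) : E)

/-- The mean curvature vector: the (unnormalized) trace of the second fundamental form with respect
to the induced metric, `∑ α(e_i, e_i)` for an orthonormal basis `e_i` of `T_x M`. -/
def meanCurvatureVector (g : MetricField I W) (φ : M → W) (x : M) : TangentSpace I (φ x) :=
  ∑ i, ∑ j, (inducedGram (J := J) g φ x)⁻¹ i j •
    secondFundamentalForm (J := J) g φ x (Module.finBasis ℝ E' i) (Module.finBasis ℝ E' j)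

variable (J) in
/-- `|H|(x)`. -/
def meanCurvatureNorm (g : MetricField I W) (φ : M → W) (x : M) : ℝ :=
  √(g (φ x) (meanCurvatureVector (J := J) g φ x) (meanCurvatureVector (J := J) g φ x))

variable (J) in
/-- `sup_M |H|`. -/
def supMeanCurvature (g : MetricField I W) (φ : M → W) : ℝ :=
  ⨆ x : M, meanCurvatureNorm J g φ x

end Immersion

/-! ### Extrinsic radius -/

/-- The radius of the smallest closed ball with centre `x₀` that contains `A`. -/
def extrinsicRadiusAt {X : Type*} [MetricSpace X] (x₀ : X) (A : Set X) : ℝ :=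
  sInf {r : ℝ | A ⊆ Metric.closedBall x₀ r}

/-- The extrinsic radius of `A`: the infimum of the radii of the balls, of any centre, that
contain `A`. -/
def extrinsicRadius {X : Type*} [MetricSpace X] (A : Set X) : ℝ :=
  sInf {r : ℝ | ∃ x : X, A ⊆ Metric.closedBall x r}

end

/-! The estimate is a maximum principle at the point of `M` farthest from `x₀`. Since `R` is below
the injectivity radius, `p₁(M)` lies in a normal ball around `x₀`, where the half squared radial
coordinate `f(v) = G 0 v v / 2` is smooth. By compactness `f ∘ p₁ ∘ φ` has a maximum, at radius `ρ`.
There `df` kills the tangent space of `M`, so the normal projection in the mean curvature vector is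
invisible to `df`, and nonpositivity of the second derivative gives `df(H) ≤ -∑ Hess f (e_i, e_i)`
for an orthonormal frame (`IsMetricOn.fderiv_flatMeanCurvature_le`).

Criticality also makes the `N`-components of the `e_i` orthogonal to the radial direction. Hessian
comparison (`IsNormalMetric.le_hessian`, resting on the Gauss lemma and the Jacobi equation)
therefore bounds each term below by `ρ ctK κ ρ` times the squared length of that component. The
squared line components sum to at most `1` by Bessel, so if `ctK κ ρ > 0` the sum is at least `ρ ctK
κ ρ (m - 1)`. On the other side, the Gauss lemma and Cauchy–Schwarz give `|df(H)| ≤ ρ |H|`. Hence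
`ctK κ ρ (m - 2) ≤ |H|` at this point (`IsNormalMetric.ctK_mul_le_flatMeanCurvature`), trivially so
when `ctK κ ρ ≤ 0`.

Finally `ρ ≤ R`: a curve leaving the centre is at least as long as the radial coordinate it reaches
(`IsNormalMetric.mem_target_of_dist_lt`). As `ctK κ` decreases from `+∞`, the bound inverts
(`ctInv_le_of_ctK_le`); if `ρ` lies beyond `π / √κ` the conclusion holds for free. The statement for
arbitrary centres follows by applying the fixed-centre one to nearly optimal centres.

Computations take place in open subsets of a vector space, with the metric as a function valued in
bilinear forms. Charts and normal coordinates are related by local isometries, and the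
transformation law of the Christoffel symbols carries geodesics, curvature and mean curvature
between them. -/

noncomputable section

set_option maxSynthPendingDepth 3

/-! ### Riemannian metrics on open subsets of a vector space -/

section FlatMetric

attribute [-instance]
  Bundle.instNormedAddCommGroupOfRiemannianBundleOfIsTopologicalAddGroupOfContinuousConstSMulReal
  Bundle.instInnerProductSpaceReal

variable {E : Type*} [NormedAddCommGroup E] [NormedSpace ℝ E]

/-- `h` is a smooth Riemannian metric on the open subset `U` of the vector space `E`. -/
structure IsMetricOn (h : E → E →L[ℝ] E →L[ℝ] ℝ) (U : Set E) : Prop where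
  isOpen : IsOpen U
  contDiffOn : ContDiffOn ℝ ∞ h U
  symm : ∀ y ∈ U, ∀ a b, h y a b = h y b a
  pos : ∀ y ∈ U, ∀ a, a ≠ 0 → 0 < h y a a

/-- The Christoffel symbols of the first kind of `h`, as a trilinear form. -/
def lcFirst (h : E → E →L[ℝ] E →L[ℝ] ℝ) (y : E) : E →L[ℝ] E →L[ℝ] E →L[ℝ] ℝ :=
  (1 / 2 : ℝ) • (fderiv ℝ h y + (fderiv ℝ h y).flip
    - ((ContinuousLinearMap.flipₗᵢ ℝ E E ℝ).toContinuousLinearEquiv : (E →L[ℝ] E →L[ℝ] ℝ) →L[ℝ] E →L[ℝ] E →L[ℝ] ℝ).comp (fderiv ℝ h y).flip)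

/-- The Christoffel symbols of the second kind of `h`, as a bilinear map. -/
def lcSecond (h : E → E →L[ℝ] E →L[ℝ] ℝ) (y : E) : E →L[ℝ] E →L[ℝ] E :=
  (ContinuousLinearMap.compL ℝ E (E →L[ℝ] ℝ) E (h y).inverse).comp (lcFirst h y)

/-- The curvature tensor of a bilinear connection form `Γ`. -/
def connCurv (Γ : E → E →L[ℝ] E →L[ℝ] E) (y u v w : E) : E :=
  fderiv ℝ Γ y u v w - fderiv ℝ Γ y v u w + Γ y u (Γ y v w) - Γ y v (Γ y u w)

theorem lcFirst_apply (h : E → E →L[ℝ] E →L[ℝ] ℝ) (y a b c : E) :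
    lcFirst h y a b c
      = (1 / 2) * (fderiv ℝ h y a b c + fderiv ℝ h y b a c - fderiv ℝ h y c a b) := by
  simp [lcFirst]

namespace IsMetricOn

variable {h : E → E →L[ℝ] E →L[ℝ] ℝ} {U : Set E} {y : E}

theorem nonneg (hh : IsMetricOn h U) (hy : y ∈ U) (a : E) : 0 ≤ h y a a := by
  by_cases ha : a = 0
  · simp [ha]
  · exact (hh.pos y hy a ha).le

theorem eq_of_forall (hh : IsMetricOn h U) (hy : y ∈ U) {a b : E}
    (hab : ∀ c, h y a c = h y b c) : a = b := by
  by_contra hne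
  have h1 := hh.pos y hy (a - b) (sub_ne_zero.2 hne)
  have h2 : h y (a - b) (a - b) = 0 := by
    have h3 : h y (a - b) = 0 := by ext c; simp [hab]
    rw [h3]; rfl
  exact h1.ne' h2

theorem mem_nhds (hh : IsMetricOn h U) (hy : y ∈ U) : U ∈ nhds y := hh.isOpen.mem_nhds hy

theorem contDiffAt (hh : IsMetricOn h U) (hy : y ∈ U) : ContDiffAt ℝ ∞ h y :=
  hh.contDiffOn.contDiffAt (hh.mem_nhds hy)

theorem hasFDerivAt (hh : IsMetricOn h U) (hy : y ∈ U) : HasFDerivAt h (fderiv ℝ h y) y :=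
  ((hh.contDiffAt hy).differentiableAt (by simp)).hasFDerivAt

theorem hasFDerivAt_apply (hh : IsMetricOn h U) (hy : y ∈ U) (a b : E) :
    HasFDerivAt (fun z => h z a b) (((fderiv ℝ h y).flip a).flip b) y := by
  have h1 := ((hh.hasFDerivAt hy).clm_apply (hasFDerivAt_const a y)).clm_apply
    (hasFDerivAt_const b y)
  refine h1.congr_fderiv ?_
  ext c; simp

theorem fderiv_symm (hh : IsMetricOn h U) (hy : y ∈ U) (c a b : E) :
    fderiv ℝ h y c a b = fderiv ℝ h y c b a := by
  have h1 := hh.hasFDerivAt_apply hy a b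
  have h2 := hh.hasFDerivAt_apply hy b a
  have h3 : (fun z => h z a b) =ᶠ[nhds y] fun z => h z b a := by
    filter_upwards [hh.mem_nhds hy] with z hz using hh.symm z hz a b
  have := (h1.congr_of_eventuallyEq h3.symm).unique h2
  simpa using congrArg (fun L => L c) this

theorem cauchy_schwarz (hh : IsMetricOn h U) (hy : y ∈ U) (a b : E) :
    h y a b ^ 2 ≤ h y a a * h y b b := by
  by_cases hb : b = 0
  · simp [hb]
  have hp := hh.pos y hy b hb
  -- This vector is `h y b b` times the component of `a` orthogonal to `b`, which clears the
  -- denominator in the usual proof.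
  have h1 := hh.nonneg hy ((h y b b) • a - (h y a b) • b)
  simp only [map_sub, map_smul, sub_apply, smul_apply,
    smul_eq_mul, hh.symm y hy b a] at h1
  have h2 : 0 ≤ h y b b * (h y a a * h y b b - h y a b ^ 2) := by nlinarith
  have := nonneg_of_mul_nonneg_right h2 hp
  linarith

theorem contDiffOn_lcFirst (hh : IsMetricOn h U) : ContDiffOn ℝ ∞ (lcFirst h) U := by
  have h1 : ContDiffOn ℝ ∞ (fderiv ℝ h) U := hh.contDiffOn.fderiv_of_isOpen hh.isOpen (by simp)
  have hf : ContDiffOn ℝ ∞ (fun y => (fderiv ℝ h y).flip) U :=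
    (ContinuousLinearMap.flipₗᵢ ℝ E E (E →L[ℝ] ℝ)).contDiff.comp_contDiffOn h1
  exact ((h1.add hf).sub (contDiffOn_const.clm_comp hf)).const_smul _

variable [FiniteDimensional ℝ E]

/-- Nondegeneracy makes `h y` injective into the dual, which has the same finite dimension. This
ensures that `.inverse` in `lcSecond` is a true inverse on `U`. -/
theorem isInvertible (hh : IsMetricOn h U) (hy : y ∈ U) : (h y).IsInvertible := by
  have hinj : Function.Injective ((h y : E →ₗ[ℝ] E →L[ℝ] ℝ)) := by
    intro a b hab
    exact hh.eq_of_forall hy fun c => congrArg (fun L : E →L[ℝ] ℝ => L c) hab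
  have hfr : Module.finrank ℝ E = Module.finrank ℝ (E →L[ℝ] ℝ) := by
    rw [← (LinearMap.toContinuousLinearMap (𝕜 := ℝ) (E := E) (F' := ℝ)).finrank_eq]
    exact (Subspace.dual_finrank_eq).symm
  refine ⟨(LinearMap.linearEquivOfInjective _ hinj hfr).toContinuousLinearEquiv, ?_⟩
  ext a b
  simp

theorem lcSecond_apply (hh : IsMetricOn h U) (hy : y ∈ U) (a b c : E) :
    h y (lcSecond h y a b) c = lcFirst h y a b c := by
  have := (hh.isInvertible hy).self_comp_inverse
  have h2 := congrArg (fun L => L (lcFirst h y a b)) this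
  simp only [ContinuousLinearMap.comp_apply] at h2
  simp only [lcSecond, ContinuousLinearMap.comp_apply, ContinuousLinearMap.compL_apply]
  rw [h2]; rfl

theorem eq_lcSecond (hh : IsMetricOn h U) (hy : y ∈ U) {a b x : E}
    (hx : ∀ c, h y x c = lcFirst h y a b c) : x = lcSecond h y a b :=
  hh.eq_of_forall hy fun c => by rw [hx, hh.lcSecond_apply hy]

theorem lcSecond_symm (hh : IsMetricOn h U) (hy : y ∈ U) (a b : E) :
    lcSecond h y a b = lcSecond h y b a :=
  hh.eq_lcSecond hy fun c => by
    rw [hh.lcSecond_apply hy, lcFirst_apply, lcFirst_apply, hh.fderiv_symm hy c a b]; ring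

/-- Metric compatibility of the Levi-Civita connection. -/
theorem fderiv_eq (hh : IsMetricOn h U) (hy : y ∈ U) (a b c : E) :
    fderiv ℝ h y a b c = h y (lcSecond h y a b) c + h y b (lcSecond h y a c) := by
  rw [hh.symm y hy b, hh.lcSecond_apply hy, hh.lcSecond_apply hy, lcFirst_apply, lcFirst_apply,
    hh.fderiv_symm hy a b c, hh.fderiv_symm hy b a c, hh.fderiv_symm hy c a b]
  ring

theorem contDiffOn_lcSecond (hh : IsMetricOn h U) : ContDiffOn ℝ ∞ (lcSecond h) U := by
  have hi : ContDiffOn ℝ ∞ (fun y => (h y).inverse) U := by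
    intro y hy
    have := (hh.isInvertible hy).contDiffAt_map_inverse (n := ∞)
    exact this.comp_contDiffWithinAt y (hh.contDiffOn y hy)
  exact ((ContinuousLinearMap.compL ℝ E (E →L[ℝ] ℝ) E).contDiff.comp_contDiffOn hi).clm_comp
    hh.contDiffOn_lcFirst

theorem hasFDerivAt_lcSecond (hh : IsMetricOn h U) (hy : y ∈ U) :
    HasFDerivAt (lcSecond h) (fderiv ℝ (lcSecond h) y) y :=
  ((hh.contDiffOn_lcSecond.contDiffAt (hh.mem_nhds hy)).differentiableAt (by simp)).hasFDerivAt

/-- The curvature operators are skew-symmetric. -/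
theorem connCurv_skew (hh : IsMetricOn h U) (hy : y ∈ U) (a b c d : E) :
    h y (connCurv (lcSecond h) y a b c) d = - h y c (connCurv (lcSecond h) y a b d) := by
  set Γ := lcSecond h with hΓ
  -- Metric compatibility is differentiated a second time. The second derivative of `h` is symmetric
  -- in `a` and `b` (`hs` below); on exchanging them and subtracting, the mixed terms `h(Γ a c, Γ b
  -- d)` cancel and the skew-symmetry of the curvature remains.
  have hd : ∀ a b, fderiv ℝ (fun z => fderiv ℝ h z b c d) y a
      = fderiv ℝ h y a (Γ y b c) d + h y (fderiv ℝ Γ y a b c) d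
        + (fderiv ℝ h y a c (Γ y b d) + h y c (fderiv ℝ Γ y a b d)) := by
    intro a b
    have he : (fun z => fderiv ℝ h z b c d) =ᶠ[nhds y]
        fun z => h z (Γ z b c) d + h z c (Γ z b d) := by
      filter_upwards [hh.mem_nhds hy] with z hz using hh.fderiv_eq hz b c d
    rw [he.fderiv_eq]
    have hG : ∀ c, HasFDerivAt (fun z => Γ z b c) (((fderiv ℝ Γ y).flip b).flip c) y := by
      intro c
      refine (((hh.hasFDerivAt_lcSecond hy).clm_apply (hasFDerivAt_const b y)).clm_apply
        (hasFDerivAt_const c y)).congr_fderiv ?_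
      ext; simp [hΓ]
    have h1 := (((hh.hasFDerivAt hy).clm_apply (hG c)).clm_apply (hasFDerivAt_const d y)).add
      (((hh.hasFDerivAt hy).clm_apply (hasFDerivAt_const c y)).clm_apply (hG d))
    erw [h1.fderiv]
    simp
    ring
  have hs : fderiv ℝ (fun z => fderiv ℝ h z b c d) y a
      = fderiv ℝ (fun z => fderiv ℝ h z a c d) y b := by
    have hsym : IsSymmSndFDerivAt ℝ h y :=
      (hh.contDiffAt hy).isSymmSndFDerivAt (by simpa using ENat.LEInfty.out)
    have h2 : HasFDerivAt (fderiv ℝ h) (fderiv ℝ (fderiv ℝ h) y) y :=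
      (((hh.contDiffAt hy).fderiv_right (m := 1) (by norm_cast)).differentiableAt
        (by simp)).hasFDerivAt
    have h3 : ∀ a b, fderiv ℝ (fun z => fderiv ℝ h z b c d) y a
        = fderiv ℝ (fderiv ℝ h) y a b c d := by
      intro a b
      rw [(((h2.clm_apply (hasFDerivAt_const b y)).clm_apply (hasFDerivAt_const c y)).clm_apply
        (hasFDerivAt_const d y)).fderiv]
      simp
    rw [h3, h3, hsym.eq a b]
  rw [hd, hd, hh.fderiv_eq hy a (Γ y b c) d, hh.fderiv_eq hy b (Γ y a c) d,
    hh.fderiv_eq hy a c (Γ y b d), hh.fderiv_eq hy b c (Γ y a d)] at hs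
  simp only [connCurv, map_add, map_sub, add_apply,
    sub_apply]
  linarith

end IsMetricOn

end FlatMetric

/-! ### Local isometries: transformation of Christoffel symbols and curvature -/

section FlatIsometry

attribute [-instance]
  Bundle.instNormedAddCommGroupOfRiemannianBundleOfIsTopologicalAddGroupOfContinuousConstSMulReal
  Bundle.instInnerProductSpaceReal

variable {E : Type*} [NormedAddCommGroup E] [NormedSpace ℝ E]

/-- `ψ` is a local isometry from the open set `V` with the metric `G` to the open set `U` with the
metric `h`. -/
structure IsLocalIsometryOn (ψ : E → E) (G : E → E →L[ℝ] E →L[ℝ] ℝ) (V : Set E)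
    (h : E → E →L[ℝ] E →L[ℝ] ℝ) (U : Set E) : Prop where
  source : IsMetricOn G V
  target : IsMetricOn h U
  contDiffOn : ContDiffOn ℝ ∞ ψ V
  mapsTo : MapsTo ψ V U
  pull : ∀ y ∈ V, ∀ a b, G y a b = h (ψ y) (fderiv ℝ ψ y a) (fderiv ℝ ψ y b)

namespace IsLocalIsometryOn

variable {ψ : E → E} {G h : E → E →L[ℝ] E →L[ℝ] ℝ} {V U : Set E} {y : E}

theorem contDiffAt (H : IsLocalIsometryOn ψ G V h U) (hy : y ∈ V) : ContDiffAt ℝ ∞ ψ y :=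
  H.contDiffOn.contDiffAt (H.source.mem_nhds hy)

theorem hasFDerivAt (H : IsLocalIsometryOn ψ G V h U) (hy : y ∈ V) :
    HasFDerivAt ψ (fderiv ℝ ψ y) y :=
  ((H.contDiffAt hy).differentiableAt (by simp)).hasFDerivAt

theorem contDiffAt_fderiv (H : IsLocalIsometryOn ψ G V h U) (hy : y ∈ V) :
    ContDiffAt ℝ ∞ (fderiv ℝ ψ) y :=
  (H.contDiffAt hy).fderiv_right (by simp)

theorem hasFDerivAt_fderiv (H : IsLocalIsometryOn ψ G V h U) (hy : y ∈ V) :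
    HasFDerivAt (fderiv ℝ ψ) (fderiv ℝ (fderiv ℝ ψ) y) y :=
  ((H.contDiffAt_fderiv hy).differentiableAt (by simp)).hasFDerivAt

theorem second_symm (H : IsLocalIsometryOn ψ G V h U) (hy : y ∈ V) (a b : E) :
    fderiv ℝ (fderiv ℝ ψ) y a b = fderiv ℝ (fderiv ℝ ψ) y b a :=
  ((H.contDiffAt hy).isSymmSndFDerivAt (by simpa using ENat.LEInfty.out)).eq a b

theorem injective (H : IsLocalIsometryOn ψ G V h U) (hy : y ∈ V) :
    Function.Injective (fderiv ℝ ψ y) := by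
  rw [injective_iff_map_eq_zero]
  intro a ha
  by_contra hne
  have := H.source.pos y hy a hne
  rw [H.pull y hy, ha] at this
  simp at this

theorem fderiv_pull (H : IsLocalIsometryOn ψ G V h U) (hy : y ∈ V) (a b c : E) :
    fderiv ℝ G y a b c = fderiv ℝ h (ψ y) (fderiv ℝ ψ y a) (fderiv ℝ ψ y b) (fderiv ℝ ψ y c)
      + h (ψ y) (fderiv ℝ (fderiv ℝ ψ) y a b) (fderiv ℝ ψ y c)
      + h (ψ y) (fderiv ℝ ψ y b) (fderiv ℝ (fderiv ℝ ψ) y a c) := by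
  have h1 := H.source.hasFDerivAt_apply hy b c
  have h2 := (H.target.hasFDerivAt (H.mapsTo hy)).comp y (H.hasFDerivAt hy)
  have h3 := (h2.clm_apply ((H.hasFDerivAt_fderiv hy).clm_apply (hasFDerivAt_const b y))).clm_apply
    ((H.hasFDerivAt_fderiv hy).clm_apply (hasFDerivAt_const c y))
  have he : (fun z => G z b c) =ᶠ[nhds y]
      fun z => h (ψ z) (fderiv ℝ ψ z b) (fderiv ℝ ψ z c) := by
    filter_upwards [H.source.mem_nhds hy] with z hz using H.pull z hz b c
  have := (h1.congr_of_eventuallyEq he.symm).unique h3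
  have := congrArg (fun L => L a) this
  simp at this
  rw [this]; ring

/-- Among the second-derivative terms of the three pulled back first derivatives, those involving
`D²ψ(a, c)` and `D²ψ(b, c)` cancel, and only `D²ψ(a, b)` survives. -/
theorem lcFirst_pull (H : IsLocalIsometryOn ψ G V h U) (hy : y ∈ V) (a b c : E) :
    lcFirst G y a b c = lcFirst h (ψ y) (fderiv ℝ ψ y a) (fderiv ℝ ψ y b) (fderiv ℝ ψ y c)
      + h (ψ y) (fderiv ℝ (fderiv ℝ ψ) y a b) (fderiv ℝ ψ y c) := by
  have hs := H.target.symm _ (H.mapsTo hy)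
  simp only [lcFirst_apply, H.fderiv_pull hy]
  rw [H.second_symm hy b a, H.second_symm hy c a, H.second_symm hy c b,
    hs (fderiv ℝ ψ y b) (fderiv ℝ (fderiv ℝ ψ) y a c),
    hs (fderiv ℝ ψ y a) (fderiv ℝ (fderiv ℝ ψ) y b c)]
  ring

variable [FiniteDimensional ℝ E]

theorem surjective (H : IsLocalIsometryOn ψ G V h U) (hy : y ∈ V) :
    Function.Surjective (fderiv ℝ ψ y) :=
  (LinearMap.injective_iff_surjective (f := (fderiv ℝ ψ y : E →ₗ[ℝ] E))).1 (H.injective hy)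

/-- The transformation law of the Christoffel symbols. -/
theorem lcSecond_map (H : IsLocalIsometryOn ψ G V h U) (hy : y ∈ V) (a b : E) :
    fderiv ℝ ψ y (lcSecond G y a b) = fderiv ℝ (fderiv ℝ ψ) y a b
      + lcSecond h (ψ y) (fderiv ℝ ψ y a) (fderiv ℝ ψ y b) := by
  refine H.target.eq_of_forall (H.mapsTo hy) fun c => ?_
  obtain ⟨c, rfl⟩ := H.surjective hy c
  rw [← H.pull y hy, H.source.lcSecond_apply hy, H.lcFirst_pull hy, map_add, add_apply,
    H.target.lcSecond_apply (H.mapsTo hy)]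
  ring

/-- Local isometries preserve the curvature tensor. -/
theorem connCurv_map (H : IsLocalIsometryOn ψ G V h U) (hy : y ∈ V) (a b c : E) :
    fderiv ℝ ψ y (connCurv (lcSecond G) y a b c)
      = connCurv (lcSecond h) (ψ y) (fderiv ℝ ψ y a) (fderiv ℝ ψ y b) (fderiv ℝ ψ y c) := by
  -- The transformation law `lcSecond_map` is differentiated in the direction `a`. The third
  -- derivative of `ψ` that appears is symmetric in `a` and `b` (`hsym`), so it drops out of the
  -- curvature, as do the terms containing `D²ψ`.
  have key : ∀ a b : E, fderiv ℝ ψ y (fderiv ℝ (lcSecond G) y a b c)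
      = fderiv ℝ (fun z => fderiv ℝ (fderiv ℝ ψ) z b c) y a
        + fderiv ℝ (lcSecond h) (ψ y) (fderiv ℝ ψ y a) (fderiv ℝ ψ y b) (fderiv ℝ ψ y c)
        + lcSecond h (ψ y) (fderiv ℝ (fderiv ℝ ψ) y a b) (fderiv ℝ ψ y c)
        + lcSecond h (ψ y) (fderiv ℝ ψ y b) (fderiv ℝ (fderiv ℝ ψ) y a c)
        - fderiv ℝ (fderiv ℝ ψ) y a (lcSecond G y b c) := by
    intro a b
    have hG := ((H.source.hasFDerivAt_lcSecond hy).clm_apply (hasFDerivAt_const b y)).clm_apply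
      (hasFDerivAt_const c y)
    have h1 := (H.hasFDerivAt_fderiv hy).clm_apply hG
    have h2 := (((H.target.hasFDerivAt_lcSecond (H.mapsTo hy)).comp y
      (H.hasFDerivAt hy)).clm_apply ((H.hasFDerivAt_fderiv hy).clm_apply
        (hasFDerivAt_const b y))).clm_apply
        ((H.hasFDerivAt_fderiv hy).clm_apply (hasFDerivAt_const c y))
    have hd : DifferentiableAt ℝ (fun z => fderiv ℝ (fderiv ℝ ψ) z b c) y :=
      ((((H.contDiffAt_fderiv hy).fderiv_right (m := ∞) (by simp)).clm_apply
        contDiffAt_const).clm_apply contDiffAt_const).differentiableAt (by simp)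
    have h3 := hd.hasFDerivAt.add h2
    have he : (fun z => fderiv ℝ ψ z (lcSecond G z b c)) =ᶠ[nhds y]
        fun z => fderiv ℝ (fderiv ℝ ψ) z b c
          + lcSecond h (ψ z) (fderiv ℝ ψ z b) (fderiv ℝ ψ z c) := by
      filter_upwards [H.source.mem_nhds hy] with z hz using H.lcSecond_map hz b c
    have := (h1.congr_of_eventuallyEq he.symm).unique h3
    have := congrArg (fun L => L a) this
    simp at this
    rw [eq_sub_iff_add_eq, this]; abel
  have hsym : fderiv ℝ (fun z => fderiv ℝ (fderiv ℝ ψ) z b c) y a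
      = fderiv ℝ (fun z => fderiv ℝ (fderiv ℝ ψ) z a c) y b := by
    have hs : IsSymmSndFDerivAt ℝ (fderiv ℝ ψ) y :=
      (H.contDiffAt_fderiv hy).isSymmSndFDerivAt (by simpa using ENat.LEInfty.out)
    have h2 : HasFDerivAt (fderiv ℝ (fderiv ℝ ψ)) (fderiv ℝ (fderiv ℝ (fderiv ℝ ψ)) y) y :=
      (((H.contDiffAt_fderiv hy).fderiv_right (m := ∞) (by simp)).differentiableAt
        (by simp)).hasFDerivAt
    have h3 : ∀ a b, fderiv ℝ (fun z => fderiv ℝ (fderiv ℝ ψ) z b c) y a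
        = fderiv ℝ (fderiv ℝ (fderiv ℝ ψ)) y a b c := by
      intro a b
      rw [((h2.clm_apply (hasFDerivAt_const b y)).clm_apply (hasFDerivAt_const c y)).fderiv]
      simp
    rw [h3, h3, hs.eq a b]
  simp only [connCurv, map_add, map_sub, key, H.lcSecond_map hy, hsym,
    H.second_symm hy b a]
  abel

end IsLocalIsometryOn

end FlatIsometry

/-! ### The functions `S_κ` and `C_κ` -/

section ModelFunctions

open Filter Topology

theorem hasDerivAt_snK (κ t : ℝ) : HasDerivAt (snK κ) (csK κ t) t := by
  have : DifferentiableAt ℝ (snK κ) t := by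
    unfold snK
    split_ifs
    · fun_prop
    · exact ((differentiableAt_id.const_mul _).sinh).div_const _
    · fun_prop
  exact this.hasDerivAt

theorem hasDerivAt_csK (κ t : ℝ) : HasDerivAt (csK κ) (-κ * snK κ t) t := by
  rw [show csK κ = _ from funext fun t => csK_eq κ t]
  unfold snK
  rcases lt_trichotomy κ 0 with h | h | h
  · have h0 : 0 < √(-κ) := Real.sqrt_pos.2 (by linarith)
    have h1 : √(-κ) * √(-κ) = -κ := Real.mul_self_sqrt (by linarith)
    simp only [not_lt.2 h.le, h, if_true, if_false]
    refine ((hasDerivAt_id t).const_mul (√(-κ))).cosh.congr_deriv ?_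
    field_simp
    simp only [id]
    linear_combination Real.sinh (√(-κ) * t) * h1
  · subst h
    simpa using hasDerivAt_const t (1 : ℝ)
  · have h0 : 0 < √κ := Real.sqrt_pos.2 h
    have h1 : √κ * √κ = κ := Real.mul_self_sqrt h.le
    simp only [h, if_true]
    refine ((hasDerivAt_id t).const_mul (√κ)).cos.congr_deriv ?_
    field_simp
    simp only [id]
    linear_combination -Real.sin (√κ * t) * h1

theorem snK_zero (κ : ℝ) : snK κ 0 = 0 := by simp [snK]

theorem csK_zero (κ : ℝ) : csK κ 0 = 1 := by simp [csK_eq]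

theorem snK_pos {κ t : ℝ} (ht : t ∈ ctDomain κ) : 0 < snK κ t := by
  obtain ⟨h0, h1⟩ := ht
  unfold snK
  split_ifs with h h'
  · have hs := Real.sqrt_pos.2 h
    have h2 := h1 h
    rw [lt_div_iff₀ hs] at h2
    exact div_pos (Real.sin_pos_of_pos_of_lt_pi (by positivity) (by linarith)) hs
  · have hs : 0 < √(-κ) := Real.sqrt_pos.2 (by linarith)
    exact div_pos (Real.sinh_pos_iff.2 (by positivity)) hs
  · exact h0

/-- Up to sign this is the numerator of `ctK κ b - ctK κ a`; positivity of `snK κ (b - a)` is what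
makes `ctK κ` decreasing. -/
theorem snK_sub (κ a b : ℝ) : snK κ (b - a) = snK κ b * csK κ a - csK κ b * snK κ a := by
  simp only [csK_eq]
  unfold snK
  split_ifs
  · rw [mul_sub, Real.sin_sub]; ring
  · rw [mul_sub, Real.sinh_sub]; ring
  · ring

theorem mem_ctDomain_of_le {κ s t : ℝ} (ht : t ∈ ctDomain κ) (hs : 0 < s) (hst : s ≤ t) :
    s ∈ ctDomain κ :=
  ⟨hs, fun h => hst.trans_lt (ht.2 h)⟩

theorem ctK_antitone {κ a b : ℝ} (ha : a ∈ ctDomain κ) (hb : b ∈ ctDomain κ) (hab : a ≤ b) :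
    ctK κ b ≤ ctK κ a := by
  rcases hab.eq_or_lt with rfl | hlt
  · exact le_rfl
  have h1 := snK_sub κ a b
  have h2 := snK_pos (mem_ctDomain_of_le hb (sub_pos.2 hlt) (by linarith [ha.1]))
  rw [ctK, ctK, div_le_div_iff₀ (snK_pos hb) (snK_pos ha)]
  linarith

theorem ctK_le_iff {κ a b : ℝ} (ha : a ∈ ctDomain κ) (hb : b ∈ ctDomain κ) :
    ctK κ b ≤ ctK κ a ↔ a ≤ b := by
  refine ⟨fun h => ?_, ctK_antitone ha hb⟩
  by_contra! hlt
  exact hlt.ne (ctK_injOn κ hb ha (le_antisymm h (ctK_antitone hb ha hlt.le)))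

theorem continuousOn_ctK (κ : ℝ) : ContinuousOn (ctK κ) (ctDomain κ) := fun t ht =>
  ((hasDerivAt_csK κ t).continuousAt.div (hasDerivAt_snK κ t).continuousAt
    (snK_pos ht).ne').continuousWithinAt

theorem tendsto_ctK_atTop {κ t₀ : ℝ} (ht₀ : t₀ ∈ ctDomain κ) :
    Tendsto (ctK κ) (𝓝[>] 0) atTop := by
  have h1 : Tendsto (csK κ) (𝓝[>] 0) (𝓝 1) :=
    (csK_zero κ ▸ (hasDerivAt_csK κ 0).continuousAt.tendsto).mono_left nhdsWithin_le_nhds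
  have h2 : Tendsto (snK κ) (𝓝[>] 0) (𝓝[>] 0) := by
    refine tendsto_nhdsWithin_iff.2 ⟨(snK_zero κ ▸
      (hasDerivAt_snK κ 0).continuousAt.tendsto).mono_left nhdsWithin_le_nhds, ?_⟩
    filter_upwards [Ioc_mem_nhdsGT ht₀.1] with t ht
    exact snK_pos (mem_ctDomain_of_le ht₀ ht.1 ht.2)
  exact h1.pos_mul_atTop one_pos h2.inv_tendsto_nhdsGT_zero

/-- Intermediate value theorem between `t₀` and a point near `0`, where `ctK κ` exceeds any given
bound. -/
theorem mem_image_ctK {κ t₀ s : ℝ} (ht₀ : t₀ ∈ ctDomain κ) (hs : ctK κ t₀ ≤ s) :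
    s ∈ ctK κ '' ctDomain κ := by
  obtain ⟨t₁, h1, h2⟩ := ((tendsto_ctK_atTop ht₀).eventually_ge_atTop s |>.and
    (Ioc_mem_nhdsGT ht₀.1)).exists
  have hsub : Icc t₁ t₀ ⊆ ctDomain κ := fun t ht =>
    mem_ctDomain_of_le ht₀ (h2.1.trans_le ht.1) ht.2
  obtain ⟨t, ht, rfl⟩ := intermediate_value_Icc' h2.2 ((continuousOn_ctK κ).mono hsub) ⟨hs, h1⟩
  exact ⟨t, hsub ht, rfl⟩

/-- A nonnegative number that dominates `C_κ / S_κ` at every admissible `t ≤ R` is a value of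
`C_κ / S_κ`, and its inverse image is at most `R`. -/
theorem ctInv_le_of_ctK_le {κ s ρ R : ℝ} (hs : 0 ≤ s) (hρ : 0 < ρ) (hρR : ρ ≤ R)
    (h : ρ ∈ ctDomain κ → ctK κ ρ ≤ s) :
    s ∈ ctK κ '' ctDomain κ ∧ ctInv κ s ≤ R := by
  have hmem : s ∈ ctK κ '' ctDomain κ := by
    by_cases hd : ρ ∈ ctDomain κ
    · exact mem_image_ctK hd (h hd)
    -- Here `ρ` is at or beyond `π / √κ`. The midpoint `π / (2√κ)` of the interval has `ctK = 0 ≤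
    -- s`, so `s` is still attained.
    · have hκ : 0 < κ := by
        by_contra hκ
        exact hd ⟨hρ, fun h => absurd h hκ⟩
      have h0 := Real.sqrt_pos.2 hκ
      refine mem_image_ctK (t₀ := Real.pi / 2 / √κ) ⟨by positivity, fun _ => ?_⟩ ?_
      · exact div_lt_div_of_pos_right (by linarith [Real.pi_pos]) h0
      · rw [ctK, csK_eq, if_pos hκ, mul_div_cancel₀ _ h0.ne', Real.cos_pi_div_two, zero_div]
        exact hs
  refine ⟨hmem, ?_⟩
  have h1 : ctInv κ s ∈ ctDomain κ := Function.invFunOn_mem hmem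
  have h2 : ctK κ (ctInv κ s) = s := Function.invFunOn_eq hmem
  by_cases hd : ρ ∈ ctDomain κ
  · refine le_trans ?_ hρR
    rw [← ctK_le_iff h1 hd, h2]
    exact h hd
  -- Every element of `ctDomain κ` is below `π / √κ ≤ ρ ≤ R`, so no information on `ctK κ ρ` is
  -- needed.
  · have hκ : 0 < κ := by
      by_contra hκ
      exact hd ⟨hρ, fun h => absurd h hκ⟩
    have h3 : Real.pi / √κ ≤ ρ := by
      by_contra! h3
      exact hd ⟨hρ, fun _ => h3⟩
    linarith [h1.2 hκ]

end ModelFunctions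

/-! ### Metrics in normal coordinates and the Hessian comparison -/

section NormalMetric

attribute [-instance]
  Bundle.instNormedAddCommGroupOfRiemannianBundleOfIsTopologicalAddGroupOfContinuousConstSMulReal
  Bundle.instInnerProductSpaceReal

variable {E : Type*} [NormedAddCommGroup E] [NormedSpace ℝ E]

/-- The open ball of radius `r` for the inner product `G 0`. -/
def normalBall (G : E → E →L[ℝ] E →L[ℝ] ℝ) (r : ℝ) : Set E := {v | G 0 v v < r ^ 2}

/-- `G` is a metric on the ball of radius `r` for which the rays from the origin are geodesics. -/
structure IsNormalMetric (G : E → E →L[ℝ] E →L[ℝ] ℝ) (r : ℝ) : Prop where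
  pos : 0 < r
  metric : IsMetricOn G (normalBall G r)
  radial : ∀ v ∈ normalBall G r, lcSecond G v v v = 0

theorem eq_of_deriv_eq_zero_Ioo {f : ℝ → ℝ} {a b : ℝ} (hab : a < b) (hc : ContinuousOn f (Icc a b))
    (hd : ∀ t ∈ Ioo a b, HasDerivAt f 0 t) : f b = f a := by
  obtain ⟨c, hc, h⟩ := exists_hasDerivAt_eq_slope f (fun _ => 0) hab hc hd
  have : b - a ≠ 0 := by linarith
  field_simp at h
  linarith

namespace IsNormalMetric

variable {G : E → E →L[ℝ] E →L[ℝ] ℝ} {r : ℝ} {v : E}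

theorem zero_mem (H : IsNormalMetric G r) : (0 : E) ∈ normalBall G r := by
  simpa [normalBall] using pow_pos H.pos 2

theorem smul_mem (H : IsNormalMetric G r) (hv : v ∈ normalBall G r) {t : ℝ} (h0 : 0 ≤ t)
    (h1 : t ≤ 1) : t • v ∈ normalBall G r := by
  simp only [normalBall, mem_ofPred_eq, map_smul, smul_apply, smul_eq_mul] at hv ⊢
  have := H.metric.nonneg H.zero_mem v
  have h2 : t * t ≤ 1 := by nlinarith
  nlinarith

theorem hasDerivAt_ray (H : IsNormalMetric G r) {t : ℝ} {u : E} (ht : t • u ∈ normalBall G r) :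
    HasDerivAt (fun t : ℝ => G (t • u)) (fderiv ℝ G (t • u) u) t := by
  have h := (H.metric.hasFDerivAt ht).comp_hasDerivAt t ((hasDerivAt_id t).smul_const u)
  exact HasDerivAt.congr_deriv h (by simp)

theorem hasDerivAt_ray_apply (H : IsNormalMetric G r) {t : ℝ} {u : E}
    (ht : t • u ∈ normalBall G r) {X Y : ℝ → E} {X' Y' : E} (hX : HasDerivAt X X' t)
    (hY : HasDerivAt Y Y' t) :
    HasDerivAt (fun t : ℝ => G (t • u) (X t) (Y t))
      (fderiv ℝ G (t • u) u (X t) (Y t) + G (t • u) X' (Y t) + G (t • u) (X t) Y') t := by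
  refine (((H.hasDerivAt_ray ht).clm_apply hX).clm_apply hY).congr_deriv ?_
  simp only [add_apply]

theorem fderiv_quad (H : IsNormalMetric G r) (v : E) (w : E) :
    fderiv ℝ (fun z => G 0 z z) v w = 2 * G 0 v w := by
  have h1 := ((hasFDerivAt_const (G 0) v).clm_apply (hasFDerivAt_id v)).clm_apply (hasFDerivAt_id v)
  rw [HasFDerivAt.fderiv (f := fun z => G 0 z z) h1]
  simp
  rw [H.metric.symm 0 H.zero_mem w v]; ring

theorem lcSecond_self_of_smul (H : IsNormalMetric G r) {t : ℝ} (ht : t ≠ 0) {u : E}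
    (hu : t • u ∈ normalBall G r) : lcSecond G (t • u) u u = 0 := by
  have := H.radial _ hu
  simp only [map_smul, smul_apply, smul_smul] at this
  exact (smul_eq_zero.1 this).resolve_left (mul_ne_zero ht ht)

variable [FiniteDimensional ℝ E]

/-- Rays have constant speed. -/
theorem apply_self (H : IsNormalMetric G r) (hv : v ∈ normalBall G r) : G v v v = G 0 v v := by
  have hd : ∀ t ∈ Icc (0 : ℝ) 1, HasDerivAt (fun t : ℝ => G (t • v) v v)
      (fderiv ℝ G (t • v) v v v) t := fun t ht => by
    simpa using H.hasDerivAt_ray_apply (H.smul_mem hv ht.1 ht.2) (hasDerivAt_const t v)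
      (hasDerivAt_const t v)
  -- The derivative is `2 G(Γ(v, v), v)` at `t • v`. The geodesic equation there reads `t² Γ(v, v) =
  -- 0`, which is only informative for `t ≠ 0`; hence the open interval.
  have := eq_of_deriv_eq_zero_Ioo one_pos
    (fun t ht => (hd t ht).continuousAt.continuousWithinAt) (fun t ht => by
      refine (hd t ⟨ht.1.le, ht.2.le⟩).congr_deriv ?_
      have hm := H.smul_mem hv ht.1.le ht.2.le
      rw [H.metric.fderiv_eq hm, H.lcSecond_self_of_smul ht.1.ne' hm]
      simp)
  simpa using this

/-- The geodesic equation paired with `w` gives `2 D_v G(v, w) = D_w G(v, v)`, and differentiating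
the constant speed identity `G z z z = G 0 z z` along `w` evaluates the right-hand side. This is the
differential equation behind the Gauss lemma. -/
theorem fderiv_radial (H : IsNormalMetric G r) (hv : v ∈ normalBall G r) (w : E) :
    fderiv ℝ G v v v w = G 0 v w - G v v w := by
  have h1 : lcFirst G v v v w = 0 := by
    rw [← H.metric.lcSecond_apply hv, H.radial v hv]; simp
  rw [lcFirst_apply] at h1
  have he : (fun z => G z z z) =ᶠ[nhds v] fun z => G 0 z z := by
    filter_upwards [H.metric.mem_nhds hv] with z hz using H.apply_self hz
  have h2 : fderiv ℝ (fun z => G z z z) v w = fderiv ℝ G v w v v + G v w v + G v v w := by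
    have h1 := ((H.metric.hasFDerivAt hv).clm_apply (hasFDerivAt_id v)).clm_apply (hasFDerivAt_id v)
    rw [HasFDerivAt.fderiv (f := fun z => G z z z) h1]
    simp; ring
  rw [he.fderiv_eq, H.fderiv_quad, H.metric.symm v hv w v] at h2
  linarith

/-- The Gauss lemma. -/
theorem gauss (H : IsNormalMetric G r) (hv : v ∈ normalBall G r) (w : E) : G v v w = G 0 v w := by
  -- By `fderiv_radial` the function `t (G(v, w) at t • v - G 0 v w)` is constant, and it vanishes
  -- at `t = 0`.
  have hd : ∀ t ∈ Icc (0 : ℝ) 1, HasDerivAt (fun t : ℝ => t * G (t • v) v w - t * G 0 v w)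
      (G (t • v) v w + t * fderiv ℝ G (t • v) v v w - G 0 v w) t := fun t ht => by
    have h1 : HasDerivAt (fun t : ℝ => G (t • v) v w) (fderiv ℝ G (t • v) v v w) t := by
      simpa using H.hasDerivAt_ray_apply (H.smul_mem hv ht.1 ht.2) (hasDerivAt_const t v)
        (hasDerivAt_const t w)
    refine (((hasDerivAt_id t).mul h1).sub ((hasDerivAt_id t).mul_const _)).congr_deriv ?_
    simp
  have := eq_of_deriv_eq_zero_Ioo one_pos
    (fun t ht => (hd t ht).continuousAt.continuousWithinAt) (fun t ht => by
      refine (hd t ⟨ht.1.le, ht.2.le⟩).congr_deriv ?_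
      have h := H.fderiv_radial (H.smul_mem hv ht.1.le ht.2.le) w
      simp only [map_smul, smul_apply, smul_eq_mul] at h
      have h2 := mul_left_cancel₀ ht.1.ne' (h.trans (mul_sub t _ _).symm)
      linarith)
  simp at this
  linarith

/-- The Hessian of `v ↦ G 0 v v / 2`. -/
theorem hessian_eq (H : IsNormalMetric G r) (hv : v ∈ normalBall G r) (a : E) :
    G 0 a a - G v v (lcSecond G v a a) = G v a a + G v a (lcSecond G v v a) := by
  -- The Gauss lemma is differentiated along `a`, and the derivative of the metric is expanded by
  -- compatibility.
  have he : (fun z => G z z a) =ᶠ[nhds v] fun z => G 0 z a := by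
    filter_upwards [H.metric.mem_nhds hv] with z hz using H.gauss hz a
  have h1 := ((H.metric.hasFDerivAt hv).clm_apply (hasFDerivAt_id v)).clm_apply
    (hasFDerivAt_const a v)
  have h2 := ((hasFDerivAt_const (G 0) v).clm_apply (hasFDerivAt_id v)).clm_apply
    (hasFDerivAt_const a v)
  have h3 := congrArg (fun L => L a) ((h1.congr_of_eventuallyEq he.symm).unique h2)
  simp at h3
  rw [H.metric.fderiv_eq hv, H.metric.lcSecond_symm hv a v,
    H.metric.symm v hv (lcSecond G v v a) a] at h3
  linarith

/-- The Jacobi equation for the variation fields `t ↦ t a` of rays. -/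
theorem jacobi (H : IsNormalMetric G r) {t : ℝ} (ht : t ≠ 0) {u : E}
    (hu : t • u ∈ normalBall G r) (a : E) :
    t • connCurv (lcSecond G) (t • u) u a u
      = (2 : ℝ) • lcSecond G (t • u) u a + t • fderiv ℝ (lcSecond G) (t • u) u u a
        + t • lcSecond G (t • u) u (lcSecond G (t • u) u a) := by
  have hs := H.metric.lcSecond_symm hu
  -- Differentiating the identity `Γ_z(z, z) = 0` along `a` at `z = t • u` gives `t² (D_a Γ)(u, u) +
  -- 2 t Γ(u, a) = 0`; one factor `t` is then cancelled.
  have h1 : t • fderiv ℝ (lcSecond G) (t • u) a u u = (-2 : ℝ) • lcSecond G (t • u) u a := by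
    have he : (fun z => lcSecond G z z z) =ᶠ[nhds (t • u)] fun _ => 0 := by
      filter_upwards [H.metric.mem_nhds hu] with z hz using H.radial z hz
    have h1 := ((H.metric.hasFDerivAt_lcSecond hu).clm_apply (hasFDerivAt_id (t • u))).clm_apply
      (hasFDerivAt_id (t • u))
    have h3 := congrArg (fun L => L a)
      ((h1.congr_of_eventuallyEq he.symm).unique (hasFDerivAt_const 0 _))
    simp at h3
    rw [hs a u] at h3
    have h4 : t • (t • fderiv ℝ (lcSecond G) (t • u) a u u
        + (2 : ℝ) • lcSecond G (t • u) u a) = 0 := by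
      rw [← h3]; module
    have h5 := (smul_eq_zero.1 h4).resolve_left ht
    rw [eq_neg_of_add_eq_zero_left h5]; module
  have h2 : fderiv ℝ (lcSecond G) (t • u) u a u = fderiv ℝ (lcSecond G) (t • u) u u a := by
    have he : (fun z => lcSecond G z a u) =ᶠ[nhds (t • u)] fun z => lcSecond G z u a := by
      filter_upwards [H.metric.mem_nhds hu] with z hz using H.metric.lcSecond_symm hz a u
    have h1 := fun a b => ((H.metric.hasFDerivAt_lcSecond hu).clm_apply
      (hasFDerivAt_const a (t • u))).clm_apply (hasFDerivAt_const b (t • u))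
    have h3 := congrArg (fun L => L u) (((h1 a u).congr_of_eventuallyEq he.symm).unique (h1 u a))
    simpa using h3
  rw [connCurv, smul_sub, smul_add, smul_sub, h1, H.lcSecond_self_of_smul ht hu, map_zero, h2,
    hs a u]
  module

/-- The Hessian comparison theorem for the squared distance in normal coordinates, in directions
orthogonal to the rays. -/
theorem le_hessian (H : IsNormalMetric G r) (hv : v ∈ normalBall G r) {κ : ℝ}
    (hcurv : ∀ z ∈ normalBall G r, z ≠ 0 → ∀ b, G z z b = 0 →
      G z (connCurv (lcSecond G) z z b b) z ≤ κ * (G z z z * G z b b))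
    (hρ : √(G 0 v v) ∈ ctDomain κ) {a : E} (ha : G 0 v a = 0) :
    √(G 0 v v) * ctK κ (√(G 0 v v)) * G v a a ≤ G 0 a a - G v v (lcSecond G v a a) := by
  rcases eq_or_ne a 0 with rfl | ha0
  · simp
  set ρ := √(G 0 v v) with hρdef
  have hρ0 : 0 < ρ := hρ.1
  have hρ2 : ρ * ρ = G 0 v v := Real.mul_self_sqrt (H.metric.nonneg H.zero_mem v)
  set u : E := ρ⁻¹ • v with hu
  have hρu : ρ • u = v := by rw [hu, smul_smul, mul_inv_cancel₀ hρ0.ne', one_smul]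
  have huu : G 0 u u = 1 := by
    simp only [hu, map_smul, smul_apply, smul_eq_mul, ← hρ2]
    field_simp
  have hua : G 0 u a = 0 := by simp [hu, ha]
  have hmem : ∀ t ∈ Icc 0 ρ, t • u ∈ normalBall G r := fun t ht => by
    have := H.smul_mem hv (t := t / ρ) (div_nonneg ht.1 hρ0.le) ((div_le_one hρ0).2 ht.2)
    rwa [← hρu, smul_smul, div_mul_cancel₀ _ hρ0.ne'] at this
  set Γ := lcSecond G with hΓ
  -- Along the unit-speed ray, `J(t) = t a` is a Jacobi field with covariant derivative `P`. Thus
  -- `|J|² = t² g` and `⟨J, J'⟩ = t q`; the factors of `t` are divided out so that `g` stays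
  -- positive at `t = 0`.
  set g : ℝ → ℝ := fun t => G (t • u) a a with hg
  set P : ℝ → E := fun t => a + t • Γ (t • u) u a with hP
  set q : ℝ → ℝ := fun t => G (t • u) a (P t) with hq
  have hgpos : ∀ t ∈ Icc 0 ρ, 0 < g t := fun t ht => H.metric.pos _ (hmem t ht) a ha0
  have hgd : ∀ t ∈ Icc 0 ρ, HasDerivAt g (2 * G (t • u) a (Γ (t • u) u a)) t := fun t ht => by
    refine (H.hasDerivAt_ray_apply (hmem t ht) (hasDerivAt_const t a)
      (hasDerivAt_const t a)).congr_deriv ?_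
    rw [H.metric.fderiv_eq (hmem t ht), H.metric.symm _ (hmem t ht) _ a]
    simp
    ring
  have hPd : ∀ t ∈ Icc 0 ρ, HasDerivAt P
      (Γ (t • u) u a + t • fderiv ℝ Γ (t • u) u u a) t := fun t ht => by
    have h1 := (H.metric.hasFDerivAt_lcSecond (hmem t ht)).comp_hasDerivAt t
      ((hasDerivAt_id t).smul_const u)
    have h2 := (h1.clm_apply (hasDerivAt_const t u)).clm_apply (hasDerivAt_const t a)
    refine (((hasDerivAt_id t).smul h2).const_add a).congr_deriv ?_
    simp [add_comm]
    rfl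
  have hqd : ∀ t ∈ Icc 0 ρ, HasDerivAt q (fderiv ℝ G (t • u) u a (P t)
      + G (t • u) a (Γ (t • u) u a + t • fderiv ℝ Γ (t • u) u u a)) t := fun t ht => by
    refine (H.hasDerivAt_ray_apply (hmem t ht) (hasDerivAt_const t a) (hPd t ht)).congr_deriv ?_
    simp
  have hqg : ∀ t, q t = g t + t * G (t • u) a (Γ (t • u) u a) := fun t => by
    simp [hq, hg, hP]
  -- the derivative of `q` is bounded below
  have hq' : ∀ t ∈ Ioo 0 ρ, (q t ^ 2 / g t - q t) / t - κ * t * g t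
      ≤ fderiv ℝ G (t • u) u a (P t)
        + G (t • u) a (Γ (t • u) u a + t • fderiv ℝ Γ (t • u) u u a) := fun t ht => by
    have hm := hmem t ⟨ht.1.le, ht.2.le⟩
    have ht0 := ht.1
    have hgt := hgpos t ⟨ht.1.le, ht.2.le⟩
    have e1 : t • Γ (t • u) u a = P t - a := by simp [hP]
    have e2 : Γ (t • u) u (P t) + (Γ (t • u) u a + t • fderiv ℝ Γ (t • u) u u a)
        = t • connCurv Γ (t • u) u a u := by
      rw [H.jacobi ht0.ne' hm a]
      simp only [hP, map_add, map_smul]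
      module
    have e3 : t * G (t • u) (Γ (t • u) u a) (P t) = G (t • u) (P t) (P t) - q t := by
      rw [← smul_eq_mul, ← smul_apply, ← map_smul, e1]
      simp [hq]
    have e4 : G (t • u) a (connCurv Γ (t • u) u a u)
        = - G (t • u) (connCurv Γ (t • u) u a a) u := by
      rw [H.metric.symm _ hm, H.metric.connCurv_skew hm, H.metric.symm _ hm]
    have e5 : G (t • u) (connCurv Γ (t • u) u a a) u ≤ κ * g t := by
      have hz : t • u ≠ 0 := by
        intro h0
        rcases smul_eq_zero.1 h0 with h | h
        · exact ht0.ne' h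
        · rw [h] at huu; simp at huu
      have h1 := hcurv _ hm hz a (by rw [H.gauss hm]; simp [hua])
      rw [H.apply_self hm] at h1
      have h2 : connCurv Γ (t • u) (t • u) a a = t • connCurv Γ (t • u) u a a := by
        simp only [connCurv, map_smul, smul_apply]
        module
      rw [h2] at h1
      simp only [map_smul, smul_apply, smul_eq_mul, huu, mul_one] at h1
      have h3 : 0 < t * t := by positivity
      refine le_of_mul_le_mul_left ?_ h3
      calc _ = t * (t * G (t • u) (connCurv Γ (t • u) u a a) u) := by ring
        _ ≤ _ := h1
        _ = _ := by simp only [hg]; ring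
    have e6 : q t ^ 2 / g t ≤ G (t • u) (P t) (P t) := by
      rw [div_le_iff₀ hgt, mul_comm]
      exact H.metric.cauchy_schwarz hm a (P t)
    rw [H.metric.fderiv_eq hm, add_assoc, ← map_add, e2, map_smul _ t, smul_eq_mul, e4]
    have e7 : G (t • u) (Γ (t • u) u a) (P t) = (G (t • u) (P t) (P t) - q t) / t := by
      rw [← e3]; field_simp
    rw [e7]
    have e8 := div_le_div_of_nonneg_right (sub_le_sub_right e6 (q t)) ht0.le
    nlinarith
  -- The Wronskian `|J|' S_κ - |J| C_κ`, with `|J| = t √g` and `|J|' = q / √g`. The bound `hq'`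
  -- amounts to `|J|'' ≥ -κ |J|`, so `w` increases from `w 0 = 0`.
  set w : ℝ → ℝ := fun t => q t / √(g t) * snK κ t - t * √(g t) * csK κ t with hw
  have hwd : ∀ t ∈ Icc 0 ρ, HasDerivAt w
      (((fderiv ℝ G (t • u) u a (P t)
        + G (t • u) a (Γ (t • u) u a + t • fderiv ℝ Γ (t • u) u u a)) * √(g t)
          - q t * (2 * G (t • u) a (Γ (t • u) u a) / (2 * √(g t)))) / √(g t) ^ 2 * snK κ t
        + q t / √(g t) * csK κ t
        - ((√(g t) + t * (2 * G (t • u) a (Γ (t • u) u a) / (2 * √(g t)))) * csK κ t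
          + t * √(g t) * (-κ * snK κ t))) t := fun t ht => by
    have hs := (hgd t ht).sqrt (hgpos t ht).ne'
    have h1 := ((hqd t ht).div hs (Real.sqrt_pos.2 (hgpos t ht)).ne').mul (hasDerivAt_snK κ t)
    have h2 := ((hasDerivAt_id t).mul hs).mul (hasDerivAt_csK κ t)
    refine (h1.sub h2).congr_deriv ?_
    simp
  have hmono : MonotoneOn w (Icc 0 ρ) := by
    refine monotoneOn_of_hasDerivWithinAt_nonneg (convex_Icc 0 ρ)
      (fun t ht => (hwd t ht).continuousAt.continuousWithinAt)
      (fun t ht => (hwd t (interior_subset ht)).hasDerivWithinAt) fun t ht => ?_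
    rw [interior_Icc] at ht
    have hgt := hgpos t ⟨ht.1.le, ht.2.le⟩
    have ht0 := ht.1
    have hsn := snK_pos (mem_ctDomain_of_le hρ ht.1 ht.2.le)
    have hr := Real.sqrt_pos.2 hgt
    have hrr : √(g t) ^ 2 = g t := Real.sq_sqrt hgt.le
    have hb := hq' t ht
    set D := fderiv ℝ G (t • u) u a (P t)
        + G (t • u) a (Γ (t • u) u a + t • fderiv ℝ Γ (t • u) u u a)
    have hc : G (t • u) a (Γ (t • u) u a) = (q t - g t) / t := by
      rw [hqg t]; field_simp; ring
    rw [hc]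
    set s := √(g t)
    rw [← hrr] at hb ⊢
    have : (D * s - q t * (2 * ((q t - s ^ 2) / t) / (2 * s))) / s ^ 2 * snK κ t
        + q t / s * csK κ t - ((s + t * (2 * ((q t - s ^ 2) / t) / (2 * s))) * csK κ t
          + t * s * (-κ * snK κ t))
        = (D - ((q t ^ 2 / s ^ 2 - q t) / t - κ * t * s ^ 2)) * (snK κ t / s) := by
      field_simp
      ring
    rw [this]
    exact mul_nonneg (sub_nonneg.2 hb) (div_nonneg hsn.le hr.le)
  have hfin := hmono ⟨le_rfl, hρ0.le⟩ ⟨hρ0.le, le_rfl⟩ hρ0.le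
  have hw0 : w 0 = 0 := by simp [hw, snK_zero]
  have hgρ := hgpos ρ ⟨hρ0.le, le_rfl⟩
  have hr := Real.sqrt_pos.2 hgρ
  have hrr : √(g ρ) * √(g ρ) = g ρ := Real.mul_self_sqrt hgρ.le
  have hsn := snK_pos hρ
  -- By `hessian_eq`, the value of `q` at the end of the ray is the Hessian to be estimated, so `w ρ
  -- ≥ 0` is the claim after division by `snK κ ρ`.
  have hq1 : q ρ = G 0 a a - G v v (Γ v a a) := by
    rw [H.hessian_eq hv, hqg ρ]
    simp only [hg, hρu]
    congr 1
    rw [← smul_eq_mul, ← map_smul, ← smul_apply, ← map_smul, hρu]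
  rw [hw0] at hfin
  rw [← hq1, ctK]
  have h2 : ρ * √(g ρ) * csK κ ρ ≤ q ρ / √(g ρ) * snK κ ρ := by simpa [hw] using hfin
  have h3 : ρ * g ρ * csK κ ρ ≤ q ρ * snK κ ρ := by
    have := mul_le_mul_of_nonneg_left h2 hr.le
    have e : √(g ρ) * (q ρ / √(g ρ) * snK κ ρ) = q ρ * snK κ ρ := by field_simp
    rw [e] at this
    calc _ = √(g ρ) * (ρ * √(g ρ) * csK κ ρ) := by linear_combination (-ρ * csK κ ρ) * hrr
      _ ≤ _ := this
  have h4 : G v a a = g ρ := by simp [hg, hρu]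
  rw [h4, show ρ * (csK κ ρ / snK κ ρ) * g ρ = ρ * g ρ * csK κ ρ / snK κ ρ by ring,
    div_le_iff₀ hsn]
  exact h3

end IsNormalMetric
end NormalMetric

/-! ### Normal components and traces with respect to an induced inner product -/

section NormalTrace

attribute [-instance]
  Bundle.instNormedAddCommGroupOfRiemannianBundleOfIsTopologicalAddGroupOfContinuousConstSMulReal
  Bundle.instInnerProductSpaceReal

variable {E' : Type*} [NormedAddCommGroup E'] [NormedSpace ℝ E'] [FiniteDimensional ℝ E']
  {V : Type*} [NormedAddCommGroup V] [NormedSpace ℝ V]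

/-- The Gram matrix of the inner product induced by `k` through `L`. -/
def pullGram (k : V → V → ℝ) (L : E' → V) :
    Matrix (Fin (Module.finrank ℝ E')) (Fin (Module.finrank ℝ E')) ℝ :=
  Matrix.of fun i j => k (L (Module.finBasis ℝ E' i)) (L (Module.finBasis ℝ E' j))

/-- The component of `w` that is `k`-normal to the range of `L`. -/
def normalComponent (k : V → V → ℝ) (L : E' → V) (w : V) : V :=
  w - ∑ i, ∑ j, ((pullGram k L)⁻¹ i j * k w (L (Module.finBasis ℝ E' j))) •
    L (Module.finBasis ℝ E' i)

/-- The normal part of the trace of `Q` with respect to the inner product induced by `k`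
through `L`. -/
def normalTrace (k : V → V → ℝ) (L : E' → V) (Q : E' → E' → V) : V :=
  ∑ i, ∑ j, (pullGram k L)⁻¹ i j •
    normalComponent k L (Q (Module.finBasis ℝ E' i) (Module.finBasis ℝ E' j))

/-- `e` is an orthonormal frame for the inner product induced by `k` through `L`. -/
def IsPullFrame (k : V → V → ℝ) (L : E' → V) (e : Fin (Module.finrank ℝ E') → E') : Prop :=
  ∀ i j, k (L (e i)) (L (e j)) = if i = j then 1 else 0

/-- `k` is an inner product. -/
structure IsInnerForm (k : V →L[ℝ] V →L[ℝ] ℝ) : Prop where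
  symm : ∀ a b, k a b = k b a
  pos : ∀ a, a ≠ 0 → 0 < k a a

theorem IsMetricOn.isInnerForm {h : V → V →L[ℝ] V →L[ℝ] ℝ} {U : Set V} (hh : IsMetricOn h U) {y : V}
    (hy : y ∈ U) : IsInnerForm (h y) := ⟨hh.symm y hy, hh.pos y hy⟩

namespace IsInnerForm

variable {k : V →L[ℝ] V →L[ℝ] ℝ} {L : E' →L[ℝ] V}

theorem dotProduct_pullGram (k : V →L[ℝ] V →L[ℝ] ℝ) (L : E' →L[ℝ] V)
    (x y : Fin (Module.finrank ℝ E') → ℝ) :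
    dotProduct x ((pullGram (k · ·) L).mulVec y)
      = k (L (∑ i, x i • Module.finBasis ℝ E' i)) (L (∑ i, y i • Module.finBasis ℝ E' i)) := by
  simp only [dotProduct, Matrix.mulVec, pullGram, Matrix.of_apply, map_sum, map_smul,
    sum_apply, smul_apply, smul_eq_mul, Finset.mul_sum]
  rw [Finset.sum_comm]
  refine Finset.sum_congr rfl fun i _ => Finset.sum_congr rfl fun j _ => ?_
  ring

theorem posDef_pullGram (hk : IsInnerForm k) (hL : Function.Injective L) :
    (pullGram (k · ·) L).PosDef := by
  refine Matrix.PosDef.of_dotProduct_mulVec_pos ?_ fun x hx => ?_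
  · ext i j
    simpa [pullGram] using hk.symm _ _
  · rw [star_trivial, dotProduct_pullGram]
    refine hk.pos _ fun h0 => hx ?_
    have h1 : ∑ i, x i • Module.finBasis ℝ E' i = 0 := hL (by rw [h0, map_zero])
    funext i
    exact Fintype.linearIndependent_iff.1 (Module.finBasis ℝ E').linearIndependent x h1 i

theorem isUnit_det (hk : IsInnerForm k) (hL : Function.Injective L) :
    IsUnit (pullGram (k · ·) L).det :=
  (Matrix.isUnit_iff_isUnit_det _).1 (hk.posDef_pullGram hL).isUnit

/-- The inverse Gram matrix is positive definite, hence of the form `Bᵀ B`. Then `B A Bᵀ = 1`, which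
says that the rows of `B` are the coordinates of an orthonormal frame. -/
theorem exists_pullFrame (hk : IsInnerForm k) (hL : Function.Injective L) :
    ∃ e, IsPullFrame (k · ·) L e := by
  have hp := (hk.posDef_pullGram hL).inv
  open scoped MatrixOrder in
  obtain ⟨B, hB⟩ := CStarAlgebra.nonneg_iff_eq_star_mul_self.mp hp.posSemidef.nonneg
  set A := pullGram (k · ·) L with hA
  have hB' : A⁻¹ = B.transpose * B := by
    rw [hB, Matrix.star_eq_conjTranspose, Matrix.conjTranspose_eq_transpose_of_trivial]
  have h1 : B * (A * B.transpose) = 1 := by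
    have h2 : (A * B.transpose) * B = 1 := by
      rw [Matrix.mul_assoc, ← hB', Matrix.mul_nonsing_inv _ (hk.isUnit_det hL)]
    exact mul_eq_one_comm.1 h2
  refine ⟨fun l => ∑ i, B l i • Module.finBasis ℝ E' i, fun i j => ?_⟩
  have h3 := congrFun (congrFun h1 i) j
  rw [Matrix.one_apply] at h3
  rw [← h3]
  exact (dotProduct_pullGram k L _ _).symm

theorem inv_pullGram_eq (_hk : IsInnerForm k) {e : Fin (Module.finrank ℝ E') → E'}
    (he : IsPullFrame (k · ·) L e) (i j : Fin (Module.finrank ℝ E')) :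
    (pullGram (k · ·) L)⁻¹ i j
      = ∑ l, (Module.finBasis ℝ E').repr (e l) i * (Module.finBasis ℝ E').repr (e l) j := by
  set A := pullGram (k · ·) L with hA
  set B : Matrix (Fin (Module.finrank ℝ E')) (Fin (Module.finrank ℝ E')) ℝ :=
    Matrix.of fun l i => (Module.finBasis ℝ E').repr (e l) i with hB
  have h1 : B * (A * B.transpose) = 1 := by
    ext i j
    rw [Matrix.one_apply, ← he i j]
    refine (dotProduct_pullGram k L (B i) (B j)).trans ?_
    simp only [hB, Matrix.of_apply, (Module.finBasis ℝ E').sum_repr]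
  have h2 : A * (B.transpose * B) = 1 := by
    rw [← Matrix.mul_assoc]; exact mul_eq_one_comm.1 h1
  rw [Matrix.inv_eq_right_inv h2]
  simp [Matrix.mul_apply, hB]

/-- For every orthonormal frame with coordinate matrix `B`, the inverse Gram matrix is `Bᵀ B`;
contracting with it is therefore summing over the frame. This links the coordinate definition of the
mean curvature to `∑ α(e_i, e_i)`. -/
theorem normalTrace_eq_sum (hk : IsInnerForm k) {e : Fin (Module.finrank ℝ E') → E'}
    (he : IsPullFrame (k · ·) L e) (Q : E' →L[ℝ] E' →L[ℝ] V) :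
    normalTrace (k · ·) L (Q · ·) = ∑ l, normalComponent (k · ·) L (Q (e l) (e l)) := by
  set N : V →ₗ[ℝ] V :=
    { toFun := normalComponent (k · ·) L
      map_add' := fun x y => by
        simp only [normalComponent, map_add, add_apply, mul_add, add_smul, Finset.sum_add_distrib]
        abel
      map_smul' := fun c x => by
        simp only [normalComponent, map_smul, smul_apply, smul_eq_mul, RingHom.id_apply, smul_sub,
          Finset.smul_sum, smul_smul]
        refine congrArg _ (Finset.sum_congr rfl fun i _ => Finset.sum_congr rfl fun j _ => ?_)
        ring_nf } with hN
  have h1 : ∀ l, normalComponent (k · ·) L (Q (e l) (e l)) = ∑ i, ∑ j,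
      ((Module.finBasis ℝ E').repr (e l) i * (Module.finBasis ℝ E').repr (e l) j) •
        N (Q (Module.finBasis ℝ E' i) (Module.finBasis ℝ E' j)) := by
    intro l
    change N (Q (e l) (e l)) = _
    conv_lhs => rw [← (Module.finBasis ℝ E').sum_repr (e l)]
    simp only [map_sum, map_smul, sum_apply, smul_apply, Finset.smul_sum, smul_smul]
    rw [Finset.sum_comm]
    refine Finset.sum_congr rfl fun i _ => Finset.sum_congr rfl fun j _ => ?_
    rw [mul_comm]
  simp only [h1]
  rw [Finset.sum_comm, normalTrace]
  refine Finset.sum_congr rfl fun i _ => ?_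
  rw [Finset.sum_comm]
  refine Finset.sum_congr rfl fun j _ => ?_
  rw [hk.inv_pullGram_eq he, Finset.sum_smul]
  rfl

theorem exists_sub_normalComponent (k : V →L[ℝ] V →L[ℝ] ℝ) (L : E' →L[ℝ] V) (w : V) :
    ∃ a, w - normalComponent (k · ·) L w = L a := by
  refine ⟨∑ i, ∑ j, ((pullGram (k · ·) L)⁻¹ i j * k w (L (Module.finBasis ℝ E' j))) •
    Module.finBasis ℝ E' i, ?_⟩
  simp [normalComponent]

theorem normalComponent_orthogonal (hk : IsInnerForm k) (hL : Function.Injective L) (w : V)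
    (a : E') : k (normalComponent (k · ·) L w) (L a) = 0 := by
  have hb : ∀ l, k (normalComponent (k · ·) L w) (L (Module.finBasis ℝ E' l)) = 0 := by
    intro l
    set A := pullGram (k · ·) L with hA
    simp only [normalComponent, map_sub, map_sum, map_smul, sub_apply, sum_apply, smul_apply,
      smul_eq_mul]
    have h1 : ∀ j, ∑ i, A⁻¹ i j * k (L (Module.finBasis ℝ E' i)) (L (Module.finBasis ℝ E' l))
        = if j = l then 1 else 0 := by
      intro j
      have h2 := congrFun (congrFun (Matrix.nonsing_inv_mul _ (hk.isUnit_det hL)) j) l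
      rw [Matrix.one_apply, Matrix.mul_apply] at h2
      rw [← h2]
      refine Finset.sum_congr rfl fun i _ => ?_
      have h3 : A⁻¹ i j = A⁻¹ j i := by
        have := (hk.posDef_pullGram hL).inv.isHermitian.apply i j
        simpa using this.symm
      rw [h3]; rfl
    have h2 : ∑ i, ∑ j, A⁻¹ i j * k w (L (Module.finBasis ℝ E' j))
        * k (L (Module.finBasis ℝ E' i)) (L (Module.finBasis ℝ E' l))
        = ∑ j, k w (L (Module.finBasis ℝ E' j)) * ∑ i, A⁻¹ i j
          * k (L (Module.finBasis ℝ E' i)) (L (Module.finBasis ℝ E' l)) := by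
      rw [Finset.sum_comm]
      refine Finset.sum_congr rfl fun j _ => ?_
      rw [Finset.mul_sum]
      refine Finset.sum_congr rfl fun i _ => ?_
      ring
    rw [h2]
    simp [h1]
  rw [← (Module.finBasis ℝ E').sum_repr a]
  simp only [map_sum, map_smul, hb, smul_zero, Finset.sum_const_zero]

/-- Uniqueness of the orthogonal decomposition. It shows that the normal component depends only on
the range of `L`, whatever the basis used in the definition. -/
theorem eq_normalComponent (hk : IsInnerForm k) (hL : Function.Injective L) {w x : V} {a : E'}
    (ha : w - x = L a) (hx : ∀ a, k x (L a) = 0) : x = normalComponent (k · ·) L w := by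
  obtain ⟨b, hb⟩ := exists_sub_normalComponent k L w
  by_contra hne
  have h1 := hk.pos _ (sub_ne_zero.2 hne)
  have h2 : x - normalComponent (k · ·) L w = L (b - a) := by rw [map_sub, ← ha, ← hb]; abel
  have h3 : k (x - normalComponent (k · ·) L w) (x - normalComponent (k · ·) L w) = 0 := by
    nth_rewrite 2 [h2]
    simp [hx, hk.normalComponent_orthogonal hL]
  exact h1.ne' h3

theorem normalComponent_add_range (hk : IsInnerForm k) (hL : Function.Injective L) (w : V)
    (a : E') : normalComponent (k · ·) L (w + L a) = normalComponent (k · ·) L w := by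
  obtain ⟨b, hb⟩ := exists_sub_normalComponent k L w
  refine (hk.eq_normalComponent hL (a := a + b) ?_ fun c =>
    hk.normalComponent_orthogonal hL w c).symm
  rw [map_add, ← hb]; abel

theorem normalComponent_comp (hk : IsInnerForm k) (hL : Function.Injective L) {T : E' →L[ℝ] E'}
    (hT : Function.Injective T) (w : V) :
    normalComponent (k · ·) (L.comp T) w = normalComponent (k · ·) L w := by
  obtain ⟨b, hb⟩ := exists_sub_normalComponent k (L.comp T) w
  exact hk.eq_normalComponent hL (a := T b) hb fun c => by
    obtain ⟨c, rfl⟩ := (LinearMap.injective_iff_surjective (f := (T : E' →ₗ[ℝ] E'))).1 hT c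
    exact hk.normalComponent_orthogonal (L := L.comp T) (hL.comp hT) w c

/-- The normal trace does not change under a linear change of coordinates in the source, nor when
tangential vectors are added. -/
theorem normalTrace_comp (hk : IsInnerForm k) (hL : Function.Injective L) {T : E' →L[ℝ] E'}
    (hT : Function.Injective T) {Q Q' : E' →L[ℝ] E' →L[ℝ] V}
    (hQ : ∀ a, ∃ b, Q' a a = Q (T a) (T a) + L b) :
    normalTrace (k · ·) (L.comp T) (Q' · ·) = normalTrace (k · ·) L (Q · ·) := by
  obtain ⟨e, he⟩ := hk.exists_pullFrame (L := L.comp T) (hL.comp hT)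
  -- The image under `T` of an orthonormal frame for `L.comp T` is an orthonormal frame for `L`.
  rw [hk.normalTrace_eq_sum he, hk.normalTrace_eq_sum (L := L) (e := fun i => T (e i)) he]
  refine Finset.sum_congr rfl fun l _ => ?_
  obtain ⟨b, hb⟩ := hQ (e l)
  rw [hk.normalComponent_comp hL hT, hb, hk.normalComponent_add_range hL]

end IsInnerForm

theorem normalTrace_map {W : Type*} [NormedAddCommGroup W] [NormedSpace ℝ W] {k : W → W → ℝ}
    {k' : V → V → ℝ} (A : V →L[ℝ] W) (hA : ∀ a b, k' a b = k (A a) (A b)) (L : E' → V)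
    (Q : E' → E' → V) :
    normalTrace k (fun a => A (L a)) (fun a b => A (Q a b)) = A (normalTrace k' L Q) := by
  have hg : pullGram k (fun a => A (L a)) = pullGram k' L := by
    ext i j; simp [pullGram, hA]
  have hn : ∀ w, normalComponent k (fun a => A (L a)) (A w) = A (normalComponent k' L w) := by
    intro w
    simp [normalComponent, hg, hA]
  simp [normalTrace, hg, hn]

end NormalTrace

/-! ### Mean curvature of an immersion between open subsets of vector spaces -/

section FlatMeanCurvature

attribute [-instance]
  Bundle.instNormedAddCommGroupOfRiemannianBundleOfIsTopologicalAddGroupOfContinuousConstSMulReal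
  Bundle.instInnerProductSpaceReal

open Filter Topology

theorem two_le_infty : (2 : WithTop ℕ∞) ≤ ((⊤ : ℕ∞) : WithTop ℕ∞) := ENat.LEInfty.out

theorem fderiv_fderiv_comp {X Y Z : Type*} [NormedAddCommGroup X] [NormedSpace ℝ X]
    [NormedAddCommGroup Y] [NormedSpace ℝ Y] [NormedAddCommGroup Z] [NormedSpace ℝ Z]
    {f : Y → Z} {g : X → Y} {x : X} (hf : ContDiffAt ℝ 2 f (g x)) (hg : ContDiffAt ℝ 2 g x)
    (a b : X) : fderiv ℝ (fderiv ℝ (f ∘ g)) x a b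
      = fderiv ℝ (fderiv ℝ f) (g x) (fderiv ℝ g x a) (fderiv ℝ g x b)
        + fderiv ℝ f (g x) (fderiv ℝ (fderiv ℝ g) x a b) := by
  have he : fderiv ℝ (f ∘ g) =ᶠ[𝓝 x] fun y => (fderiv ℝ f (g y)).comp (fderiv ℝ g y) := by
    have h1 : ∀ᶠ y in 𝓝 x, DifferentiableAt ℝ g y :=
      (hg.eventually (by simp)).mono fun y hy => hy.differentiableAt (by simp)
    have h2 : ∀ᶠ y in 𝓝 x, DifferentiableAt ℝ f (g y) :=
      hg.continuousAt.eventually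
        ((hf.eventually (by simp)).mono fun y hy => hy.differentiableAt (by simp))
    filter_upwards [h1, h2] with y hy hy' using fderiv_comp y hy' hy
  rw [he.fderiv_eq]
  have h1 : HasFDerivAt (fderiv ℝ f) (fderiv ℝ (fderiv ℝ f) (g x)) (g x) :=
    ((hf.fderiv_right (m := 1) (by norm_num)).differentiableAt (by simp)).hasFDerivAt
  have h2 : HasFDerivAt (fderiv ℝ g) (fderiv ℝ (fderiv ℝ g) x) x :=
    ((hg.fderiv_right (m := 1) (by norm_num)).differentiableAt (by simp)).hasFDerivAt
  have h3 := (h1.comp x (hg.differentiableAt (by simp)).hasFDerivAt).clm_comp h2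
  erw [h3.fderiv]
  simp [add_comm]

/-- On the line through `x` in the direction `e`, a positive second derivative at the critical point
would force a local minimum. Together with the local maximum the restriction would be locally
constant, contradicting positivity. -/
theorem fderiv_fderiv_nonpos_of_isLocalMax {X : Type*} [NormedAddCommGroup X] [NormedSpace ℝ X]
    {f : X → ℝ} {x : X} (hf : ContDiffAt ℝ 2 f x) (hmax : IsLocalMax f x) (e : X) :
    fderiv ℝ (fderiv ℝ f) x e e ≤ 0 := by
  set c : ℝ → ℝ := fun t => f (x + t • e) with hc
  have hl : ∀ t : ℝ, HasDerivAt (fun t : ℝ => x + t • e) e t := fun t => by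
    simpa using ((hasDerivAt_id t).smul_const e).const_add x
  have hx : x + (0 : ℝ) • e = x := by simp
  have htd : Tendsto (fun t : ℝ => x + t • e) (𝓝 0) (𝓝 x) := by
    simpa using (hl 0).continuousAt.tendsto
  have h1 : ∀ᶠ t in 𝓝 (0 : ℝ), HasDerivAt c (fderiv ℝ f (x + t • e) e) t := by
    filter_upwards [htd.eventually (hf.eventually (by simp))] with t ht
    exact (ht.differentiableAt (by simp)).hasFDerivAt.comp_hasDerivAt t (hl t)
  have h2 : deriv c =ᶠ[𝓝 0] fun t => fderiv ℝ f (x + t • e) e := h1.mono fun t ht => ht.deriv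
  have h3 : deriv (deriv c) 0 = fderiv ℝ (fderiv ℝ f) x e e := by
    rw [h2.deriv_eq]
    have hd : HasFDerivAt (fderiv ℝ f) (fderiv ℝ (fderiv ℝ f) x) (x + (0 : ℝ) • e) := by
      rw [hx]
      exact ((hf.fderiv_right (m := 1) (by norm_num)).differentiableAt (by simp)).hasFDerivAt
    have hd' : HasDerivAt (fun t : ℝ => fderiv ℝ f (x + t • e)) (fderiv ℝ (fderiv ℝ f) x e) 0 :=
      hd.comp_hasDerivAt 0 (hl 0)
    have hd'' : HasDerivAt (fun t : ℝ => fderiv ℝ f (x + t • e) e)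
        (fderiv ℝ (fderiv ℝ f) x e e) 0 :=
      (hd'.clm_apply (hasDerivAt_const 0 e)).congr_deriv (by simp)
    exact hd''.deriv
  have hcmax : IsLocalMax c 0 := by
    have := htd.eventually hmax
    simpa [IsLocalMax, IsMaxFilter, hc] using this
  by_contra! hpos
  rw [← h3] at hpos
  have hmin := isLocalMin_of_deriv_deriv_pos hpos hcmax.deriv_eq_zero h1.self_of_nhds.continuousAt
  have hconst : c =ᶠ[𝓝 0] fun _ => c 0 := by
    filter_upwards [hmin, hcmax] with t ht ht' using le_antisymm ht' ht
  have h4 : deriv c =ᶠ[𝓝 0] fun _ => 0 := by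
    simpa using hconst.deriv
  rw [h4.deriv_eq] at hpos
  simp at hpos

variable {E' : Type*} [NormedAddCommGroup E'] [NormedSpace ℝ E'] [FiniteDimensional ℝ E']
  {V : Type*} [NormedAddCommGroup V] [NormedSpace ℝ V]

/-- The covariant second derivative of a map. -/
def covSecondDeriv (h : V → V →L[ℝ] V →L[ℝ] ℝ) (F : E' → V) (z : E') : E' →L[ℝ] E' →L[ℝ] V :=
  fderiv ℝ (fderiv ℝ F) z + (lcSecond h (F z)).bilinearComp (fderiv ℝ F z) (fderiv ℝ F z)

/-- The mean curvature vector of a map into a vector space with metric `h`. -/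
def flatMeanCurvature (h : V → V →L[ℝ] V →L[ℝ] ℝ) (F : E' → V) (z : E') : V :=
  normalTrace (h (F z) · ·) (fderiv ℝ F z) (covSecondDeriv h F z · ·)

omit [FiniteDimensional ℝ E'] in
theorem covSecondDeriv_apply (h : V → V →L[ℝ] V →L[ℝ] ℝ) (F : E' → V) (z a b : E') :
    covSecondDeriv h F z a b = fderiv ℝ (fderiv ℝ F) z a b
      + lcSecond h (F z) (fderiv ℝ F z a) (fderiv ℝ F z b) := by
  simp [covSecondDeriv]

theorem flatMeanCurvature_congr (h : V → V →L[ℝ] V →L[ℝ] ℝ) {F F' : E' → V} {z : E'}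
    (hF : F =ᶠ[𝓝 z] F') : flatMeanCurvature h F z = flatMeanCurvature h F' z := by
  simp only [flatMeanCurvature, covSecondDeriv_apply, hF.eq_of_nhds, hF.fderiv_eq,
    hF.fderiv.fderiv_eq]

/-- The second derivative of `F ∘ θ` on `(a, a)` differs from that of `F` on `(Dθ a, Dθ a)` by the
tangential vector `DF(D²θ(a, a))`, which the normal projection removes. -/
theorem IsMetricOn.flatMeanCurvature_comp {h : V → V →L[ℝ] V →L[ℝ] ℝ} {U : Set V}
    (hh : IsMetricOn h U) {F : E' → V} {θ : E' → E'} {z : E'} (hz : F (θ z) ∈ U)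
    (hF : ContDiffAt ℝ ∞ F (θ z)) (hθ : ContDiffAt ℝ ∞ θ z)
    (hFi : Function.Injective (fderiv ℝ F (θ z))) (hθi : Function.Injective (fderiv ℝ θ z)) :
    flatMeanCurvature h (F ∘ θ) z = flatMeanCurvature h F (θ z) := by
  have hc : fderiv ℝ (F ∘ θ) z = (fderiv ℝ F (θ z)).comp (fderiv ℝ θ z) :=
    fderiv_comp z (hF.differentiableAt (by simp)) (hθ.differentiableAt (by simp))
  have h2 := two_le_infty
  unfold flatMeanCurvature
  rw [hc]
  refine (hh.isInnerForm hz).normalTrace_comp hFi hθi fun a =>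
    ⟨fderiv ℝ (fderiv ℝ θ) z a a, ?_⟩
  rw [covSecondDeriv_apply, covSecondDeriv_apply, hc,
    fderiv_fderiv_comp (hF.of_le h2) (hθ.of_le h2)]
  simp only [ContinuousLinearMap.comp_apply, Function.comp_apply]
  abel

/-- The term `D²ψ` from the chain rule is exactly the inhomogeneous term in the transformation law
of the Christoffel symbols, so the covariant second derivative is mapped by `Dψ`. -/
theorem IsLocalIsometryOn.flatMeanCurvature_comp [FiniteDimensional ℝ V] {ψ : V → V}
    {G h : V → V →L[ℝ] V →L[ℝ] ℝ} {V₀ U : Set V} (H : IsLocalIsometryOn ψ G V₀ h U) {F : E' → V}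
    {z : E'} (hz : F z ∈ V₀) (hF : ContDiffAt ℝ ∞ F z) :
    flatMeanCurvature h (ψ ∘ F) z = fderiv ℝ ψ (F z) (flatMeanCurvature G F z) := by
  have h2 := two_le_infty
  have hc : fderiv ℝ (ψ ∘ F) z = (fderiv ℝ ψ (F z)).comp (fderiv ℝ F z) :=
    fderiv_comp z ((H.contDiffAt hz).differentiableAt (by simp)) (hF.differentiableAt (by simp))
  unfold flatMeanCurvature
  rw [← normalTrace_map (k := (h (ψ (F z)) · ·)) (fderiv ℝ ψ (F z)) (H.pull _ hz)]
  congr 1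
  · rw [hc]; rfl
  · funext a b
    rw [covSecondDeriv_apply, covSecondDeriv_apply, hc, map_add, H.lcSecond_map hz,
      fderiv_fderiv_comp ((H.contDiffAt hz).of_le h2) (hF.of_le h2)]
    simp only [ContinuousLinearMap.comp_apply, Function.comp_apply]
    abel

theorem continuousAt_normalTrace {X : Type*} [TopologicalSpace X] {K : X → V →L[ℝ] V →L[ℝ] ℝ} {L : X → E' →L[ℝ] V}
    {S : X → E' →L[ℝ] E' →L[ℝ] V} {x : X} (hK : ContinuousAt K x) (hL : ContinuousAt L x)
    (hS : ∀ a b, ContinuousAt (fun x => S x a b) x) (hk : IsInnerForm (K x))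
    (hi : Function.Injective (L x)) :
    ContinuousAt (fun x => normalTrace (K x · ·) (L x) (S x · ·)) x := by
  have hg : ContinuousAt (fun x => pullGram (K x · ·) (L x)) x := by
    refine continuousAt_pi.2 fun i => continuousAt_pi.2 fun j => ?_
    simp only [pullGram, Matrix.of_apply]
    fun_prop
  have hinv : ContinuousAt (fun x => (pullGram (K x · ·) (L x))⁻¹) x := by
    refine ContinuousAt.comp (f := fun x => pullGram (K x · ·) (L x))
      (g := Inv.inv) (continuousAt_matrix_inv _ ?_) hg
    exact NormedRing.inverse_continuousAt (hk.isUnit_det hi).unit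
  have hinv' : ∀ i j, ContinuousAt (fun x => (pullGram (K x · ·) (L x))⁻¹ i j) x :=
    fun i j => continuousAt_pi.1 (continuousAt_pi.1 hinv i) j
  have hN : ∀ a b, ContinuousAt (fun x => normalComponent (K x · ·) (L x) (S x a b)) x := by
    intro a b
    have := hS a b
    refine this.sub (tendsto_finsetSum _ fun i _ => tendsto_finsetSum _ fun j _ => ?_)
    have h1 : ContinuousAt (fun x => L x (Module.finBasis ℝ E' i)) x := by fun_prop
    have h2 : ContinuousAt (fun x => K x (S x a b) (L x (Module.finBasis ℝ E' j))) x := by fun_prop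
    exact ((hinv' i j).mul h2).smul h1
  exact tendsto_finsetSum _ fun i _ => tendsto_finsetSum _ fun j _ =>
    (hinv' i j).smul (hN _ _)

theorem IsMetricOn.continuousAt_flatMeanCurvature [FiniteDimensional ℝ V]
    {h : V → V →L[ℝ] V →L[ℝ] ℝ} {U : Set V} (hh : IsMetricOn h U) {F : E' → V} {z : E'}
    (hz : F z ∈ U) (hF : ContDiffAt ℝ ∞ F z) (hi : Function.Injective (fderiv ℝ F z)) :
    ContinuousAt (flatMeanCurvature h F) z := by
  have hF0 := hF.continuousAt
  have hF1 : ContDiffAt ℝ ∞ (fderiv ℝ F) z := hF.fderiv_right (by simp)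
  have hF2 : ContDiffAt ℝ ∞ (fderiv ℝ (fderiv ℝ F)) z := hF1.fderiv_right (by simp)
  have hf1 := hF1.continuousAt
  have hf2 := hF2.continuousAt
  have hhc : ContinuousAt (fun z => h (F z)) z :=
    ContinuousAt.comp (f := F) (g := h) (hh.contDiffAt hz).continuousAt hF0
  have hΓ : ContinuousAt (fun z => lcSecond h (F z)) z :=
    ContinuousAt.comp (f := F) (g := lcSecond h) (hh.hasFDerivAt_lcSecond hz).continuousAt hF0
  have hS : ∀ a b, ContinuousAt (fun z => covSecondDeriv h F z a b) z := by
    intro a b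
    simp only [covSecondDeriv_apply]
    exact ((hf2.clm_apply continuousAt_const).clm_apply continuousAt_const).add
      ((hΓ.clm_apply (hf1.clm_apply continuousAt_const)).clm_apply
        (hf1.clm_apply continuousAt_const))
  exact continuousAt_normalTrace hhc hf1 hS (hh.isInnerForm hz) hi

/-- At a critical point of `q ∘ F` the differential of `q` vanishes on tangent vectors, so it does
not see the normal projection in the mean curvature vector. The chain rule for `D²(q ∘ F) ≤ 0` then
yields minus the trace of the covariant Hessian of `q` over the tangent space. -/
theorem IsMetricOn.fderiv_flatMeanCurvature_le {h : V → V →L[ℝ] V →L[ℝ] ℝ} {U : Set V}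
    (hh : IsMetricOn h U) {F : E' → V} {z : E'} (hz : F z ∈ U) (hF : ContDiffAt ℝ ∞ F z)
    (hi : Function.Injective (fderiv ℝ F z)) {q : V → ℝ} (hq : ContDiffAt ℝ ∞ q (F z))
    (hmax : IsLocalMax (q ∘ F) z) :
    (∀ a, fderiv ℝ q (F z) (fderiv ℝ F z a) = 0) ∧
    ∃ e, IsPullFrame (h (F z) · ·) (fderiv ℝ F z) e ∧
      fderiv ℝ q (F z) (flatMeanCurvature h F z) ≤
        - ∑ l, (fderiv ℝ (fderiv ℝ q) (F z) (fderiv ℝ F z (e l)) (fderiv ℝ F z (e l))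
          - fderiv ℝ q (F z) (lcSecond h (F z) (fderiv ℝ F z (e l)) (fderiv ℝ F z (e l)))) := by
  have h2 := two_le_infty
  have hcrit : ∀ a, fderiv ℝ q (F z) (fderiv ℝ F z a) = 0 := by
    intro a
    have h1 := hmax.fderiv_eq_zero
    rw [fderiv_comp z (hq.differentiableAt (by simp)) (hF.differentiableAt (by simp))] at h1
    exact congrArg (fun L => L a) h1
  refine ⟨hcrit, ?_⟩
  have hk := hh.isInnerForm hz
  obtain ⟨e, he⟩ := hk.exists_pullFrame (L := fderiv ℝ F z) hi
  refine ⟨e, he, ?_⟩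
  rw [flatMeanCurvature, hk.normalTrace_eq_sum he, map_sum, ← Finset.sum_neg_distrib]
  refine Finset.sum_le_sum fun l _ => ?_
  obtain ⟨a, ha⟩ := IsInnerForm.exists_sub_normalComponent (h (F z)) (fderiv ℝ F z)
    (covSecondDeriv h F z (e l) (e l))
  have h3 := hcrit a
  rw [← ha, map_sub, sub_eq_zero] at h3
  rw [← h3, covSecondDeriv_apply, map_add]
  have h4 := fderiv_fderiv_nonpos_of_isLocalMax
    ((hq.of_le h2).comp z (hF.of_le h2)) hmax (e l)
  rw [fderiv_fderiv_comp (hq.of_le h2) (hF.of_le h2)] at h4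
  linarith

end FlatMeanCurvature

/-! ### Products with a line -/

section ProductWithLine

attribute [-instance]
  Bundle.instNormedAddCommGroupOfRiemannianBundleOfIsTopologicalAddGroupOfContinuousConstSMulReal
  Bundle.instInnerProductSpaceReal

variable {E : Type*} [NormedAddCommGroup E] [NormedSpace ℝ E]

/-- The product of the metric `G` with the standard metric of the line. -/
def lineProd (G : E → E →L[ℝ] E →L[ℝ] ℝ) (p : E × ℝ) : E × ℝ →L[ℝ] E × ℝ →L[ℝ] ℝ :=
  (G p.1).bilinearComp (ContinuousLinearMap.fst ℝ E ℝ) (ContinuousLinearMap.fst ℝ E ℝ)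
    + (ContinuousLinearMap.mul ℝ ℝ).bilinearComp (ContinuousLinearMap.snd ℝ E ℝ)
      (ContinuousLinearMap.snd ℝ E ℝ)

theorem lineProd_apply (G : E → E →L[ℝ] E →L[ℝ] ℝ) (p a b : E × ℝ) :
    lineProd G p a b = G p.1 a.1 b.1 + a.2 * b.2 := by
  simp [lineProd]

theorem contDiffOn_lineProd [FiniteDimensional ℝ E] {G : E → E →L[ℝ] E →L[ℝ] ℝ} {U : Set E}
    (hG : ContDiffOn ℝ ∞ G U) : ContDiffOn ℝ ∞ (lineProd G) (U ×ˢ univ) := by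
  refine contDiffOn_clm_apply.2 fun a => contDiffOn_clm_apply.2 fun b => ?_
  simp only [lineProd_apply]
  have h1 : ContDiffOn ℝ ∞ (fun p : E × ℝ => G p.1) (U ×ˢ univ) :=
    hG.comp contDiff_fst.contDiffOn fun p hp => hp.1
  exact ((h1.clm_apply contDiffOn_const).clm_apply contDiffOn_const).add contDiffOn_const

variable [FiniteDimensional ℝ E] {G : E → E →L[ℝ] E →L[ℝ] ℝ} {U : Set E}

theorem IsMetricOn.lineProd (hG : IsMetricOn G U) : IsMetricOn (lineProd G) (U ×ˢ univ) where
  isOpen := hG.isOpen.prod isOpen_univ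
  contDiffOn := contDiffOn_lineProd hG.contDiffOn
  symm p hp a b := by rw [lineProd_apply, lineProd_apply, hG.symm p.1 hp.1, mul_comm a.2]
  pos p hp a ha := by
    rw [lineProd_apply]
    by_cases h1 : a.1 = 0
    · have h2 : a.2 ≠ 0 := fun h2 => ha (Prod.ext h1 h2)
      rw [h1]
      simpa using mul_self_pos.2 h2
    · have := hG.pos p.1 hp.1 a.1 h1
      nlinarith [mul_self_nonneg a.2]

theorem IsMetricOn.fderiv_lineProd (hG : IsMetricOn G U) {p : E × ℝ} (hp : p.1 ∈ U)
    (c a b : E × ℝ) : fderiv ℝ (_root_.lineProd G) p c a b = fderiv ℝ G p.1 c.1 a.1 b.1 := by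
  have h1 := hG.lineProd.hasFDerivAt_apply (y := p) ⟨hp, trivial⟩ a b
  have h2 := ((((hG.hasFDerivAt hp).comp p hasFDerivAt_fst).clm_apply
    (hasFDerivAt_const a.1 p)).clm_apply (hasFDerivAt_const b.1 p)).add_const (a.2 * b.2)
  have h3 : (fun z => _root_.lineProd G z a b) = fun z => G z.1 a.1 b.1 + a.2 * b.2 :=
    funext fun z => lineProd_apply G z a b
  rw [h3] at h1
  have := congrArg (fun L => L c) (h1.unique h2)
  simpa using this

theorem IsMetricOn.lcSecond_lineProd (hG : IsMetricOn G U) {p : E × ℝ} (hp : p.1 ∈ U)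
    (a b : E × ℝ) : lcSecond (_root_.lineProd G) p a b = (lcSecond G p.1 a.1 b.1, 0) := by
  refine (hG.lineProd.eq_lcSecond (y := p) ⟨hp, trivial⟩ fun c => ?_).symm
  rw [lineProd_apply, lcFirst_apply, hG.fderiv_lineProd hp, hG.fderiv_lineProd hp,
    hG.fderiv_lineProd hp, hG.lcSecond_apply hp, lcFirst_apply]
  simp

end ProductWithLine

/-! ### The mean curvature at a point of maximal distance -/

section FarthestPoint

attribute [-instance]
  Bundle.instNormedAddCommGroupOfRiemannianBundleOfIsTopologicalAddGroupOfContinuousConstSMulReal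
  Bundle.instInnerProductSpaceReal

variable {E : Type*} [NormedAddCommGroup E] [NormedSpace ℝ E]
  {E' : Type*} [NormedAddCommGroup E'] [NormedSpace ℝ E'] [FiniteDimensional ℝ E']

omit [FiniteDimensional ℝ E'] in
theorem IsPullFrame.bessel {V : Type*} [NormedAddCommGroup V] [NormedSpace ℝ V]
    {k : V →L[ℝ] V →L[ℝ] ℝ} (hk : IsInnerForm k) {L : E' →L[ℝ] V}
    {e : Fin (Module.finrank ℝ E') → E'} (he : IsPullFrame (k · ·) L e) (w : V) :
    ∑ l, k w (L (e l)) ^ 2 ≤ k w w := by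
  have hn : ∀ a, 0 ≤ k a a := fun a => by
    by_cases ha : a = 0
    · simp [ha]
    · exact (hk.pos a ha).le
  have h1 := hn (w - ∑ l, k w (L (e l)) • L (e l))
  have h2 : ∀ l, k (L (e l)) w = k w (L (e l)) := fun l => hk.symm _ _
  have h3 : ∀ i j, k (L (e i)) (L (e j)) = if i = j then 1 else 0 := he
  simp only [map_sub, map_sum, map_smul, sub_apply, sum_apply, smul_apply, smul_eq_mul, h2, h3,
    mul_ite, mul_one, mul_zero, Finset.sum_ite_eq', Finset.mem_univ,
    if_true, sub_self, Finset.sum_const_zero, ← pow_two] at h1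
  linarith

omit [FiniteDimensional ℝ E'] in
-- Such an `L` embeds `E'` into the line. This later excludes that `p₁ ∘ φ` is constant.
theorem finrank_le_one_of_fst_eq_zero {L : E' →L[ℝ] E × ℝ} (hL : Function.Injective L)
    (h : ∀ a, (L a).1 = 0) : Module.finrank ℝ E' ≤ 1 := by
  have hi : Function.Injective ((ContinuousLinearMap.snd ℝ E ℝ).comp L : E' →ₗ[ℝ] ℝ) := by
    intro a b hab
    exact hL (Prod.ext (by rw [h, h]) hab)
  simpa using LinearMap.finrank_le_finrank_of_injective hi

variable [FiniteDimensional ℝ E] {G : E → E →L[ℝ] E →L[ℝ] ℝ} {r : ℝ}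

/-- The Hessian comparison is summed over an orthonormal frame at a maximum of the radial
coordinate. Only directions orthogonal to the ray occur, by criticality, and the line factor costs
at most one dimension, by Bessel. When `ctK` is positive the argument yields the factor `m - 1`,
stronger than the stated `m - 2`. -/
theorem IsNormalMetric.ctK_mul_le_flatMeanCurvature (H : IsNormalMetric G r) {κ : ℝ}
    (hcurv : ∀ z ∈ normalBall G r, z ≠ 0 → ∀ b, G z z b = 0 →
      G z (connCurv (lcSecond G) z z b b) z ≤ κ * (G z z z * G z b b))
    {F : E' → E × ℝ} {z : E'} (hz : (F z).1 ∈ normalBall G r)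
    (hF : ContDiffAt ℝ ((⊤ : ℕ∞) : WithTop ℕ∞) F z)
    (hi : Function.Injective (fderiv ℝ F z))
    (hmax : IsLocalMax (fun z => G 0 (F z).1 (F z).1) z)
    (hρ : √(G 0 (F z).1 (F z).1) ∈ ctDomain κ) (hm : 2 ≤ Module.finrank ℝ E') :
    ctK κ (√(G 0 (F z).1 (F z).1)) * ((Module.finrank ℝ E' : ℝ) - 2)
      ≤ √(lineProd G (F z) (flatMeanCurvature (lineProd G) F z)
          (flatMeanCurvature (lineProd G) F z)) := by
  set v := (F z).1 with hv
  set ρ := √(G 0 v v) with hρdef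
  set X := flatMeanCurvature (lineProd G) F z with hX
  have hm' : (2 : ℝ) ≤ Module.finrank ℝ E' := by exact_mod_cast hm
  -- The Bessel bound below is multiplied by `ρ * ctK κ ρ`, which requires a positive sign;
  -- otherwise the left-hand side is nonpositive.
  rcases le_or_gt (ctK κ ρ) 0 with hneg | hct
  · exact (mul_nonpos_of_nonpos_of_nonneg hneg (by linarith)).trans (Real.sqrt_nonneg _)
  have hρ0 : 0 < ρ := hρ.1
  have hρ2 : ρ ^ 2 = G 0 v v := Real.sq_sqrt (H.metric.nonneg H.zero_mem v)
  have hmet := H.metric.lineProd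
  have hz' : F z ∈ normalBall G r ×ˢ (univ : Set ℝ) := ⟨hz, trivial⟩
  set B : E × ℝ →L[ℝ] E × ℝ →L[ℝ] ℝ :=
    (G 0).bilinearComp (ContinuousLinearMap.fst ℝ E ℝ) (ContinuousLinearMap.fst ℝ E ℝ) with hB
  have hBa : ∀ a b, B a b = G 0 a.1 b.1 := fun a b => by simp [hB]
  set q : E × ℝ → ℝ := fun p => (1 / 2) * B p p with hq
  have hqd : ∀ p, HasFDerivAt q (B p) p := by
    intro p
    have h1 := ((B.hasFDerivAt (x := p)).clm_apply (hasFDerivAt_id p)).const_mul (1 / 2)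
    refine h1.congr_fderiv ?_
    ext a <;> simp [hBa, H.metric.symm 0 H.zero_mem _ p.1]
    ring
  have hq1 : fderiv ℝ q = fun p => B p := funext fun p => (hqd p).fderiv
  have hq2 : ∀ p, fderiv ℝ (fderiv ℝ q) p = B := fun p => by
    rw [hq1]; exact B.fderiv
  have hqs : ContDiffAt ℝ ((⊤ : ℕ∞) : WithTop ℕ∞) q (F z) := by
    have : ContDiff ℝ ((⊤ : ℕ∞) : WithTop ℕ∞) q :=
      contDiff_const.mul (B.contDiff.clm_apply contDiff_id)
    exact this.contDiffAt
  have hqmax : IsLocalMax (q ∘ F) z := by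
    filter_upwards [hmax] with y hy
    simp only [hq, Function.comp_apply, hBa]
    linarith
  obtain ⟨hcrit, e, he, hle⟩ := hmet.fderiv_flatMeanCurvature_le hz' hF hi hqs hqmax
  simp only [hq2] at hle
  simp only [hq1, hBa] at hcrit hle
  rw [← hv, ← hX] at hle
  rw [← hv] at hcrit
  have h1 : ∀ l, ρ * ctK κ ρ * (1 - (fderiv ℝ F z (e l)).2 ^ 2)
      ≤ G 0 (fderiv ℝ F z (e l)).1 (fderiv ℝ F z (e l)).1
        - G 0 v (lcSecond (lineProd G) (F z) (fderiv ℝ F z (e l)) (fderiv ℝ F z (e l))).1 := by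
    intro l
    have h2 := H.le_hessian hz hcurv hρ (hcrit (e l))
    rw [H.metric.lcSecond_lineProd hz, ← H.gauss hz]
    refine le_trans (le_of_eq ?_) h2
    have h3 := he l l
    simp only [lineProd_apply, if_true, ← hv] at h3
    rw [← h3]
    ring
  -- Bessel's inequality for the vertical unit vector `(0, 1)`.
  have h2 : ∑ l, (fderiv ℝ F z (e l)).2 ^ 2 ≤ 1 := by
    have := he.bessel (hmet.isInnerForm hz') ((0, 1) : E × ℝ)
    simpa [lineProd_apply] using this
  have h3 : ρ * ctK κ ρ * ((Module.finrank ℝ E' : ℝ) - 1) ≤ - G 0 v X.1 := by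
    have h4 := Finset.sum_le_sum fun l (_ : l ∈ Finset.univ) => h1 l
    rw [← Finset.mul_sum, Finset.sum_sub_distrib] at h4
    simp only [Finset.sum_const, Finset.card_univ, Fintype.card_fin, nsmul_eq_mul, mul_one] at h4
    have h5 : 0 < ρ * ctK κ ρ := mul_pos hρ0 hct
    nlinarith
  -- The Gauss lemma replaces `G 0 v` by `G v v`; Cauchy–Schwarz follows, and the line component of
  -- `X` only increases its length.
  have h4 : - G 0 v X.1 ≤ ρ * √(lineProd G (F z) X X) := by
    refine le_trans (neg_le_abs _) (abs_le_of_sq_le_sq ?_ (by positivity))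
    rw [mul_pow, Real.sq_sqrt (hmet.nonneg hz' X), hρ2, ← H.gauss hz, ← H.apply_self hz]
    refine (H.metric.cauchy_schwarz hz v X.1).trans ?_
    refine mul_le_mul_of_nonneg_left ?_ (H.metric.nonneg hz v)
    rw [lineProd_apply]
    nlinarith [mul_self_nonneg X.2]
  have h5 : ρ * (ctK κ ρ * ((Module.finrank ℝ E' : ℝ) - 1)) ≤ ρ * √(lineProd G (F z) X X) := by
    linarith
  have h6 := le_of_mul_le_mul_left h5 hρ0
  nlinarith

end FarthestPoint

/-! ### Riemannian manifolds in charts -/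

section Charts

attribute [-instance]
  Bundle.instNormedAddCommGroupOfRiemannianBundleOfIsTopologicalAddGroupOfContinuousConstSMulReal
  Bundle.instInnerProductSpaceReal

open Filter Topology

variable {E : Type*} [NormedAddCommGroup E] [NormedSpace ℝ E] [FiniteDimensional ℝ E]
  {H : Type*} [TopologicalSpace H] {I : ModelWithCorners ℝ E H}
  {W : Type*} [TopologicalSpace W] [ChartedSpace H W]

/-- `h` is the coordinate expression of the metric `g` in the chart at `p`, on the open set `U`. -/
structure IsChartMetric (g : MetricField I W) (p : W) (h : E → E →L[ℝ] E →L[ℝ] ℝ) (U : Set E) :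
    Prop where
  metric : IsMetricOn h U
  eq : ∀ y ∈ U, ∀ u v, chartMetric g p y u v = h y u v

namespace IsChartMetric

variable {g : MetricField I W} {p : W} {h : E → E →L[ℝ] E →L[ℝ] ℝ} {U : Set E} {y : E}

omit [FiniteDimensional ℝ E] in
theorem christoffelFirst_eq (H : IsChartMetric g p h U) (hy : y ∈ U) (u v w : E) :
    christoffelFirst g p y u v w = lcFirst h y u v w := by
  have hd : ∀ a b c, fderiv ℝ (fun z => chartMetric g p z a b) y c = fderiv ℝ h y c a b := by
    intro a b c
    have he : (fun z => chartMetric g p z a b) =ᶠ[𝓝 y] fun z => h z a b := by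
      filter_upwards [H.metric.mem_nhds hy] with z hz using H.eq z hz a b
    rw [he.fderiv_eq, (H.metric.hasFDerivAt_apply hy a b).fderiv]
    rfl
  rw [christoffelFirst, hd, hd, hd, lcFirst_apply]

/-- For the identity embedding every normal component vanishes, so the inverse Gram expansion in
`normalComponent` reproduces its argument. Applied to `lcSecond h y u v`, that expansion is the
coordinate definition of `christoffel`. -/
theorem christoffel_eq (H : IsChartMetric g p h U) (hy : y ∈ U) (u v : E) :
    christoffel g p y u v = lcSecond h y u v := by
  have hk := H.metric.isInnerForm hy
  have hid : Function.Injective (ContinuousLinearMap.id ℝ E) := fun _ _ h => h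
  have hg : chartGram g p y = pullGram (h y · ·) (ContinuousLinearMap.id ℝ E) := by
    ext i j
    exact H.eq y hy _ _
  have h1 : lcSecond h y u v - normalComponent (h y · ·) (ContinuousLinearMap.id ℝ E)
      (lcSecond h y u v) = christoffel g p y u v := by
    rw [christoffel, hg, normalComponent, sub_sub_cancel]
    refine Finset.sum_congr rfl fun i _ => Finset.sum_congr rfl fun j _ => ?_
    rw [H.christoffelFirst_eq hy, H.metric.lcSecond_apply hy]
    rfl
  have h2 : (0 : E) = normalComponent (h y · ·) (ContinuousLinearMap.id ℝ E)
      (lcSecond h y u v) :=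
    hk.eq_normalComponent hid (sub_zero _) fun a => by simp
  rw [← h1, ← h2, sub_zero]

theorem riemannTensor_eq {x : W} (H : IsChartMetric g x h U) (hx : extChartAt I x x ∈ U)
    (u v w : E) : (riemannTensor g x (u : TangentSpace I x) (v : TangentSpace I x)
      (w : TangentSpace I x) : E) = connCurv (lcSecond h) (extChartAt I x x) u v w := by
  have hd : ∀ a b c : E, fderiv ℝ (fun z => christoffel g x z a b) (extChartAt I x x) c
      = fderiv ℝ (lcSecond h) (extChartAt I x x) c a b := by
    intro a b c
    have he : (fun z => christoffel g x z a b) =ᶠ[𝓝 (extChartAt I x x)]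
        fun z => lcSecond h z a b := by
      filter_upwards [H.metric.mem_nhds hx] with z hz using H.christoffel_eq hz a b
    have h1 : HasFDerivAt (fun z => lcSecond h z a b) _ (extChartAt I x x) :=
      ((H.metric.hasFDerivAt_lcSecond hx).clm_apply (hasFDerivAt_const a _)).clm_apply
        (hasFDerivAt_const b _)
    rw [he.fderiv_eq, h1.fderiv]
    simp
  change fderiv ℝ (fun z => christoffel g x z v w) (extChartAt I x x) u
    - fderiv ℝ (fun z => christoffel g x z u w) (extChartAt I x x) v
    + christoffel g x (extChartAt I x x) u (christoffel g x (extChartAt I x x) v w)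
    - christoffel g x (extChartAt I x x) v (christoffel g x (extChartAt I x x) u w) = _
  simp only [hd, H.christoffel_eq hx]
  rfl

variable [I.Boundaryless] [IsManifold I 1 W]

omit [FiniteDimensional ℝ E] in
/-- At the centre of a chart the coordinate expression of a metric is the metric itself. -/
theorem apply_center {x : W} (H : IsChartMetric g x h U) (hx : extChartAt I x x ∈ U) (u v : E) :
    h (extChartAt I x x) u v = g x (u : TangentSpace I x) (v : TangentSpace I x) := by
  have hid : mfderiv 𝓘(ℝ, E) I (extChartAt I x).symm (extChartAt I x x)
      = ContinuousLinearMap.id ℝ E := by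
    have := mfderivWithin_range_extChartAt_symm (I := I) (x := x)
    rw [I.range_eq_univ, mfderivWithin_univ] at this
    exact this
  rw [← H.eq _ hx u v, chartMetric, hid]
  have h0 : (extChartAt I x).symm (extChartAt I x x) = x := extChartAt_to_inv x
  have h1 : ∀ w : W, w = x → g w (u : TangentSpace I w) (v : TangentSpace I w)
      = g x (u : TangentSpace I x) (v : TangentSpace I x) := by
    rintro w rfl; rfl
  exact h1 _ h0

end IsChartMetric

/-! ### The mean curvature of an immersion in charts -/

section Immersion

variable {E' : Type*} [NormedAddCommGroup E'] [NormedSpace ℝ E'] [FiniteDimensional ℝ E']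
  {H' : Type*} [TopologicalSpace H'] {J : ModelWithCorners ℝ E' H'} [J.Boundaryless]
  {M : Type*} [TopologicalSpace M] [ChartedSpace H' M]

/-- The coordinate expression of a map in the charts at `x` and `φ x`. -/
def chartRep (J : ModelWithCorners ℝ E' H') (I : ModelWithCorners ℝ E H) (φ : M → W) (x : M) :
    E' → E := fun z => extChartAt I (φ x) (φ ((extChartAt J x).symm z))

omit [FiniteDimensional ℝ E] [FiniteDimensional ℝ E'] in
theorem contDiffAt_chartRep {φ : M → W} {x : M}
    (hφ : ContMDiffAt J I ((⊤ : ℕ∞) : WithTop ℕ∞) φ x) :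
    ContDiffAt ℝ ((⊤ : ℕ∞) : WithTop ℕ∞) (chartRep J I φ x) (extChartAt J x x) := by
  have := (contMDiffAt_iff.1 hφ).2
  rw [J.range_eq_univ, contDiffWithinAt_univ] at this
  exact this

omit [FiniteDimensional ℝ E] [FiniteDimensional ℝ E'] in
theorem mfderiv_eq_fderiv_chartRep {φ : M → W} {x : M} (hφ : MDifferentiableAt J I φ x) :
    mfderiv J I φ x = fderiv ℝ (chartRep J I φ x) (extChartAt J x x) := by
  rw [hφ.mfderiv, J.range_eq_univ, fderivWithin_univ]
  rfl

theorem meanCurvatureNorm_eq [I.Boundaryless] [IsManifold I 1 W] {g : MetricField I W} {φ : M → W} {x : M}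
    {h : E → E →L[ℝ] E →L[ℝ] ℝ} {U : Set E} (H : IsChartMetric g (φ x) h U)
    (hx : extChartAt I (φ x) (φ x) ∈ U)
    (hφ : ContMDiffAt J I ((⊤ : ℕ∞) : WithTop ℕ∞) φ x) :
    meanCurvatureNorm J g φ x = √(h (chartRep J I φ x (extChartAt J x x))
      (flatMeanCurvature h (chartRep J I φ x) (extChartAt J x x))
      (flatMeanCurvature h (chartRep J I φ x) (extChartAt J x x))) := by
  have hF0 : chartRep J I φ x (extChartAt J x x) = extChartAt I (φ x) (φ x) := by
    simp [chartRep]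
  have hF := contDiffAt_chartRep hφ
  have hmf := mfderiv_eq_fderiv_chartRep (hφ.mdifferentiableAt (by simp))
  have hF2 : ∀ u v, fderiv ℝ (fun z => fderiv ℝ (chartRep J I φ x) z v) (extChartAt J x x) u
      = fderiv ℝ (fderiv ℝ (chartRep J I φ x)) (extChartAt J x x) u v := by
    intro u v
    have h1 : HasFDerivAt (fderiv ℝ (chartRep J I φ x)) _ (extChartAt J x x) :=
      ((hF.fderiv_right (m := 1) (by norm_cast)).differentiableAt (by simp)).hasFDerivAt
    rw [(h1.clm_apply (hasFDerivAt_const v _)).fderiv]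
    simp
  set F := chartRep J I φ x with hFdef
  set y := extChartAt J x x with hy
  have hk : (fun a b : E => g (φ x) (a : TangentSpace I (φ x)) (b : TangentSpace I (φ x)))
      = fun a b => h (F y) a b := by
    funext a b
    rw [hF0]
    exact (H.apply_center hx a b).symm
  have hvec : (meanCurvatureVector (J := J) g φ x : E) = flatMeanCurvature h F y := by
    change normalTrace (fun a b : E => g (φ x) (a : TangentSpace I (φ x))
      (b : TangentSpace I (φ x))) (fun a : E' => (mfderiv J I φ x a : E))
      (fun u v => fderiv ℝ (fun z => fderiv ℝ F z v) y u
        + christoffel g (φ x) (F y) (fderiv ℝ F y u) (fderiv ℝ F y v)) = _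
    rw [hk, hmf, flatMeanCurvature]
    congr 1
    funext u v
    rw [covSecondDeriv_apply, hF2, H.christoffel_eq (by rw [hF0]; exact hx)]
  rw [meanCurvatureNorm]
  congr 1
  have h1 := congrFun (congrFun hk (flatMeanCurvature h F y)) (flatMeanCurvature h F y)
  rw [← h1, ← hvec]

end Immersion

end Charts

/-! ### Pulled back Riemannian metrics -/

section PullForm

open Filter Topology

variable {E : Type*} [NormedAddCommGroup E] [NormedSpace ℝ E]
  {H : Type*} [TopologicalSpace H] {I : ModelWithCorners ℝ E H}
  {N : Type*} [TopologicalSpace N] [ChartedSpace H N]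

theorem IsMetricOn.mono {h : E → E →L[ℝ] E →L[ℝ] ℝ} {U V : Set E} (hh : IsMetricOn h U)
    (hV : IsOpen V) (hVU : V ⊆ U) : IsMetricOn h V :=
  ⟨hV, hh.contDiffOn.mono hVU, fun y hy => hh.symm y (hVU hy), fun y hy => hh.pos y (hVU hy)⟩

theorem mfderiv_comp_apply_of_eventuallyEq {W : Type*} [TopologicalSpace W] [ChartedSpace H W]
    {σ τ : E → W} {ψ : E → E} {y : E} (hτ : MDifferentiableAt 𝓘(ℝ, E) I τ (ψ y))
    (hψ : DifferentiableAt ℝ ψ y) (h : σ =ᶠ[𝓝 y] τ ∘ ψ) (a : E) :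
    (mfderiv 𝓘(ℝ, E) I σ y a : E) = mfderiv 𝓘(ℝ, E) I τ (ψ y) (fderiv ℝ ψ y a) := by
  have h1 : HasMFDerivAt 𝓘(ℝ, E) I σ y
      ((mfderiv 𝓘(ℝ, E) I τ (ψ y)).comp (mfderiv 𝓘(ℝ, E) 𝓘(ℝ, E) ψ y)) :=
    (hτ.hasMFDerivAt.comp y hψ.mdifferentiableAt.hasMFDerivAt).congr_of_eventuallyEq h
  rw [h1.mfderiv, mfderiv_eq_fderiv]
  rfl

variable [RiemannianBundle (fun x : N => TangentSpace I x)]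

/-- The pullback of the Riemannian metric by a parametrization. -/
def pullForm (I : ModelWithCorners ℝ E H) {N : Type*} [TopologicalSpace N] [ChartedSpace H N]
    [RiemannianBundle (fun x : N => TangentSpace I x)] (σ : E → N) (y : E) :
    E →L[ℝ] E →L[ℝ] ℝ :=
  (innerSL ℝ : TangentSpace I (σ y) →L[ℝ] TangentSpace I (σ y) →L[ℝ] ℝ).bilinearComp
    (mfderiv 𝓘(ℝ, E) I σ y : E →L[ℝ] TangentSpace I (σ y))
    (mfderiv 𝓘(ℝ, E) I σ y : E →L[ℝ] TangentSpace I (σ y))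

theorem pullForm_apply (σ : E → N) (y a b : E) : pullForm I σ y a b
    = riemannianMetric I N (σ y) (mfderiv 𝓘(ℝ, E) I σ y a) (mfderiv 𝓘(ℝ, E) I σ y b) := rfl

/-- A smooth map from an open subset of the model space with injective differentials. -/
structure IsParam (I : ModelWithCorners ℝ E H) {N : Type*} [TopologicalSpace N] [ChartedSpace H N]
    (σ : E → N) (U : Set E) : Prop where
  isOpen : IsOpen U
  smooth : ContMDiffOn 𝓘(ℝ, E) I ((⊤ : ℕ∞) : WithTop ℕ∞) σ U
  injective : ∀ y ∈ U, Function.Injective (mfderiv 𝓘(ℝ, E) I σ y)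

omit [RiemannianBundle (fun x : N => TangentSpace I x)] in
theorem IsParam.mdifferentiableAt {σ : E → N} {U : Set E} (hσ : IsParam I σ U) {y : E}
    (hy : y ∈ U) : MDifferentiableAt 𝓘(ℝ, E) I σ y :=
  (hσ.smooth.contMDiffAt (hσ.isOpen.mem_nhds hy)).mdifferentiableAt (by simp)

omit [RiemannianBundle (fun x : N => TangentSpace I x)] in
-- The chain rule for `τ ∘ σ = id` makes the differential of `σ` left invertible.
theorem IsParam.of_leftInverse {σ : E → N} {U : Set E} (hU : IsOpen U)
    (hσ : ContMDiffOn 𝓘(ℝ, E) I ((⊤ : ℕ∞) : WithTop ℕ∞) σ U) {τ : N → E}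
    (hτ : ∀ y ∈ U, MDifferentiableAt I 𝓘(ℝ, E) τ (σ y)) (h : ∀ y ∈ U, τ (σ y) = y) :
    IsParam I σ U where
  isOpen := hU
  smooth := hσ
  injective y hy := by
    have h1 : MDifferentiableAt 𝓘(ℝ, E) I σ y :=
      (hσ.contMDiffAt (hU.mem_nhds hy)).mdifferentiableAt (by simp)
    have he : id =ᶠ[𝓝 y] τ ∘ σ := by
      filter_upwards [hU.mem_nhds hy] with z hz using (h z hz).symm
    have h2 := ((hτ y hy).hasMFDerivAt.comp y h1.hasMFDerivAt).congr_of_eventuallyEq he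
    have h3 := hasMFDerivAt_unique h2 (hasMFDerivAt_id y)
    intro a b hab
    have h4 := congrArg (fun L => L a) h3
    have h5 := congrArg (fun L => L b) h3
    have h6 : (mfderiv I 𝓘(ℝ, E) τ (σ y)) ((mfderiv 𝓘(ℝ, E) I σ y) a)
      = (mfderiv I 𝓘(ℝ, E) τ (σ y)) ((mfderiv 𝓘(ℝ, E) I σ y) b) := congrArg _ hab
    exact (h4.symm.trans h6).trans h5

variable [FiniteDimensional ℝ E] [IsManifold I ((⊤ : ℕ∞) : WithTop ℕ∞) N]
  [IsContMDiffRiemannianBundle I ((⊤ : ℕ∞) : WithTop ℕ∞) E (fun x : N => TangentSpace I x)]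

/-- The map `y ↦ (σ y, dσ_y a)` is the tangent map of `σ` composed with a constant vector field,
hence a smooth section along `σ`; the metric is smooth on pairs of such sections. -/
theorem IsParam.contDiffOn_pullForm {σ : E → N} {U : Set E} (hσ : IsParam I σ U) :
    ContDiffOn ℝ ((⊤ : ℕ∞) : WithTop ℕ∞) (pullForm I σ) U := by
  refine contDiffOn_clm_apply.2 fun a => contDiffOn_clm_apply.2 fun b => ?_
  have hsec : ∀ a : E, ContMDiffOn 𝓘(ℝ, E) (I.prod 𝓘(ℝ, E)) ((⊤ : ℕ∞) : WithTop ℕ∞)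
      (fun y => (⟨σ y, mfderiv 𝓘(ℝ, E) I σ y a⟩ : TangentBundle I N)) U := by
    intro a
    have h1 := hσ.smooth.contMDiffOn_tangentMapWithin (m := ((⊤ : ℕ∞) : WithTop ℕ∞)) (by simp)
      hσ.isOpen.uniqueMDiffOn
    have h2 : ContMDiffOn 𝓘(ℝ, E) 𝓘(ℝ, E).tangent ((⊤ : ℕ∞) : WithTop ℕ∞)
        (fun y => (⟨y, a⟩ : TangentBundle 𝓘(ℝ, E) E)) U := fun y hy =>
      contMDiffWithinAt_vectorSpace_iff_contDiffWithinAt.2 contDiffWithinAt_const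
    refine (h1.comp h2 fun y hy => hy).congr fun y hy => ?_
    simp only [Function.comp_apply, tangentMapWithin,
      mfderivWithin_of_isOpen hσ.isOpen hy]
  have h3 := ContMDiffOn.inner_bundle (IB := I) (F := E) (E := fun x : N => TangentSpace I x)
    (b := σ) (v := fun y => mfderiv 𝓘(ℝ, E) I σ y a) (w := fun y => mfderiv 𝓘(ℝ, E) I σ y b)
    (hsec a) (hsec b)
  exact contMDiffOn_iff_contDiffOn.1 h3

theorem IsParam.isMetricOn {σ : E → N} {U : Set E} (hσ : IsParam I σ U) :
    IsMetricOn (pullForm I σ) U where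
  isOpen := hσ.isOpen
  contDiffOn := hσ.contDiffOn_pullForm
  symm y _ a b := real_inner_comm (F := TangentSpace I (σ y)) (mfderiv 𝓘(ℝ, E) I σ y b)
    (mfderiv 𝓘(ℝ, E) I σ y a)
  pos y hy a ha := by
    refine (real_inner_self_pos (F := TangentSpace I (σ y))).2 fun h0 => ha ?_
    exact hσ.injective y hy (h0.trans (map_zero _).symm)

theorem IsParam.isLocalIsometryOn {σ τ : E → N} {U U' V : Set E} {ψ : E → E} (hσ : IsParam I σ U)
    (hτ : IsParam I τ U') (hV : IsOpen V) (hVU : V ⊆ U)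
    (hψ : ContDiffOn ℝ ((⊤ : ℕ∞) : WithTop ℕ∞) ψ V) (hm : MapsTo ψ V U')
    (h : ∀ y ∈ V, σ y = τ (ψ y)) :
    IsLocalIsometryOn ψ (pullForm I σ) V (pullForm I τ) U' where
  source := hσ.isMetricOn.mono hV hVU
  target := hτ.isMetricOn
  contDiffOn := hψ
  mapsTo := hm
  pull y hy a b := by
    have he : σ =ᶠ[𝓝 y] τ ∘ ψ := by
      filter_upwards [hV.mem_nhds hy] with z hz using h z hz
    have hd := mfderiv_comp_apply_of_eventuallyEq (hτ.mdifferentiableAt (hm hy))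
      ((hψ.contDiffAt (hV.mem_nhds hy)).differentiableAt (by simp)) he
    rw [pullForm_apply, pullForm_apply]
    -- The base points `σ y` and `τ (ψ y)` are equal only propositionally, so the vectors are
    -- compared as elements of the common model space.
    have h1 : ∀ (p q : N) (_ : p = q) (a a' b b' : E), a = a' → b = b' →
        riemannianMetric I N p (a : TangentSpace I p) (b : TangentSpace I p)
          = riemannianMetric I N q (a' : TangentSpace I q) (b' : TangentSpace I q) := by
      rintro p _ rfl a _ b _ rfl rfl; rfl
    exact h1 _ _ (h y hy) _ _ _ _ (hd a) (hd b)

omit [FiniteDimensional ℝ E] [RiemannianBundle (fun x : N => TangentSpace I x)]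
  [IsContMDiffRiemannianBundle I ((⊤ : ℕ∞) : WithTop ℕ∞) E (fun x : N => TangentSpace I x)] in
theorem isParam_extChartAt_symm [I.Boundaryless] (p : N) :
    IsParam I (extChartAt I p).symm (extChartAt I p).target :=
  IsParam.of_leftInverse (isOpen_extChartAt_target p) (contMDiffOn_extChartAt_symm p)
    (τ := extChartAt I p)
    (fun y hy => mdifferentiableAt_extChartAt (by
      rw [← extChartAt_source I]; exact (extChartAt I p).map_target hy))
    (fun y hy => (extChartAt I p).right_inv hy)

theorem isChartMetric_pullForm [I.Boundaryless] (p : N) :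
    IsChartMetric (riemannianMetric I N) p (pullForm I (extChartAt I p).symm)
      (extChartAt I p).target where
  metric := (isParam_extChartAt_symm p).isMetricOn
  eq _ _ _ _ := rfl

end PullForm

/-! ### Normal coordinates of a Riemannian manifold -/

section NormalCoordinates

open Filter Topology

variable {E : Type*} [NormedAddCommGroup E] [NormedSpace ℝ E]
  {H : Type*} [TopologicalSpace H] {I : ModelWithCorners ℝ E H} [I.Boundaryless]
  {N : Type*} [TopologicalSpace N] [ChartedSpace H N]
  [IsManifold I ((⊤ : ℕ∞) : WithTop ℕ∞) N]
  {Φ : OpenPartialHomeomorph E N}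

omit [I.Boundaryless] [IsManifold I ((⊤ : ℕ∞) : WithTop ℕ∞) N] in
theorem isParam_of_contMDiffOn
    (h1 : ContMDiffOn 𝓘(ℝ, E) I ((⊤ : ℕ∞) : WithTop ℕ∞) Φ Φ.source)
    (h2 : ContMDiffOn I 𝓘(ℝ, E) ((⊤ : ℕ∞) : WithTop ℕ∞) Φ.symm Φ.target) :
    IsParam I Φ Φ.source :=
  IsParam.of_leftInverse Φ.open_source h1 (τ := Φ.symm)
    (fun _ hy => (h2.contMDiffAt (Φ.open_target.mem_nhds (Φ.map_source hy))).mdifferentiableAt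
      (by simp))
    fun _ hy => Φ.left_inv hy

omit [I.Boundaryless] [IsManifold I ((⊤ : ℕ∞) : WithTop ℕ∞) N] in
theorem IsParam.mfderiv_eq_fderiv (hΦ : IsParam I Φ Φ.source) {y : E} (hy : y ∈ Φ.source) :
    (mfderiv 𝓘(ℝ, E) I Φ y : E →L[ℝ] E) = fderiv ℝ (extChartAt I (Φ y) ∘ Φ) y :=
  mfderiv_eq_fderiv_chartRep (hΦ.mdifferentiableAt hy)

omit [I.Boundaryless] [IsManifold I ((⊤ : ℕ∞) : WithTop ℕ∞) N] in
theorem IsParam.velocity_eq (hΦ : IsParam I Φ Φ.source) {u : E} {t : ℝ} (ht : t • u ∈ Φ.source) :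
    (velocity (I := I) (fun t : ℝ => Φ (t • u)) t : E) = mfderiv 𝓘(ℝ, E) I Φ (t • u) u := by
  have h1 : HasDerivAt (fun t : ℝ => t • u) u t := by simpa using (hasDerivAt_id t).smul_const u
  have h2 := (hΦ.mdifferentiableAt ht).hasMFDerivAt.comp t h1.hasFDerivAt.hasMFDerivAt
  have h3 : mfderiv 𝓘(ℝ, ℝ) I (fun t : ℝ => Φ (t • u)) t = _ := h2.mfderiv
  rw [velocity, h3]
  change mfderiv 𝓘(ℝ, E) I Φ (t • u) ((1 : ℝ) • u) = _
  rw [one_smul]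

variable [RiemannianBundle (fun x : N => TangentSpace I x)] [FiniteDimensional ℝ E]
  [IsContMDiffRiemannianBundle I ((⊤ : ℕ∞) : WithTop ℕ∞) E (fun x : N => TangentSpace I x)]

theorem IsParam.isLocalIsometryOn_chart (hΦ : IsParam I Φ Φ.source) (p : N) :
    IsLocalIsometryOn (extChartAt I p ∘ Φ) (pullForm I Φ)
      (Φ.source ∩ Φ ⁻¹' (extChartAt I p).source) (pullForm I (extChartAt I p).symm)
      (extChartAt I p).target := by
  refine hΦ.isLocalIsometryOn (isParam_extChartAt_symm p)
    (Φ.isOpen_inter_preimage (isOpen_extChartAt_source p)) inter_subset_left ?_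
    (fun y hy => (extChartAt I p).map_source hy.2)
    (fun y hy => ((extChartAt I p).left_inv hy.2).symm)
  refine contMDiffOn_iff_contDiffOn.1 (ContMDiffOn.comp (t := (extChartAt I p).source) ?_
    (hΦ.smooth.mono inter_subset_left) fun y hy => hy.2)
  rw [extChartAt_source]
  exact contMDiffOn_extChartAt

/-- Read in the chart `ψ`, the acceleration of the ray is `D²ψ(u, u)` plus the Christoffel term,
which by the transformation law is `Dψ` of the Christoffel symbol in normal coordinates; and `Dψ` is
injective. -/
theorem IsParam.lcSecond_eq_zero (hΦ : IsParam I Φ Φ.source) {u : E} {t : ℝ}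
    (ht : t • u ∈ Φ.source)
    (hgeo : covAccel (riemannianMetric I N) (fun t : ℝ => Φ (t • u)) t = 0) :
    lcSecond (pullForm I Φ) (t • u) u u = 0 := by
  set p := Φ (t • u) with hp
  have hiso := hΦ.isLocalIsometryOn_chart p
  set ψ := extChartAt I p ∘ Φ with hψ
  have hl : ∀ s : ℝ, HasDerivAt (fun s : ℝ => s • u) u s := fun s => by
    simpa using (hasDerivAt_id s).smul_const u
  have hmem : t • u ∈ Φ.source ∩ Φ ⁻¹' (extChartAt I p).source := ⟨ht, mem_extChartAt_source p⟩
  have hev : ∀ᶠ s in 𝓝 t, s • u ∈ Φ.source ∩ Φ ⁻¹' (extChartAt I p).source :=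
    (hl t).continuousAt.eventually (hiso.source.mem_nhds hmem)
  have hd : ∀ᶠ s in 𝓝 t, deriv (fun s : ℝ => ψ (s • u)) s = fderiv ℝ ψ (s • u) u :=
    hev.mono fun s hs => ((hiso.hasFDerivAt hs).comp_hasDerivAt s (hl s)).deriv
  have hdd : deriv (deriv fun s : ℝ => ψ (s • u)) t = fderiv ℝ (fderiv ℝ ψ) (t • u) u u := by
    rw [EventuallyEq.deriv_eq hd]
    have h1 : HasDerivAt (fun s : ℝ => fderiv ℝ ψ (s • u)) (fderiv ℝ (fderiv ℝ ψ) (t • u) u) t :=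
      (hiso.hasFDerivAt_fderiv hmem).comp_hasDerivAt t (hl t)
    have h2 : HasDerivAt (fun s : ℝ => fderiv ℝ ψ (s • u) u)
        (fderiv ℝ (fderiv ℝ ψ) (t • u) u u) t :=
      (h1.clm_apply (hasDerivAt_const t u)).congr_deriv (by simp)
    exact h2.deriv
  have hacc : deriv (deriv fun s : ℝ => ψ (s • u)) t
      + christoffel (riemannianMetric I N) p (ψ (t • u)) (deriv (fun s : ℝ => ψ (s • u)) t)
        (deriv (fun s : ℝ => ψ (s • u)) t) = 0 := hgeo
  rw [hdd, hd.self_of_nhds, (isChartMetric_pullForm p).christoffel_eq (hiso.mapsTo hmem),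
    ← hiso.lcSecond_map hmem] at hacc
  exact hiso.injective hmem (hacc.trans (map_zero _).symm)

/-- The chart at `Φ (t • u)` is a local isometry from normal coordinates and carries the curvature
tensor over. Since `u` and `b` are orthonormal at `t • u`, the denominator of the sectional
curvature is `1`. -/
theorem IsParam.inner_connCurv_le (hΦ : IsParam I Φ Φ.source) {x₀ : N} {κ r : ℝ} (hr : 0 < r)
    (hκ : RadialCurvatureLE (riemannianMetric I N) x₀ κ) (h0 : Φ 0 = x₀) {u : E}
    (hgeo : IsGeodesicOn (riemannianMetric I N) (fun t : ℝ => Φ (t • u)) (Ioo (-r) r))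
    (hu0 : pullForm I Φ 0 u u = 1) {t : ℝ} (ht : t ∈ Ioo 0 r)
    (hsrc : t • u ∈ Φ.source) (h0src : (0 : E) ∈ Φ.source) (hu : pullForm I Φ (t • u) u u = 1)
    {b : E} (hb : pullForm I Φ (t • u) b b = 1) (hub : pullForm I Φ (t • u) u b = 0) :
    pullForm I Φ (t • u) (connCurv (lcSecond (pullForm I Φ)) (t • u) u b b) u ≤ κ := by
  set p := Φ (t • u) with hp
  have hiso := hΦ.isLocalIsometryOn_chart p
  have hmem : t • u ∈ Φ.source ∩ Φ ⁻¹' (extChartAt I p).source :=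
    ⟨hsrc, mem_extChartAt_source p⟩
  have hmf := hΦ.mfderiv_eq_fderiv hsrc
  have hvel : (velocity (I := I) (fun t : ℝ => Φ (t • u)) t : E)
      = fderiv ℝ (extChartAt I p ∘ Φ) (t • u) u := by
    rw [hΦ.velocity_eq hsrc]
    exact congrArg (fun L : E →L[ℝ] E => L u) hmf
  have hinit : riemannianMetric I N ((fun t : ℝ => Φ (t • u)) 0)
      (velocity (I := I) (fun t : ℝ => Φ (t • u)) 0)
      (velocity (I := I) (fun t : ℝ => Φ (t • u)) 0) = 1 := by
    have h1 : (0 : ℝ) • u ∈ Φ.source := by rwa [zero_smul]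
    have h2 : (velocity (I := I) (fun t : ℝ => Φ (t • u)) 0)
      = mfderiv 𝓘(ℝ, E) I Φ ((0 : ℝ) • u) u := hΦ.velocity_eq h1
    rw [h2]
    have h3 : pullForm I Φ ((0 : ℝ) • u) u u = 1 := by rwa [zero_smul]
    exact h3
  have hgv : ∀ a c : E, riemannianMetric I N p
      (fderiv ℝ (extChartAt I p ∘ Φ) (t • u) a : E) (fderiv ℝ (extChartAt I p ∘ Φ) (t • u) c : E)
      = pullForm I Φ (t • u) a c := by
    intro a c
    rw [pullForm_apply, hmf]
    rfl
  have hsec := hκ (fun t : ℝ => Φ (t • u)) (-r) r (by linarith) hr hgeo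
    (by simpa using h0) hinit t ht (fderiv ℝ (extChartAt I p ∘ Φ) (t • u) b : E)
  have hv' : (velocity (I := I) (fun t : ℝ => Φ (t • u)) t)
      = (fderiv ℝ (extChartAt I p ∘ Φ) (t • u) u : E) := hvel
  rw [hv'] at hsec
  have hsec' := hsec ((hgv b b).trans hb) ((hgv u b).trans hub)
  have hchart := isChartMetric_pullForm (I := I) p
  have hq : extChartAt I p p ∈ (extChartAt I p).target := mem_extChartAt_target p
  have hR : (riemannTensor (riemannianMetric I N) p
      (fderiv ℝ (extChartAt I p ∘ Φ) (t • u) u : E) (fderiv ℝ (extChartAt I p ∘ Φ) (t • u) b : E)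
      (fderiv ℝ (extChartAt I p ∘ Φ) (t • u) b : E) : E)
      = fderiv ℝ (extChartAt I p ∘ Φ) (t • u)
        (connCurv (lcSecond (pullForm I Φ)) (t • u) u b b) := by
    rw [hiso.connCurv_map hmem]
    exact hchart.riemannTensor_eq hq _ _ _
  have hs : sectionalCurvature (riemannianMetric I N) p
      (fderiv ℝ (extChartAt I p ∘ Φ) (t • u) u : E) (fderiv ℝ (extChartAt I p ∘ Φ) (t • u) b : E)
      = pullForm I Φ (t • u) (connCurv (lcSecond (pullForm I Φ)) (t • u) u b b) u := by
    have e1 := hgv (connCurv (lcSecond (pullForm I Φ)) (t • u) u b b) u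
    rw [← hR] at e1
    have e2 : ∀ A B C D : ℝ, B = 1 → C = 1 → D = 0 → A / (B * C - D ^ 2) = A := by
      rintro A _ _ _ rfl rfl rfl; simp
    exact (e2 _ _ _ _ ((hgv u u).trans hu) ((hgv b b).trans hb) ((hgv u b).trans hub)).trans e1
  rw [← hs]
  exact hsec'

/-- The metric in normal coordinates. -/
theorem exists_isNormalMetric {x₀ : N} {r : ℝ} (hr : 0 < r)
    (h : IsNormalRadius (riemannianMetric I N) x₀ r) :
    ∃ Φ : OpenPartialHomeomorph E N, IsParam I Φ Φ.source ∧
      ContMDiffOn I 𝓘(ℝ, E) ((⊤ : ℕ∞) : WithTop ℕ∞) Φ.symm Φ.target ∧ Φ 0 = x₀ ∧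
      Φ.source = normalBall (pullForm I Φ) r ∧ IsNormalMetric (pullForm I Φ) r ∧
      ∀ κ, RadialCurvatureLE (riemannianMetric I N) x₀ κ →
        ∀ z ∈ normalBall (pullForm I Φ) r, z ≠ 0 → ∀ b, pullForm I Φ z z b = 0 →
          pullForm I Φ z (connCurv (lcSecond (pullForm I Φ)) z z b b) z
            ≤ κ * (pullForm I Φ z z z * pullForm I Φ z b b) := by
  obtain ⟨Φ, hsrc, hs1, hs2, h0, hgeo⟩ := h
  have hΦ := isParam_of_contMDiffOn hs1 hs2
  have h0src : (0 : E) ∈ Φ.source := by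
    rw [hsrc]
    have : riemannianMetric I N x₀ (0 : TangentSpace I x₀) (0 : TangentSpace I x₀) = 0 :=
      inner_zero_left _
    change riemannianMetric I N x₀ (0 : TangentSpace I x₀) (0 : TangentSpace I x₀) < r ^ 2
    rw [this]; positivity
  -- The geodesic with initial velocity `u` is the ray itself, so the differential of `Φ` at `0`
  -- fixes unit vectors. Homogeneity then identifies `pullForm I Φ 0` with the metric at `x₀` on all
  -- vectors (`hG0`).
  have hunit : ∀ u : E, riemannianMetric I N x₀ (u : TangentSpace I x₀) (u : TangentSpace I x₀) = 1 →
      pullForm I Φ 0 u u = 1 := by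
    intro u hu
    have h1 := congrArg (fun p : TangentBundle I N => riemannianMetric I N p.1 p.2 p.2)
      (hgeo u hu).2
    have h1s : (0 : ℝ) • u ∈ Φ.source := by rwa [zero_smul]
    have h2 : (velocity (I := I) (fun t : ℝ => Φ (t • u)) 0)
      = mfderiv 𝓘(ℝ, E) I Φ ((0 : ℝ) • u) u := hΦ.velocity_eq h1s
    have h3 : pullForm I Φ ((0 : ℝ) • u) u u = 1 := by
      rw [pullForm_apply, ← hu, ← h2]
      exact h1
    rwa [zero_smul] at h3
  have hG0 : ∀ v : E, pullForm I Φ 0 v v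
      = riemannianMetric I N x₀ (v : TangentSpace I x₀) (v : TangentSpace I x₀) := by
    intro v
    by_cases hv : v = 0
    · subst hv
      rw [map_zero]
      exact (inner_zero_left (0 : TangentSpace I x₀)).symm
    set B : E →L[ℝ] E →L[ℝ] ℝ :=
      (innerSL ℝ : TangentSpace I x₀ →L[ℝ] TangentSpace I x₀ →L[ℝ] ℝ) with hB
    have hBv : 0 < B v v := (real_inner_self_pos (F := TangentSpace I x₀)).2 hv
    have h2 := Real.sqrt_pos.2 hBv
    have h3 := Real.mul_self_sqrt hBv.le
    have h4 : B ((√(B v v))⁻¹ • v) ((√(B v v))⁻¹ • v) = 1 := by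
      simp only [map_smul, smul_apply, smul_eq_mul]
      rw [← mul_assoc, ← mul_inv, h3, inv_mul_cancel₀ hBv.ne']
    have h5 := hunit _ h4
    simp only [map_smul, smul_apply, smul_eq_mul] at h5
    rw [← mul_assoc, ← mul_inv, h3] at h5
    change _ = B v v
    field_simp at h5
    exact h5
  have hball : Φ.source = normalBall (pullForm I Φ) r := by
    rw [hsrc]
    ext v
    exact (Iff.of_eq (congrArg (· < r ^ 2) (hG0 v))).symm
  have hpos : ∀ v : E, v ≠ 0 → 0 < pullForm I Φ 0 v v := hΦ.isMetricOn.pos 0 h0src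
  -- polar decomposition of a nonzero vector of the ball
  have hpolar : ∀ v ∈ Φ.source, v ≠ 0 → ∃ (u : E) (t : ℝ), t ∈ Ioo 0 r ∧ v = t • u ∧
      pullForm I Φ 0 u u = 1 := by
    intro v hv hv0
    have h1 := hpos v hv0
    have h2 := Real.sqrt_pos.2 h1
    have h3 := Real.mul_self_sqrt h1.le
    refine ⟨(√(pullForm I Φ 0 v v))⁻¹ • v, √(pullForm I Φ 0 v v), ⟨h2, ?_⟩, ?_, ?_⟩
    · rw [hball] at hv
      exact (Real.sqrt_lt' hr).2 hv
    · rw [smul_smul, mul_inv_cancel₀ h2.ne', one_smul]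
    · simp only [map_smul, smul_apply, smul_eq_mul]
      rw [← mul_assoc, ← mul_inv, h3, inv_mul_cancel₀ h1.ne']
  have hnormal : IsNormalMetric (pullForm I Φ) r := by
    refine ⟨hr, hball ▸ hΦ.isMetricOn, fun v hv => ?_⟩
    by_cases hv0 : v = 0
    · subst hv0; simp
    rw [← hball] at hv
    obtain ⟨u, t, ht, rfl, hu⟩ := hpolar v hv hv0
    have hg := (hgeo u (by rw [← hG0]; exact hu)).1.2 t ⟨by linarith [ht.1, hr], ht.2⟩
    simp [hΦ.lcSecond_eq_zero hv hg]
  refine ⟨Φ, hΦ, hs2, h0, hball, hnormal, fun κ hκ z hz hz0 b hzb => ?_⟩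
  by_cases hb0 : b = 0
  · subst hb0; simp [connCurv]
  have hzs : z ∈ Φ.source := hball ▸ hz
  have hm := hnormal.metric
  have hbb := hm.pos z hz b hb0
  obtain ⟨u, t, ht, rfl, hu⟩ := hpolar z hzs hz0
  have ht0 := ht.1
  set G := pullForm I Φ with hG
  -- The curvature hypothesis concerns unit vectors only. Here `s` normalises `b`, and the general
  -- inequality is recovered by quadratic homogeneity in `b` and in `z = t • u`.
  set s := (√(G (t • u) b b))⁻¹ with hs
  have hs0 : 0 < s := inv_pos.2 (Real.sqrt_pos.2 hbb)
  have hss : s * s * G (t • u) b b = 1 := by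
    rw [hs, ← mul_inv, Real.mul_self_sqrt hbb.le, inv_mul_cancel₀ hbb.ne']
  have huu : G (t • u) u u = 1 := by
    have := hnormal.apply_self hz
    simp only [map_smul, smul_apply, smul_eq_mul, hu, mul_one] at this
    have h2 : 0 < t * t := by positivity
    nlinarith
  have hub : G (t • u) u b = 0 := by
    simpa [ht0.ne'] using hzb
  have key := hΦ.inner_connCurv_le hr hκ h0 (hgeo u (by rw [← hG0]; exact hu)).1 hu ht hzs h0src huu
    (b := s • b) (by simpa [mul_assoc] using hss) (by simp [← hG, hub])
  rw [← hG] at key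
  have e1 : connCurv (lcSecond G) (t • u) u (s • b) (s • b)
      = (s * s) • connCurv (lcSecond G) (t • u) u b b := by
    simp only [connCurv, map_smul, smul_apply]
    module
  have e2 : connCurv (lcSecond G) (t • u) (t • u) b b
      = t • connCurv (lcSecond G) (t • u) u b b := by
    simp only [connCurv, map_smul, smul_apply]
    module
  rw [e1] at key
  rw [e2]
  simp only [map_smul, smul_apply, smul_eq_mul, huu, mul_one] at key ⊢
  have h3 := mul_le_mul_of_nonneg_left key (mul_nonneg (mul_nonneg ht0.le ht0.le) hbb.le)
  calc _ = t * t * G (t • u) b b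
        * (s * s * G (t • u) (connCurv (lcSecond G) (t • u) u b b) u) := by
        linear_combination (-t * t * G (t • u) (connCurv (lcSecond G) (t • u) u b b) u) * hss
    _ ≤ _ := h3
    _ = _ := by ring

end NormalCoordinates

/-! ### The distance to the centre of a normal ball -/

section RadialSpeed

attribute [-instance]
  Bundle.instNormedAddCommGroupOfRiemannianBundleOfIsTopologicalAddGroupOfContinuousConstSMulReal
  Bundle.instInnerProductSpaceReal

variable {E : Type*} [NormedAddCommGroup E] [NormedSpace ℝ E]
  {G : E → E →L[ℝ] E →L[ℝ] ℝ} {r : ℝ}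

/-- The term `ε ^ 2` smooths the radial coordinate at the origin, where curves from the centre
start. -/
theorem IsNormalMetric.hasDerivAt_sqrt (H : IsNormalMetric G r) {ε : ℝ} (hε : 0 < ε) {β : ℝ → E}
    {w : E} {t : ℝ} (hβ : HasDerivAt β w t) :
    HasDerivAt (fun t => √(ε ^ 2 + G 0 (β t) (β t)))
      (G 0 (β t) w / √(ε ^ 2 + G 0 (β t) (β t))) t := by
  have h0 : 0 < ε ^ 2 + G 0 (β t) (β t) :=
    add_pos_of_pos_of_nonneg (by positivity) (H.metric.nonneg H.zero_mem _)
  have h1 : HasDerivAt (fun t => G 0 (β t) (β t)) (2 * G 0 (β t) w) t := by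
    refine (((hasDerivAt_const t (G 0)).clm_apply hβ).clm_apply hβ).congr_deriv ?_
    simp [H.metric.symm 0 H.zero_mem w (β t)]
    ring
  refine ((h1.const_add (ε ^ 2)).sqrt h0.ne').congr_deriv ?_
  field_simp

/-- The smoothed radial coordinate is `1`-Lipschitz: the Gauss lemma turns `G 0 v w` into `G v v w`,
and Cauchy–Schwarz for `G v` bounds it. -/
theorem IsNormalMetric.abs_div_sqrt_le [FiniteDimensional ℝ E] (H : IsNormalMetric G r) {ε : ℝ}
    (hε : 0 < ε) {v : E} (hv : v ∈ normalBall G r) (w : E) :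
    |G 0 v w / √(ε ^ 2 + G 0 v v)| ≤ √(G v w w) := by
  have h0 : 0 ≤ G 0 v v := H.metric.nonneg H.zero_mem _
  have h1 : 0 < ε ^ 2 + G 0 v v := add_pos_of_pos_of_nonneg (by positivity) h0
  have hw : 0 ≤ G v w w := H.metric.nonneg hv w
  rw [abs_div, abs_of_pos (Real.sqrt_pos.2 h1), div_le_iff₀ (Real.sqrt_pos.2 h1),
    ← Real.sqrt_mul hw]
  refine Real.abs_le_sqrt ?_
  have h2 := H.metric.cauchy_schwarz hv v w
  rw [H.gauss hv, H.apply_self hv] at h2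
  nlinarith [sq_nonneg ε, mul_nonneg (sq_nonneg ε) hw]

theorem IsNormalMetric.isCompact_closedBall [FiniteDimensional ℝ E] (H : IsNormalMetric G r)
    (L : ℝ) : IsCompact {v : E | G 0 v v ≤ L} := by
  have hc : Continuous fun v : E => G 0 v v := by fun_prop
  refine Metric.isCompact_of_isClosed_isBounded (isClosed_le hc continuous_const) ?_
  -- In the trivial space the unit sphere is empty. Otherwise the quadratic form has a positive
  -- minimum on the sphere, which bounds the norm.
  rcases subsingleton_or_nontrivial E with h | h
  · exact (Set.toFinite _).isBounded
  obtain ⟨e, he, hmin⟩ := (isCompact_sphere (0 : E) 1).exists_isMinOn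
    (NormedSpace.sphere_nonempty.2 zero_le_one) hc.continuousOn
  have he0 : e ≠ 0 := by
    rintro rfl
    simp at he
  have hpos := H.metric.pos 0 H.zero_mem e he0
  refine isBounded_iff_forall_norm_le.2 ⟨√(L / G 0 e e), fun v hv => Real.le_sqrt_of_sq_le ?_⟩
  rw [le_div_iff₀ hpos]
  by_cases hv0 : v = 0
  · subst hv0
    simp only [mem_ofPred_eq, map_zero] at hv
    simpa using hv
  have hn := norm_pos_iff.2 hv0
  have h1 : G 0 e e ≤ G 0 (‖v‖⁻¹ • v) (‖v‖⁻¹ • v) :=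
    hmin (by simp [norm_smul, inv_mul_cancel₀ hn.ne'])
  simp only [map_smul, smul_apply, smul_eq_mul] at h1
  calc ‖v‖ ^ 2 * G 0 e e ≤ ‖v‖ ^ 2 * (‖v‖⁻¹ * (‖v‖⁻¹ * G 0 v v)) := by gcongr
    _ = G 0 v v := by field_simp
    _ ≤ L := hv

end RadialSpeed

/-! ### Lengths of curves issuing from the centre of a normal ball -/

section Distance

open Filter Topology MeasureTheory

variable {E : Type*} [NormedAddCommGroup E] [NormedSpace ℝ E] [FiniteDimensional ℝ E]
  {H : Type*} [TopologicalSpace H] {I : ModelWithCorners ℝ E H}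
  {N : Type*} [TopologicalSpace N] [ChartedSpace H N]
  [RiemannianBundle (fun x : N => TangentSpace I x)]
  {Φ : OpenPartialHomeomorph E N} {r : ℝ}

omit [FiniteDimensional ℝ E] in
theorem enorm_mfderiv_eq (hΦ : IsParam I Φ Φ.source) {γ : ℝ → N} {β : ℝ → E} {t : ℝ} {w : E}
    (hβ : HasDerivAt β w t) (ht : β t ∈ Φ.source) (h : γ =ᶠ[𝓝 t] Φ ∘ β) :
    ‖mfderiv 𝓘(ℝ, ℝ) I γ t 1‖ₑ = ENNReal.ofReal √(pullForm I Φ (β t) w w) := by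
  have h1 := ((hΦ.mdifferentiableAt ht).hasMFDerivAt.comp t
    hβ.hasFDerivAt.hasMFDerivAt).congr_of_eventuallyEq h
  have h2 : (mfderiv 𝓘(ℝ, ℝ) I γ t 1 : E) = mfderiv 𝓘(ℝ, E) I Φ (β t) w := by
    rw [h1.mfderiv]
    change mfderiv 𝓘(ℝ, E) I Φ (β t) ((1 : ℝ) • w) = _
    rw [one_smul]
  have h3 : ∀ (p q : N) (_ : p = q) (a : TangentSpace I p) (b : TangentSpace I q),
      (a : E) = (b : E) → ‖a‖ₑ = ENNReal.ofReal √(riemannianMetric I N q b b) := by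
    rintro p _ rfl a _ rfl
    change ‖a‖ₑ = ENNReal.ofReal √(inner ℝ a a)
    rw [← norm_eq_sqrt_real_inner, ofReal_norm]
  exact h3 _ _ h.eq_of_nhds _ _ h2

/-- The smoothed radial coordinate grows no faster than arc length; integrating along the curve and
letting the smoothing parameter tend to `0` gives the bound. -/
theorem IsNormalMetric.ofReal_sqrt_le_pathELength (hG : IsNormalMetric (pullForm I Φ) r)
    (hΦ : IsParam I Φ Φ.source)
    (hΦ' : ContMDiffOn I 𝓘(ℝ, E) ((⊤ : ℕ∞) : WithTop ℕ∞) Φ.symm Φ.target)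
    (hball : Φ.source = normalBall (pullForm I Φ) r) {γ : ℝ → N} (hγ : ContMDiff 𝓘(ℝ, ℝ) I 1 γ)
    {a b : ℝ} (hab : a ≤ b) (hm : ∀ t ∈ Icc a b, γ t ∈ Φ.target) (ha : Φ.symm (γ a) = 0) :
    ENNReal.ofReal √(pullForm I Φ 0 (Φ.symm (γ b)) (Φ.symm (γ b))) ≤ pathELength I γ a b := by
  set β : ℝ → E := Φ.symm ∘ γ with hβ
  have hev : ∀ t ∈ Icc a b, ∀ᶠ s in 𝓝 t, γ s ∈ Φ.target := fun t ht =>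
    hγ.continuous.continuousAt.eventually (Φ.open_target.mem_nhds (hm t ht))
  have hβs : ∀ t ∈ Icc a b, ContDiffAt ℝ 1 β t := fun t ht =>
    contMDiffAt_iff_contDiffAt.1 (ContMDiffAt.comp t
      ((hΦ'.contMDiffAt (Φ.open_target.mem_nhds (hm t ht))).of_le (by simp)) (hγ t))
  have hβm : ∀ t ∈ Icc a b, β t ∈ Φ.source := fun t ht => Φ.map_target (hm t ht)
  have hβd : ∀ t ∈ Icc a b, HasDerivAt β (deriv β t) t := fun t ht =>
    ((hβs t ht).differentiableAt one_ne_zero).hasDerivAt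
  refine ENNReal.le_of_forall_pos_le_add fun δ hδ _ => ?_
  obtain ⟨ε, hε⟩ : ∃ ε : ℝ, ε = δ := ⟨_, rfl⟩
  have hε0 : 0 < ε := hε ▸ hδ
  have hpos : ∀ t, 0 < ε ^ 2 + pullForm I Φ 0 (β t) (β t) := fun t =>
    add_pos_of_pos_of_nonneg (by positivity) (hG.metric.nonneg hG.zero_mem _)
  set c : ℝ → ℝ := fun t => √(ε ^ 2 + pullForm I Φ 0 (β t) (β t)) with hc
  have hcs : ContDiffOn ℝ 1 c (Icc a b) := fun t ht => by
    refine ContDiffAt.contDiffWithinAt (ContDiffAt.sqrt ?_ (hpos t).ne')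
    exact contDiffAt_const.add ((contDiffAt_const.clm_apply (hβs t ht)).clm_apply (hβs t ht))
  have hca : c a = ε := by
    simp only [hc, hβ, Function.comp_apply, ha, map_zero, add_zero]
    exact Real.sqrt_sq hε0.le
  have hlen : ‖c b - c a‖ₑ ≤ pathELength I γ a b := by
    refine (enorm_sub_le_lintegral_deriv_of_contDiffOn_Icc hcs hab).trans ?_
    rw [pathELength_eq_lintegral_mfderiv_Icc]
    refine setLIntegral_mono' measurableSet_Icc fun t ht => ?_
    rw [enorm_mfderiv_eq hΦ (hβd t ht) (hβm t ht)
      ((hev t ht).mono fun s hs => (Φ.right_inv hs).symm),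
      HasDerivAt.deriv (hG.hasDerivAt_sqrt hε0 (hβd t ht)), Real.enorm_eq_ofReal_abs]
    exact ENNReal.ofReal_le_ofReal (hG.abs_div_sqrt_le hε0 (hball ▸ hβm t ht) _)
  have hcb : √(pullForm I Φ 0 (β b) (β b)) ≤ c b := Real.sqrt_le_sqrt (by nlinarith [sq_nonneg ε])
  calc ENNReal.ofReal √(pullForm I Φ 0 (β b) (β b))
      ≤ ENNReal.ofReal (|c b - c a| + ε) :=
        ENNReal.ofReal_le_ofReal (by linarith [le_abs_self (c b - c a)])
    _ = ‖c b - c a‖ₑ + δ := by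
        rw [ENNReal.ofReal_add (abs_nonneg _) hε0.le, Real.enorm_eq_ofReal_abs, hε,
          ENNReal.ofReal_coe_nnreal]
    _ ≤ _ := by gcongr

/-- Points at distance less than `r` from the centre lie in the normal ball of radius `r`. -/
theorem IsNormalMetric.mem_target_of_riemannianEDist_lt [T2Space N]
    (hG : IsNormalMetric (pullForm I Φ) r)
    (hΦ : IsParam I Φ Φ.source)
    (hΦ' : ContMDiffOn I 𝓘(ℝ, E) ((⊤ : ℕ∞) : WithTop ℕ∞) Φ.symm Φ.target)
    (hball : Φ.source = normalBall (pullForm I Φ) r) {L : ℝ} (hL : 0 < L) (hLr : L < r) {p : N}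
    (hp : riemannianEDist I (Φ 0) p < ENNReal.ofReal L) :
    p ∈ Φ.target ∧ √(pullForm I Φ 0 (Φ.symm p) (Φ.symm p)) < L := by
  obtain ⟨γ, hγ0, hγ1, hγ, hlen, -⟩ :=
    exists_lt_locally_constant_of_riemannianEDist_lt hp zero_lt_one
  set G := pullForm I Φ with hGdef
  have h0src : (0 : E) ∈ Φ.source := hball ▸ hG.zero_mem
  have hsub : {v : E | G 0 v v ≤ L ^ 2} ⊆ Φ.source := fun v hv => by
    rw [hball]
    exact lt_of_le_of_lt hv (by nlinarith : L ^ 2 < r ^ 2)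
  -- The compact ball of radius `L < r` has a closed image in the Hausdorff space `N`, so a curve
  -- cannot leave the normal ball without first reaching its boundary sphere.
  set K : Set N := Φ '' {v : E | G 0 v v ≤ L ^ 2} with hK
  have hKc : IsClosed K :=
    ((hG.isCompact_closedBall _).image_of_continuousOn (Φ.continuousOn.mono hsub)).isClosed
  have hKt : K ⊆ Φ.target := by
    rintro _ ⟨v, hv, rfl⟩
    exact Φ.map_source (hsub hv)
  have hstart : Φ.symm (γ 0) = 0 := by rw [hγ0, Φ.left_inv h0src]
  have hbound : ∀ t ∈ Icc (0 : ℝ) 1, (∀ s ∈ Icc 0 t, γ s ∈ K) →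
      √(G 0 (Φ.symm (γ t)) (Φ.symm (γ t))) < L := by
    intro t ht hs
    refine (ENNReal.ofReal_lt_ofReal_iff hL).1 (lt_of_le_of_lt
      (hG.ofReal_sqrt_le_pathELength hΦ hΦ' hball hγ ht.1 (fun s h => hKt (hs s h)) hstart)
      (lt_of_le_of_lt (pathELength_mono le_rfl ht.2) hlen))
  -- Continuation in time: as long as the curve stays in `K`, its length being less than `L` forces
  -- a radial coordinate strictly below `L`, so it stays in `K` a little longer.
  have hA : Icc (0 : ℝ) 1 ⊆ γ ⁻¹' K := by
    refine IsClosed.Icc_subset_of_forall_mem_nhdsGT_of_Icc_subset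
      ((hKc.preimage hγ.continuous).inter isClosed_Icc) ?_ ?_
    · refine ⟨0, by simp; positivity, ?_⟩
      exact hγ0.symm
    · rintro t ⟨ht0, ht1⟩ ht
      have h1 := hbound t ⟨ht0, ht1.le⟩ ht
      have h2 : γ t ∈ Φ.target := hKt (ht ⟨ht0, le_rfl⟩)
      have hcont : ContinuousAt (fun s => √(G 0 (Φ.symm (γ s)) (Φ.symm (γ s)))) t := by
        have h3 : ContinuousAt (fun s => Φ.symm (γ s)) t :=
          ContinuousAt.comp (Φ.symm.continuousAt h2) hγ.continuous.continuousAt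
        exact (((continuousAt_const (y := G 0)).clm_apply h3).clm_apply h3).sqrt
      refine mem_nhdsWithin_of_mem_nhds ?_
      filter_upwards [hcont.eventually (gt_mem_nhds h1),
        hγ.continuous.continuousAt.eventually (Φ.open_target.mem_nhds h2)] with s hs hs'
      exact ⟨Φ.symm (γ s), ((Real.sqrt_lt' hL).1 hs).le, Φ.right_inv hs'⟩
  rw [← hγ1]
  exact ⟨hKt (hA (right_mem_Icc.2 zero_le_one)), hbound 1 (right_mem_Icc.2 zero_le_one) hA⟩

end Distance

section MetricDistance

variable {E : Type*} [NormedAddCommGroup E] [NormedSpace ℝ E] [FiniteDimensional ℝ E]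
  {H : Type*} [TopologicalSpace H] {I : ModelWithCorners ℝ E H}
  {N : Type*} [MetricSpace N] [ChartedSpace H N]
  [RiemannianBundle (fun x : N => TangentSpace I x)] [IsRiemannianManifold I N]
  {Φ : OpenPartialHomeomorph E N} {r : ℝ}

theorem IsNormalMetric.mem_target_of_dist_lt (hG : IsNormalMetric (pullForm I Φ) r)
    (hΦ : IsParam I Φ Φ.source)
    (hΦ' : ContMDiffOn I 𝓘(ℝ, E) ((⊤ : ℕ∞) : WithTop ℕ∞) Φ.symm Φ.target)
    (hball : Φ.source = normalBall (pullForm I Φ) r) {p : N} (hp : dist (Φ 0) p < r) :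
    p ∈ Φ.target ∧ √(pullForm I Φ 0 (Φ.symm p) (Φ.symm p)) ≤ dist (Φ 0) p := by
  have key : ∀ L, dist (Φ 0) p < L → L < r →
      p ∈ Φ.target ∧ √(pullForm I Φ 0 (Φ.symm p) (Φ.symm p)) < L := fun L h1 h2 => by
    have hL : 0 < L := dist_nonneg.trans_lt h1
    refine hG.mem_target_of_riemannianEDist_lt hΦ hΦ' hball hL h2 ?_
    rw [← IsRiemannianManifold.out (I := I) (Φ 0) p, edist_dist]
    exact (ENNReal.ofReal_lt_ofReal_iff hL).2 h1
  obtain ⟨L, h1, h2⟩ := exists_between hp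
  -- The length estimate is strict for each `L` above the distance; the closed bound follows as `L`
  -- decreases to it.
  refine ⟨(key L h1 h2).1, le_of_forall_gt_imp_ge_of_dense fun L' h => ?_⟩
  rcases lt_or_ge L' r with h3 | h3
  · exact (key L' h h3).2.le
  · exact ((key L h1 h2).2.trans h2).le.trans h3

end MetricDistance

/-! ### Immersions into the product of a manifold with the line -/

section ProductManifold

attribute [-instance]
  Bundle.instNormedAddCommGroupOfRiemannianBundleOfIsTopologicalAddGroupOfContinuousConstSMulReal
  Bundle.instInnerProductSpaceReal

open Filter Topology

variable {E : Type*} [NormedAddCommGroup E] [NormedSpace ℝ E] [FiniteDimensional ℝ E]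
  {H : Type*} [TopologicalSpace H] {I : ModelWithCorners ℝ E H}
  {W : Type*} [TopologicalSpace W] [ChartedSpace H W]

theorem IsChartMetric.prodLineMetric [I.Boundaryless] [IsManifold I 1 W] {g : MetricField I W}
    {p : W × ℝ} {h : E → E →L[ℝ] E →L[ℝ] ℝ}
    (hg : IsChartMetric g p.1 h (extChartAt I p.1).target) :
    IsChartMetric (prodLineMetric g) p (lineProd h) ((extChartAt I p.1).target ×ˢ univ) where
  metric := hg.metric.lineProd
  eq y hy u v := by
    set τ := (extChartAt I p.1).symm with hτ
    set σ := (extChartAt (I.prod 𝓘(ℝ, ℝ)) p).symm with hσ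
    have hσe : ⇑σ = fun z : E × ℝ => (τ z.1, z.2) := by
      rw [hσ, extChartAt_prod]
      rfl
    have hτd : MDifferentiableAt 𝓘(ℝ, E) I τ y.1 :=
      ((contMDiffOn_extChartAt_symm (n := 1) p.1).contMDiffAt
        ((isOpen_extChartAt_target p.1).mem_nhds hy.1)).mdifferentiableAt one_ne_zero
    have h1 : HasMFDerivAt 𝓘(ℝ, E × ℝ) I (fun z : E × ℝ => τ z.1) y
        ((mfderiv 𝓘(ℝ, E) I τ y.1).comp (ContinuousLinearMap.fst ℝ E ℝ)) :=
      hτd.hasMFDerivAt.comp (f := Prod.fst) y hasFDerivAt_fst.hasMFDerivAt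
    have h2 : HasMFDerivAt 𝓘(ℝ, E × ℝ) 𝓘(ℝ, ℝ) (fun z : E × ℝ => z.2) y
        (ContinuousLinearMap.snd ℝ E ℝ) := hasFDerivAt_snd.hasMFDerivAt
    have h3 : ∀ u : E × ℝ, (mfderiv 𝓘(ℝ, E × ℝ) (I.prod 𝓘(ℝ, ℝ)) σ y u : E × ℝ)
        = (mfderiv 𝓘(ℝ, E) I τ y.1 u.1, u.2) := fun u => by
      rw [hσe]
      rw [(h1.prodMk h2).mfderiv]
      rfl
    rw [lineProd_apply, ← hg.eq y.1 hy.1, chartMetric, chartMetric, _root_.prodLineMetric]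
    simp only [mfderiv_fst, mfderiv_snd]
    have h4 : ∀ (q : W × ℝ) (q' : W) (_ : q.1 = q') (a b : E × ℝ) (a' b' : E × ℝ), a = a' → b = b' →
        g q.1 (a.1 : E) (b.1 : E) + a.2 * b.2
          = g q' (a'.1 : E) (b'.1 : E) + a'.2 * b'.2 := by
      rintro q _ rfl a b _ _ rfl rfl
      rfl
    exact h4 _ _ (congrArg (fun f => (f y).1) hσe) _ _ _ _ (h3 u) (h3 v)

theorem IsLocalIsometryOn.lineProd {ψ : E → E} {G h : E → E →L[ℝ] E →L[ℝ] ℝ} {V U : Set E}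
    (hψ : IsLocalIsometryOn ψ G V h U) :
    IsLocalIsometryOn (fun q : E × ℝ => (ψ q.1, q.2)) (lineProd G) (V ×ˢ univ) (lineProd h)
      (U ×ˢ univ) where
  source := hψ.source.lineProd
  target := hψ.target.lineProd
  contDiffOn := (hψ.contDiffOn.comp contDiff_fst.contDiffOn fun _ hq => hq.1).prodMk
    contDiff_snd.contDiffOn
  mapsTo _ hq := ⟨hψ.mapsTo hq.1, trivial⟩
  pull q hq a b := by
    have h1 : HasFDerivAt (fun q : E × ℝ => (ψ q.1, q.2)) _ q :=
      ((hψ.hasFDerivAt hq.1).comp q hasFDerivAt_fst).prodMk hasFDerivAt_snd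
    rw [lineProd_apply, lineProd_apply, hψ.pull q.1 hq.1, h1.fderiv]
    rfl

variable {E' : Type*} [NormedAddCommGroup E'] [NormedSpace ℝ E'] [FiniteDimensional ℝ E']
  {H' : Type*} [TopologicalSpace H'] {J : ModelWithCorners ℝ E' H'}
  {M : Type*} [TopologicalSpace M] [ChartedSpace H' M]

section TransitionMap

variable (J) in
/-- The change of coordinates from the chart at `x` to the chart at `x₁`. -/
def chartTransition (x x₁ : M) : E' → E' := extChartAt J x₁ ∘ (extChartAt J x).symm

omit [FiniteDimensional ℝ E'] in
theorem chartTransition_apply_self (x x₁ : M) :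
    chartTransition J x x₁ (extChartAt J x x) = extChartAt J x₁ x := by
  simp [chartTransition]

variable [J.Boundaryless] [IsManifold J ((⊤ : ℕ∞) : WithTop ℕ∞) M] {x x₁ : M}

omit [FiniteDimensional ℝ E'] in
theorem contDiffAt_chartTransition {x₂ : M} (hx : x₂ ∈ (extChartAt J x).source)
    (hx₁ : x₂ ∈ (extChartAt J x₁).source) : ContDiffAt ℝ ((⊤ : ℕ∞) : WithTop ℕ∞)
      (chartTransition J x x₁) (extChartAt J x x₂) := by
  refine contMDiffAt_iff_contDiffAt.1 (ContMDiffAt.comp (I' := J) (extChartAt J x x₂) ?_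
    ((contMDiffOn_extChartAt_symm x).contMDiffAt
      ((isOpen_extChartAt_target x).mem_nhds ((extChartAt J x).map_source hx))))
  rw [(extChartAt J x).left_inv hx]
  exact contMDiffAt_extChartAt' (by rwa [← extChartAt_source J])

omit [FiniteDimensional ℝ E'] [J.Boundaryless] [IsManifold J ((⊤ : ℕ∞) : WithTop ℕ∞) M] in
theorem eventually_symm_chartTransition (hx : x ∈ (extChartAt J x₁).source) :
    ∀ᶠ z in 𝓝 (extChartAt J x x),
      (extChartAt J x₁).symm (chartTransition J x x₁ z) = (extChartAt J x).symm z := by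
  have h1 : ContinuousAt (extChartAt J x).symm (extChartAt J x x) := continuousAt_extChartAt_symm x
  have h2 := h1.eventually ((isOpen_extChartAt_source x₁).mem_nhds
    (by rwa [extChartAt_to_inv x]))
  exact h2.mono fun z hz => (extChartAt J x₁).left_inv hz

omit [FiniteDimensional ℝ E'] in
theorem injective_fderiv_chartTransition (hx : x ∈ (extChartAt J x₁).source) :
    Function.Injective (fderiv ℝ (chartTransition J x x₁) (extChartAt J x x)) := by
  have h1 := contDiffAt_chartTransition (J := J) (mem_extChartAt_source (I := J) x) hx
  have h2 := contDiffAt_chartTransition (J := J) hx (mem_extChartAt_source (I := J) x)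
  rw [← chartTransition_apply_self x x₁] at h2
  have h3 : HasFDerivAt (chartTransition J x₁ x ∘ chartTransition J x x₁) _ (extChartAt J x x) :=
    (h2.differentiableAt (by simp)).hasFDerivAt.comp (extChartAt J x x)
      (h1.differentiableAt (by simp)).hasFDerivAt
  have h4 : id =ᶠ[𝓝 (extChartAt J x x)] chartTransition J x₁ x ∘ chartTransition J x x₁ := by
    filter_upwards [eventually_symm_chartTransition (J := J) hx,
      (isOpen_extChartAt_target (I := J) x).mem_nhds (mem_extChartAt_target x)] with z hz hz'
    change z = extChartAt J x ((extChartAt J x₁).symm (chartTransition J x x₁ z))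
    rw [hz, (extChartAt J x).right_inv hz']
  have h5 := (h3.congr_of_eventuallyEq h4).unique (hasFDerivAt_id _)
  refine Function.Injective.of_comp (f := fderiv ℝ (chartTransition J x₁ x)
    (chartTransition J x x₁ (extChartAt J x x))) fun a b hab => ?_
  have ha := congrArg (fun L => L a) h5
  have hb := congrArg (fun L => L b) h5
  exact ha.symm.trans (hab.trans hb)

end TransitionMap

/-- The coordinate expression of a map into `W × ℝ` in the chart at `x₁` and the chart `Φ.symm`
of `W`. -/
def lineRep (J : ModelWithCorners ℝ E' H') (Φ : OpenPartialHomeomorph E W) (φ : M → W × ℝ)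
    (x₁ : M) : E' → E × ℝ :=
  fun z => (Φ.symm (φ ((extChartAt J x₁).symm z)).1, (φ ((extChartAt J x₁).symm z)).2)

omit [NormedSpace ℝ E] [FiniteDimensional ℝ E] [FiniteDimensional ℝ E'] in
theorem lineRep_extChartAt {Φ : OpenPartialHomeomorph E W} {φ : M → W × ℝ} {x x₁ : M}
    (hx : x ∈ (extChartAt J x₁).source) :
    lineRep J Φ φ x₁ (extChartAt J x₁ x) = (Φ.symm (φ x).1, (φ x).2) := by
  rw [lineRep, (extChartAt J x₁).left_inv hx]

variable [J.Boundaryless] [IsManifold J ((⊤ : ℕ∞) : WithTop ℕ∞) M]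
  {Φ : OpenPartialHomeomorph E W} {φ : M → W × ℝ} {x x₁ : M}

omit [FiniteDimensional ℝ E] [FiniteDimensional ℝ E'] in
theorem contDiffAt_lineRep
    (hΦ : ContMDiffOn I 𝓘(ℝ, E) ((⊤ : ℕ∞) : WithTop ℕ∞) Φ.symm Φ.target)
    (hφ : ContMDiff J (I.prod 𝓘(ℝ, ℝ)) ((⊤ : ℕ∞) : WithTop ℕ∞) φ)
    (hx : x ∈ (extChartAt J x₁).source) (hxΦ : (φ x).1 ∈ Φ.target) :
    ContDiffAt ℝ ((⊤ : ℕ∞) : WithTop ℕ∞) (lineRep J Φ φ x₁) (extChartAt J x₁ x) := by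
  have h1 : ContMDiffAt 𝓘(ℝ, E') J ((⊤ : ℕ∞) : WithTop ℕ∞) (extChartAt J x₁).symm
      (extChartAt J x₁ x) :=
    (contMDiffOn_extChartAt_symm x₁).contMDiffAt
      ((isOpen_extChartAt_target x₁).mem_nhds ((extChartAt J x₁).map_source hx))
  have h2 := hφ.contMDiffAt.comp (extChartAt J x₁ x) h1
  have h3 : ContMDiffAt I 𝓘(ℝ, E) ((⊤ : ℕ∞) : WithTop ℕ∞) Φ.symm
      (φ ((extChartAt J x₁).symm (extChartAt J x₁ x))).1 := by
    rw [(extChartAt J x₁).left_inv hx]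
    exact hΦ.contMDiffAt (Φ.open_target.mem_nhds hxΦ)
  refine ContDiffAt.prodMk (contMDiffAt_iff_contDiffAt.1 ?_) (contMDiffAt_iff_contDiffAt.1 ?_)
  · exact ContMDiffAt.comp (I' := I) (g := Φ.symm) (extChartAt J x₁ x) h3
      (contMDiffAt_fst.comp (extChartAt J x₁ x) h2)
  · exact contMDiffAt_snd.comp (extChartAt J x₁ x) h2

variable [I.Boundaryless] [IsManifold I ((⊤ : ℕ∞) : WithTop ℕ∞) W]
  {g : MetricField I W} {h : W → E → E →L[ℝ] E →L[ℝ] ℝ} {G : E → E →L[ℝ] E →L[ℝ] ℝ}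

omit [FiniteDimensional ℝ E] [FiniteDimensional ℝ E'] [I.Boundaryless] [J.Boundaryless]
  [IsManifold J ((⊤ : ℕ∞) : WithTop ℕ∞) M] [IsManifold I ((⊤ : ℕ∞) : WithTop ℕ∞) W] in
-- The mean curvature at `x` is defined in the preferred charts at `x` and `φ x`. This factorisation
-- compares them with one fixed source chart and normal coordinates in the target, so that both
-- invariance properties of `flatMeanCurvature` apply.
theorem chartRep_eventuallyEq
    (hφ : ContMDiff J (I.prod 𝓘(ℝ, ℝ)) ((⊤ : ℕ∞) : WithTop ℕ∞) φ)
    (hx : x ∈ (extChartAt J x₁).source) (hxΦ : (φ x).1 ∈ Φ.target) :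
    chartRep J (I.prod 𝓘(ℝ, ℝ)) φ x =ᶠ[𝓝 (extChartAt J x x)]
      ((fun q : E × ℝ => ((extChartAt I (φ x).1 ∘ Φ) q.1, q.2)) ∘ lineRep J Φ φ x₁)
        ∘ chartTransition J x x₁ := by
  have h1 : ContinuousAt (fun z => (φ ((extChartAt J x).symm z)).1) (extChartAt J x x) := by
    have h2 : ContinuousAt φ ((extChartAt J x).symm (extChartAt J x x)) :=
      hφ.continuous.continuousAt
    exact continuousAt_fst.comp (h2.comp (continuousAt_extChartAt_symm x))
  filter_upwards [eventually_symm_chartTransition (J := J) hx,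
    h1.eventually (Φ.open_target.mem_nhds (by simpa only [extChartAt_to_inv x] using hxΦ))] with z hz hz'
  simp only [chartRep, Function.comp_apply, lineRep, hz, extChartAt_prod, PartialEquiv.prod_coe,
    Φ.right_inv hz']
  rfl

omit [FiniteDimensional ℝ E] [I.Boundaryless] [IsManifold I ((⊤ : ℕ∞) : WithTop ℕ∞) W] in
-- The differential of `φ` factors through these maps, with the surjective differential of the chart
-- transition on the right, so injectivity passes to the factors.
theorem injective_fderiv_lineRep
    (hΦ : ContMDiffOn 𝓘(ℝ, E) I ((⊤ : ℕ∞) : WithTop ℕ∞) Φ Φ.source)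
    (hΦ' : ContMDiffOn I 𝓘(ℝ, E) ((⊤ : ℕ∞) : WithTop ℕ∞) Φ.symm Φ.target)
    (hφ : IsSmoothImmersion J (I.prod 𝓘(ℝ, ℝ)) φ)
    (hx : x ∈ (extChartAt J x₁).source) (hxΦ : (φ x).1 ∈ Φ.target) :
    Function.Injective (fderiv ℝ (lineRep J Φ φ x₁) (extChartAt J x₁ x)) ∧
    Function.Injective (fderiv ℝ ((fun q : E × ℝ => ((extChartAt I (φ x).1 ∘ Φ) q.1, q.2))
      ∘ lineRep J Φ φ x₁) (extChartAt J x₁ x)) := by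
  set z := extChartAt J x₁ x with hz
  have hF := contDiffAt_lineRep hΦ' hφ.1 hx hxΦ
  have hψ : DifferentiableAt ℝ (fun q : E × ℝ => ((extChartAt I (φ x).1 ∘ Φ) q.1, q.2))
      (lineRep J Φ φ x₁ z) := by
    have h1 : (lineRep J Φ φ x₁ z).1 = Φ.symm (φ x).1 := by rw [hz, lineRep_extChartAt hx]
    have h2 : ContDiffAt ℝ ((⊤ : ℕ∞) : WithTop ℕ∞) (extChartAt I (φ x).1 ∘ Φ)
        (lineRep J Φ φ x₁ z).1 := by
      rw [h1]
      refine contMDiffAt_iff_contDiffAt.1 (ContMDiffAt.comp (I' := I) _ ?_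
        (hΦ.contMDiffAt (Φ.open_source.mem_nhds (Φ.map_target hxΦ))))
      rw [Φ.right_inv hxΦ]
      exact contMDiffAt_extChartAt
    have h3 : DifferentiableAt ℝ (extChartAt I (φ x).1 ∘ Φ) (lineRep J Φ φ x₁ z).1 :=
      h2.differentiableAt (by simp)
    exact (h3.comp (lineRep J Φ φ x₁ z) differentiableAt_fst).prodMk differentiableAt_snd
  have hc : DifferentiableAt ℝ ((fun q : E × ℝ => ((extChartAt I (φ x).1 ∘ Φ) q.1, q.2))
      ∘ lineRep J Φ φ x₁) z := hψ.comp z (hF.differentiableAt (by simp))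
  have hθ := contDiffAt_chartTransition (J := J) (mem_extChartAt_source (I := J) x) hx
  have hθz : chartTransition J x x₁ (extChartAt J x x) = z := chartTransition_apply_self x x₁
  have hinj : Function.Injective (fderiv ℝ (chartRep J (I.prod 𝓘(ℝ, ℝ)) φ x) (extChartAt J x x)) := by
    rw [← mfderiv_eq_fderiv_chartRep (hφ.1.mdifferentiable (by simp) x)]
    exact hφ.2 x
  rw [(chartRep_eventuallyEq hφ.1 hx hxΦ).fderiv_eq, fderiv_comp _ (by rwa [hθz])
    (hθ.differentiableAt (by simp)), hθz] at hinj
  have hsurj : Function.Surjective (fderiv ℝ (chartTransition J x x₁) (extChartAt J x x)) :=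
    (LinearMap.injective_iff_surjective (f := (fderiv ℝ (chartTransition J x x₁)
      (extChartAt J x x) : E' →ₗ[ℝ] E'))).1 (injective_fderiv_chartTransition hx)
  have h2 := Function.Injective.of_comp_right (f := fderiv ℝ
    ((fun q : E × ℝ => ((extChartAt I (φ x).1 ∘ Φ) q.1, q.2)) ∘ lineRep J Φ φ x₁) z) hinj hsurj
  refine ⟨?_, h2⟩
  rw [fderiv_comp _ hψ (hF.differentiableAt (by simp))] at h2
  exact Function.Injective.of_comp (f := fderiv ℝ
    (fun q : E × ℝ => ((extChartAt I (φ x).1 ∘ Φ) q.1, q.2)) (lineRep J Φ φ x₁ z)) h2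

/-- The length of the mean curvature vector of an immersion into `W × ℝ`, in a chart of `W`. -/
theorem meanCurvatureNorm_prodLineMetric_eq
    (hchart : ∀ p, IsChartMetric g p (h p) (extChartAt I p).target)
    (hiso : ∀ p, IsLocalIsometryOn (extChartAt I p ∘ Φ) G
      (Φ.source ∩ Φ ⁻¹' (extChartAt I p).source) (h p) (extChartAt I p).target)
    (hΦ : ContMDiffOn 𝓘(ℝ, E) I ((⊤ : ℕ∞) : WithTop ℕ∞) Φ Φ.source)
    (hΦ' : ContMDiffOn I 𝓘(ℝ, E) ((⊤ : ℕ∞) : WithTop ℕ∞) Φ.symm Φ.target)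
    (hφ : IsSmoothImmersion J (I.prod 𝓘(ℝ, ℝ)) φ)
    (hx : x ∈ (extChartAt J x₁).source) (hxΦ : (φ x).1 ∈ Φ.target) :
    meanCurvatureNorm J (prodLineMetric g) φ x =
      √(lineProd G (lineRep J Φ φ x₁ (extChartAt J x₁ x))
        (flatMeanCurvature (lineProd G) (lineRep J Φ φ x₁) (extChartAt J x₁ x))
        (flatMeanCurvature (lineProd G) (lineRep J Φ φ x₁) (extChartAt J x₁ x))) := by
  have hiso' := (hiso (φ x).1).lineProd
  have hchart' := (hchart (φ x).1).prodLineMetric (p := φ x)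
  have hev := chartRep_eventuallyEq (I := I) (J := J) hφ.1 hx hxΦ
  have hinj := (injective_fderiv_lineRep hΦ hΦ' hφ hx hxΦ).2
  have hF := contDiffAt_lineRep hΦ' hφ.1 hx hxΦ
  have hθ := contDiffAt_chartTransition (J := J) (mem_extChartAt_source (I := J) x) hx
  have hθi := injective_fderiv_chartTransition (J := J) hx
  have hθz := chartTransition_apply_self (J := J) x x₁
  set Ψ : E × ℝ → E × ℝ := fun q : E × ℝ => ((extChartAt I (φ x).1 ∘ Φ) q.1, q.2) with hΨ
  set F := lineRep J Φ φ x₁ with hFdef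
  set z := extChartAt J x₁ x with hz
  have hFz : F z ∈ (Φ.source ∩ Φ ⁻¹' (extChartAt I (φ x).1).source) ×ˢ univ := by
    rw [hFdef, hz, lineRep_extChartAt hx]
    refine ⟨⟨Φ.map_target hxΦ, ?_⟩, trivial⟩
    change Φ (Φ.symm (φ x).1) ∈ (extChartAt I (φ x).1).source
    rw [Φ.right_inv hxΦ]
    exact mem_extChartAt_source _
  have hΨF : ContDiffAt ℝ ((⊤ : ℕ∞) : WithTop ℕ∞) (Ψ ∘ F) z := (hiso'.contDiffAt hFz).comp z hF
  have hval : chartRep J (I.prod 𝓘(ℝ, ℝ)) φ x (extChartAt J x x) = Ψ (F z) := by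
    rw [hev.eq_of_nhds, ← hθz]
    rfl
  have hmean : flatMeanCurvature (lineProd (h (φ x).1)) (chartRep J (I.prod 𝓘(ℝ, ℝ)) φ x)
      (extChartAt J x x) = fderiv ℝ Ψ (F z) (flatMeanCurvature (lineProd G) F z) := by
    -- First the change of target coordinates `Ψ` is absorbed by isometry invariance, then the
    -- change of source chart by reparametrisation invariance.
    rw [flatMeanCurvature_congr _ hev, ← hiso'.flatMeanCurvature_comp hFz hF, ← hθz]
    refine hiso'.target.flatMeanCurvature_comp ?_ ?_ hθ ?_ hθi
    · rw [hθz]; exact hiso'.mapsTo hFz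
    · rwa [hθz]
    · rwa [hθz]
  rw [meanCurvatureNorm_eq hchart' ?_ hφ.1.contMDiffAt, hmean, hval, ← hiso'.pull _ hFz]
  rw [extChartAt_prod]
  exact ⟨mem_extChartAt_target _, trivial⟩

/-- The charts used to define the mean curvature vary with the point, so continuity is read off from
the formula in one fixed chart near `x₁`. On compact `M` it ensures that the supremum of `|H|` is
over a bounded set. -/
theorem continuous_meanCurvatureNorm
    (hchart : ∀ p, IsChartMetric g p (h p) (extChartAt I p).target)
    (hiso : ∀ p, IsLocalIsometryOn (extChartAt I p ∘ Φ) G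
      (Φ.source ∩ Φ ⁻¹' (extChartAt I p).source) (h p) (extChartAt I p).target)
    (hG : IsMetricOn G Φ.source)
    (hΦ : ContMDiffOn 𝓘(ℝ, E) I ((⊤ : ℕ∞) : WithTop ℕ∞) Φ Φ.source)
    (hΦ' : ContMDiffOn I 𝓘(ℝ, E) ((⊤ : ℕ∞) : WithTop ℕ∞) Φ.symm Φ.target)
    (hφ : IsSmoothImmersion J (I.prod 𝓘(ℝ, ℝ)) φ) (hφΦ : ∀ x, (φ x).1 ∈ Φ.target) :
    Continuous (meanCurvatureNorm J (prodLineMetric g) φ) := by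
  refine continuous_iff_continuousAt.2 fun x₁ => ?_
  have hx₁ : x₁ ∈ (extChartAt J x₁).source := mem_extChartAt_source x₁
  have hF := contDiffAt_lineRep hΦ' hφ.1 hx₁ (hφΦ x₁)
  have hFz : lineRep J Φ φ x₁ (extChartAt J x₁ x₁) ∈ Φ.source ×ˢ univ := by
    rw [lineRep_extChartAt hx₁]
    exact ⟨Φ.map_target (hφΦ x₁), trivial⟩
  have h1 := hG.lineProd.continuousAt_flatMeanCurvature hFz hF
    (injective_fderiv_lineRep hΦ hΦ' hφ hx₁ (hφΦ x₁)).1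
  have h2 : ContinuousAt (fun z => lineProd G (lineRep J Φ φ x₁ z)) (extChartAt J x₁ x₁) :=
    ContinuousAt.comp (f := lineRep J Φ φ x₁) (g := lineProd G)
      (hG.lineProd.contDiffAt hFz).continuousAt hF.continuousAt
  have h3 : ContinuousAt (fun z => √(lineProd G (lineRep J Φ φ x₁ z)
      (flatMeanCurvature (lineProd G) (lineRep J Φ φ x₁) z)
      (flatMeanCurvature (lineProd G) (lineRep J Φ φ x₁) z))) (extChartAt J x₁ x₁) :=
    ((h2.clm_apply h1).clm_apply h1).sqrt
  refine (h3.comp (f := extChartAt J x₁) (continuousAt_extChartAt x₁)).congr ?_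
  filter_upwards [(isOpen_extChartAt_source (I := J) x₁).mem_nhds hx₁] with x hx
  exact (meanCurvatureNorm_prodLineMetric_eq hchart hiso hΦ hΦ' hφ hx (hφΦ x)).symm

end ProductManifold

/-! ### The extrinsic radius of an immersion -/

section ExtrinsicRadius

variable {X : Type*} [MetricSpace X] {A : Set X}

theorem subset_closedBall_extrinsicRadiusAt (hA : Bornology.IsBounded A) (x₀ : X) :
    A ⊆ Metric.closedBall x₀ (extrinsicRadiusAt x₀ A) := fun _ hp =>
  le_csInf (s := {r : ℝ | A ⊆ Metric.closedBall x₀ r}) (hA.subset_closedBall x₀) fun _ hr => hr hp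

theorem extrinsicRadiusAt_le (hA : A.Nonempty) {x₀ : X} {r : ℝ}
    (h : A ⊆ Metric.closedBall x₀ r) : extrinsicRadiusAt x₀ A ≤ r :=
  csInf_le (s := {r : ℝ | A ⊆ Metric.closedBall x₀ r})
    ⟨0, fun _ hr => dist_nonneg.trans (hr hA.some_mem)⟩ h

theorem exists_extrinsicRadiusAt_lt (hA : Bornology.IsBounded A) (hne : A.Nonempty) {R : ℝ}
    (hR : extrinsicRadius A < R) : ∃ x : X, extrinsicRadiusAt x A < R := by
  obtain ⟨r, ⟨x, hx⟩, hr⟩ := exists_lt_of_csInf_lt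
    (s := {r : ℝ | ∃ x : X, A ⊆ Metric.closedBall x r})
    ((hA.subset_closedBall hne.some).imp fun _ h => ⟨hne.some, h⟩) hR
  exact ⟨x, (extrinsicRadiusAt_le hne hx).trans_lt hr⟩

end ExtrinsicRadius

/-! ### The radius estimate -/

section RadiusEstimate

variable {E : Type*} [NormedAddCommGroup E] [NormedSpace ℝ E] [FiniteDimensional ℝ E]
  {H : Type*} [TopologicalSpace H] {I : ModelWithCorners ℝ E H} [I.Boundaryless]
  {N : Type*} [MetricSpace N] [ChartedSpace H N] [IsManifold I ((⊤ : ℕ∞) : WithTop ℕ∞) N]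
  [RiemannianBundle (fun x : N => TangentSpace I x)]
  [IsContMDiffRiemannianBundle I ((⊤ : ℕ∞) : WithTop ℕ∞) E (fun x : N => TangentSpace I x)]
  [IsRiemannianManifold I N]
  {E' : Type*} [NormedAddCommGroup E'] [NormedSpace ℝ E'] [FiniteDimensional ℝ E']
  {H' : Type*} [TopologicalSpace H'] {J : ModelWithCorners ℝ E' H'} [J.Boundaryless]
  {M : Type*} [TopologicalSpace M] [CompactSpace M] [Nonempty M] [ChartedSpace H' M]
  [IsManifold J ((⊤ : ℕ∞) : WithTop ℕ∞) M] {φ : M → N × ℝ}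

/-- The radius estimate for the ball centred at a given point. -/
theorem ctInv_le_extrinsicRadiusAt (hm : 3 ≤ Module.finrank ℝ E')
    (hφ : IsSmoothImmersion J (I.prod 𝓘(ℝ, ℝ)) φ) {κ : ℝ} {x₀ : N}
    (hκ : RadialCurvatureLE (riemannianMetric I N) x₀ κ)
    (hinj : ENNReal.ofReal (extrinsicRadiusAt x₀ (Prod.fst '' range φ)) <
      injRadius (riemannianMetric I N) x₀) :
    supMeanCurvature J (prodLineMetric (riemannianMetric I N)) φ
        / ((Module.finrank ℝ E' : ℝ) - 2) ∈ ctK κ '' ctDomain κ ∧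
    ctInv κ (supMeanCurvature J (prodLineMetric (riemannianMetric I N)) φ
        / ((Module.finrank ℝ E' : ℝ) - 2)) ≤ extrinsicRadiusAt x₀ (Prod.fst '' range φ) := by
  set R := extrinsicRadiusAt x₀ (Prod.fst '' range φ) with hRdef
  have hφc : Continuous fun x => (φ x).1 := continuous_fst.comp hφ.1.continuous
  have hbdd : Bornology.IsBounded (Prod.fst '' range φ) :=
    ((isCompact_range hφ.1.continuous).image continuous_fst).isBounded
  have hdist : ∀ x, dist x₀ (φ x).1 ≤ R := fun x => by
    rw [dist_comm]
    exact subset_closedBall_extrinsicRadiusAt hbdd x₀ ⟨φ x, mem_range_self x, rfl⟩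
  obtain ⟨r, hr⟩ := lt_iSup_iff.1 hinj
  obtain ⟨⟨hr0, hrn⟩, hRr'⟩ := lt_iSup_iff.1 hr
  have hRr : R < r := (ENNReal.ofReal_lt_ofReal_iff hr0).1 hRr'
  obtain ⟨Φ, hΦ, hΦ', hΦ0, hball, hG, hcurv⟩ := exists_isNormalMetric hr0 hrn
  have hfin := hcurv κ hκ
  have hmem : ∀ x, (φ x).1 ∈ Φ.target ∧
      √(pullForm I Φ 0 (Φ.symm (φ x).1) (Φ.symm (φ x).1)) ≤ R := fun x => by
    have h := hG.mem_target_of_dist_lt hΦ hΦ' hball (p := (φ x).1)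
      (by rw [hΦ0]; exact (hdist x).trans_lt hRr)
    rw [hΦ0] at h
    exact ⟨h.1, h.2.trans (hdist x)⟩
  have hφΦ : ∀ x, (φ x).1 ∈ Φ.target := fun x => (hmem x).1
  set G := pullForm I Φ with hGdef
  have hsymm : Continuous fun x => Φ.symm (φ x).1 :=
    Φ.continuousOn_symm.comp_continuous hφc hφΦ
  have hfc : Continuous fun x => G 0 (Φ.symm (φ x).1) (Φ.symm (φ x).1) := by fun_prop
  -- The point of `M` whose projection is farthest from `x₀`, measured by the radial coordinate.
  obtain ⟨x₁, -, hmax⟩ := isCompact_univ.exists_isMaxOn univ_nonempty hfc.continuousOn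
  have hmax' : ∀ x, G 0 (Φ.symm (φ x).1) (Φ.symm (φ x).1)
      ≤ G 0 (Φ.symm (φ x₁).1) (Φ.symm (φ x₁).1) := fun x => hmax (mem_univ x)
  have hx₁ : x₁ ∈ (extChartAt J x₁).source := mem_extChartAt_source x₁
  have hF1 : (lineRep J Φ φ x₁ (extChartAt J x₁ x₁)).1 = Φ.symm (φ x₁).1 := by
    rw [lineRep_extChartAt hx₁]
  have hFs := contDiffAt_lineRep hΦ' hφ.1 hx₁ (hφΦ x₁)
  have hFi := (injective_fderiv_lineRep hΦ.smooth hΦ' hφ hx₁ (hφΦ x₁)).1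
  -- If the largest radius were `0`, all of `p₁(M)` would be the point `x₀`, and the differential of
  -- the immersion would take values in the line, against `m ≥ 3`.
  have hpos : 0 < √(G 0 (Φ.symm (φ x₁).1) (Φ.symm (φ x₁).1)) := by
    rw [Real.sqrt_pos]
    by_contra hcon
    have hzero : ∀ x, Φ.symm (φ x).1 = 0 := fun x => by
      by_contra hne
      exact hcon ((hG.metric.pos 0 hG.zero_mem _ hne).trans_le (hmax' x))
    have h1 : Module.finrank ℝ E' ≤ 1 := by
      refine finrank_le_one_of_fst_eq_zero hFi fun a => ?_
      have h2 : HasFDerivAt (fun z => (lineRep J Φ φ x₁ z).1) _ (extChartAt J x₁ x₁) :=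
        ((hFs.differentiableAt (by simp)).hasFDerivAt).fst
      have h3 : (fun z => (lineRep J Φ φ x₁ z).1) = fun _ => (0 : E) :=
        funext fun z => hzero _
      rw [h3] at h2
      exact congrArg (fun L => L a) (h2.unique (hasFDerivAt_const (0 : E) _))
    omega
  have hm2 : (0 : ℝ) < (Module.finrank ℝ E' : ℝ) - 2 := by
    have : (3 : ℝ) ≤ Module.finrank ℝ E' := by exact_mod_cast hm
    linarith
  have hchart := fun p : N => isChartMetric_pullForm (I := I) p
  have hiso := fun p : N => hΦ.isLocalIsometryOn_chart p
  have hcont := continuous_meanCurvatureNorm hchart hiso hΦ.isMetricOn hΦ.smooth hΦ' hφ hφΦ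
  have hsup : meanCurvatureNorm J (prodLineMetric (riemannianMetric I N)) φ x₁
      ≤ supMeanCurvature J (prodLineMetric (riemannianMetric I N)) φ :=
    le_ciSup (isCompact_range hcont).bddAbove x₁
  refine ctInv_le_of_ctK_le (div_nonneg (Real.iSup_nonneg fun _ => Real.sqrt_nonneg _) hm2.le)
    hpos (hmem x₁).2 fun hρ => ?_
  rw [le_div_iff₀ hm2]
  refine le_trans ?_ hsup
  rw [meanCurvatureNorm_prodLineMetric_eq hchart hiso hΦ.smooth hΦ' hφ hx₁ (hφΦ x₁)]
  rw [← hF1] at hρ ⊢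
  refine hG.ctK_mul_le_flatMeanCurvature hfin ?_ hFs hFi ?_ hρ (by omega)
  · rw [hF1, ← hball]
    exact Φ.map_target (hφΦ x₁)
  · refine Filter.Eventually.of_forall fun z => ?_
    beta_reduce
    rw [hF1]
    exact hmax' _

/-- The radius estimate for balls of any centre. -/
theorem ctInv_le_extrinsicRadius (hm : 3 ≤ Module.finrank ℝ E')
    (hφ : IsSmoothImmersion J (I.prod 𝓘(ℝ, ℝ)) φ) {κ : ℝ}
    (hκ : ∀ x : N, RadialCurvatureLE (riemannianMetric I N) x κ)
    (hinj : ENNReal.ofReal (extrinsicRadius (Prod.fst '' range φ)) <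
      ⨅ x : N, injRadius (riemannianMetric I N) x) :
    supMeanCurvature J (prodLineMetric (riemannianMetric I N)) φ
        / ((Module.finrank ℝ E' : ℝ) - 2) ∈ ctK κ '' ctDomain κ ∧
    ctInv κ (supMeanCurvature J (prodLineMetric (riemannianMetric I N)) φ
        / ((Module.finrank ℝ E' : ℝ) - 2)) ≤ extrinsicRadius (Prod.fst '' range φ) := by
  have hbdd : Bornology.IsBounded (Prod.fst '' range φ) :=
    ((isCompact_range hφ.1.continuous).image continuous_fst).isBounded
  have hne : (Prod.fst '' range φ).Nonempty := (range_nonempty φ).image _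
  -- The infimum over centres need not be attained. The room up to `R` allows nearly optimal centres
  -- whose radius is still below the injectivity radius; their radii are then sent to the infimum.
  obtain ⟨R, -, hR1, hR2⟩ := ENNReal.lt_iff_exists_real_btwn.1 hinj
  have hR := (ENNReal.ofReal_lt_ofReal_iff'.1 hR1).1
  have key : ∀ a, extrinsicRadius (Prod.fst '' range φ) < a → a ≤ R →
      supMeanCurvature J (prodLineMetric (riemannianMetric I N)) φ
        / ((Module.finrank ℝ E' : ℝ) - 2) ∈ ctK κ '' ctDomain κ ∧
      ctInv κ (supMeanCurvature J (prodLineMetric (riemannianMetric I N)) φ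
        / ((Module.finrank ℝ E' : ℝ) - 2)) ≤ a := fun a ha haR => by
    obtain ⟨x, hx⟩ := exists_extrinsicRadiusAt_lt hbdd hne ha
    have h := ctInv_le_extrinsicRadiusAt hm hφ (hκ x)
      (((ENNReal.ofReal_le_ofReal (hx.le.trans haR)).trans_lt hR2).trans_le (iInf_le _ x))
    exact ⟨h.1, h.2.trans hx.le⟩
  refine ⟨(key R hR le_rfl).1, le_of_forall_gt_imp_ge_of_dense fun a ha => ?_⟩
  exact (key (min a R) (lt_min ha hR) (min_le_right _ _)).2.trans (min_le_left _ _)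

end RadiusEstimate

end

theorem mainTheorem4
    {n m : ℕ} (hm : 3 ≤ m)
    -- a complete `n`-dimensional Riemannian manifold
    {N : Type*} [MetricSpace N] [CompleteSpace N]
    [ChartedSpace (EuclideanSpace ℝ (Fin n)) N] [IsManifold (𝓡 n) ∞ N]
    [RiemannianBundle (fun x : N => TangentSpace (𝓡 n) x)]
    [IsContMDiffRiemannianBundle (𝓡 n) ∞ (EuclideanSpace ℝ (Fin n))
      (fun x : N => TangentSpace (𝓡 n) x)]
    [IsRiemannianManifold (𝓡 n) N]
    -- a compact `m`-dimensional immersed submanifold of `N × ℝ`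
    {M : Type*} [TopologicalSpace M] [T2Space M] [CompactSpace M] [Nonempty M]
    [ChartedSpace (EuclideanSpace ℝ (Fin m)) M] [IsManifold (𝓡 m) ∞ M]
    (φ : M → N × ℝ) (hφ : IsSmoothImmersion (𝓡 m) ((𝓡 n).prod 𝓘(ℝ, ℝ)) φ)
    (κ : ℝ) :
    -- the ball centred at a given point `x₀`
    (∀ x₀ : N, RadialCurvatureLE (riemannianMetric (𝓡 n) N) x₀ κ →
      ENNReal.ofReal (extrinsicRadiusAt x₀ (Prod.fst '' range φ)) <
        injRadius (riemannianMetric (𝓡 n) N) x₀ →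
      supMeanCurvature (𝓡 m) (prodLineMetric (riemannianMetric (𝓡 n) N)) φ / ((m : ℝ) - 2)
        ∈ ctK κ '' ctDomain κ ∧
      ctInv κ (supMeanCurvature (𝓡 m) (prodLineMetric (riemannianMetric (𝓡 n) N)) φ
        / ((m : ℝ) - 2)) ≤ extrinsicRadiusAt x₀ (Prod.fst '' range φ)) ∧
    -- the smallest ball of any centre
    ((∀ x : N, RadialCurvatureLE (riemannianMetric (𝓡 n) N) x κ) →
      ENNReal.ofReal (extrinsicRadius (Prod.fst '' range φ)) <
        ⨅ x : N, injRadius (riemannianMetric (𝓡 n) N) x →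
      supMeanCurvature (𝓡 m) (prodLineMetric (riemannianMetric (𝓡 n) N)) φ / ((m : ℝ) - 2)
        ∈ ctK κ '' ctDomain κ ∧
      ctInv κ (supMeanCurvature (𝓡 m) (prodLineMetric (riemannianMetric (𝓡 n) N)) φ
        / ((m : ℝ) - 2)) ≤ extrinsicRadius (Prod.fst '' range φ)) := by
  have h : Module.finrank ℝ (EuclideanSpace ℝ (Fin m)) = m := finrank_euclideanSpace_fin
  refine ⟨fun x₀ hκ hinj => ?_, fun hκ hinj => ?_⟩
  · have := ctInv_le_extrinsicRadiusAt (h.symm ▸ hm) hφ hκ hinj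
    rwa [h] at this
  · have := ctInv_le_extrinsicRadius (h.symm ▸ hm) hφ hκ hinj
    rwa [h] at this
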